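/- Let $\{X_t\}_{t\in\mathbb Z}$ be a real-valued time series with $\mathrm E[X_t]=0$ and $\mathrm E|X_t|^8<\infty$ that is $8$th-order stationary, i.e. all its joint moments $\mathrm E[X_{t_1}\cdots X_{t_n}]$ with $n\le 8$ are invariant under time shifts. Put $c(j)=\mathrm{cov}(X_t,X_{t+j})$ and $\kappa_s(j_1,\ldots,j_{s-1})=\mathrm{cum}(X_t,X_{t+j_1},\ldots,X_{t+j_{s-1}})$, and assume that for all $2\le s\le 8$ and $1\le i\le s-1$ \[\sum_{j_1,\ldots,j_{s-1}\in\mathbb Z}(1+|j_i|)\,|\kappa_s(j_1,\ldots,j_{s-1})|<\infty .\] Let $f(\omega)=\frac1{2\pi}\sum_{j\in\mathbb Z}c(j)e^{ij\omega}$ and $f_4(\omega_1,\omega_2,\omega_3)=\frac1{(2\pi)^3}\sum_{j_1,j_2,j_3\in\mathbb Z}\kappa_4(j_1,j_2,j_3)e^{i(j_1\omega_1+j_2\omega_2+j_3\omega_3)}$. Let $\phi:[0,2\pi]\to\mathbb C$ be Lipschitz continuous, and read $\phi(-\omega)$ as the value of its $2\pi$-periodic extension, i.e. $\phi(2\pi-\omega)$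 for $\omega\in[0,2\pi]$. Define \[V(0)=\frac1{2\pi}\int_0^{2\pi}f(\omega)^2\Big(|\phi(\omega)|^2+\phi(\omega)\overline{\phi(-\omega)}\Big)d\omega+\frac1{2\pi}\int_0^{2\pi}\!\!\int_0^{2\pi}\phi(\omega_1)\overline{\phi(\omega_2)}f_4(\omega_1,-\omega_1,-\omega_2)\,d\omega_1d\omega_2 ,\] and, for integers $T,M\ge1$, with $\omega_k=2\pi k/T$ and $J_T(\omega)=(2\pi T)^{-1/2}\sum_{t=1}^TX_te^{it\omega}$, \[A_T(\phi;r)=\frac1T\sum_{k=1}^T\phi(\omega_k)J_T(\omega_k)\overline{J_T(\omega_{k+r})},\qquad \widehat V_M(0)=\frac TM\sum_{r=1}^M|A_T(\phi;r)|^2 .\] Then $\widehat V_M(0)$ is square integrable, and there is a finite constant $K$, not depending on $T$ or $M$, such that for all integers $T\ge1$ and $M\ge1$ \[\big|\mathrm E[\widehat V_M(0)]-V(0)\big|\le K\,\frac MT\qquad\text{and}\qquad \mathrm E\big|\widehat V_M(0)-V(0)\big|^2\le K\Big(\frac{M^2}{T^2}+\frac1M\Big).\] -/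

import Mathlib

open MeasureTheory ProbabilityTheory
open scoped ENNReal NNReal

namespace OrthogonalSample

noncomputable section

/-- The joint cumulant of `Y 0, …, Y (n-1)`: the sum over all set partitions `π` of the index set of
`(-1)^(|π|-1) (|π|-1)! ∏_{B ∈ π} E[∏_{i ∈ B} Y i]`. -/
def jointCumulant {Ω : Type*} [MeasurableSpace Ω] (P : Measure Ω) {n : ℕ}
    (Y : Fin n → Ω → ℝ) : ℝ :=
  ∑ π : Finpartition (Finset.univ : Finset (Fin n)),
    (-1) ^ (π.parts.card - 1) * ((π.parts.card - 1).factorial : ℝ) *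
      ∏ B ∈ π.parts, ∫ x, ∏ i ∈ B, Y i x ∂P

/-- The cumulant `κ_{m+1}(j_1, …, j_m) = cum(X_0, X_{j_1}, …, X_{j_m})` of order `m + 1`. Under the
stationarity assumed below it is equal to `cum(X_t, X_{t+j_1}, …, X_{t+j_m})` for every `t`. -/
def kappa {Ω : Type*} [MeasurableSpace Ω] (P : Measure Ω) (X : ℤ → Ω → ℝ) {m : ℕ}
    (j : Fin m → ℤ) : ℝ :=
  jointCumulant P (fun i : Fin (m + 1) => X ((Fin.cons 0 j : Fin (m + 1) → ℤ) i))

/-- `p`-th order stationarity, finite `p`-th moments and summability of the cumulants of the orders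
`s = m + 1` with `2 ≤ s ≤ p`, weighted with `1 + |j_i|` for each of the lags `j_1, …, j_{s-1}`. -/
structure StationaryCumulantCondition {Ω : Type*} [MeasurableSpace Ω] (P : Measure Ω)
    (X : ℤ → Ω → ℝ) (p : ℕ) : Prop where
  memLp : ∀ t : ℤ, MemLp (X t) (p : ℝ≥0∞) P
  moment_shift : ∀ n : ℕ, n ≤ p → ∀ (t : Fin n → ℤ) (h : ℤ),
    ∫ x, ∏ i, X (t i + h) x ∂P = ∫ x, ∏ i, X (t i) x ∂P
  summable_kappa : ∀ m : ℕ, 1 ≤ m → m + 1 ≤ p → ∀ i : Fin m,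
    Summable (fun j : Fin m → ℤ => (1 + |(j i : ℝ)|) * |kappa P X j|)

/-- The spectral density `f(ω) = (2π)⁻¹ ∑_{j ∈ ℤ} c(j) e^{ijω}` with `c(j) = cov(X_0, X_j)`. -/
def spectralDensity {Ω : Type*} [MeasurableSpace Ω] (P : Measure Ω) (X : ℤ → Ω → ℝ)
    (ω : ℝ) : ℂ :=
  (1 / (2 * Real.pi) : ℂ) *
    ∑' j : ℤ, (cov[X 0, X j; P] : ℂ) * Complex.exp (Complex.I * (j : ℂ) * (ω : ℂ))

/-- The spectral density of order `s = m + 1`,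
`f_s(ω_1, …, ω_m) = (2π)^{-(s-1)} ∑_{j ∈ ℤ^m} κ_s(j_1, …, j_m) e^{i(j_1 ω_1 + ⋯ + j_m ω_m)}`. -/
def higherSpectralDensity {Ω : Type*} [MeasurableSpace Ω] (P : Measure Ω) (X : ℤ → Ω → ℝ)
    {m : ℕ} (ω : Fin m → ℝ) : ℂ :=
  (1 / (2 * Real.pi) ^ m : ℂ) *
    ∑' j : Fin m → ℤ,
      (kappa P X j : ℂ) * Complex.exp (Complex.I * ∑ i, (j i : ℂ) * (ω i : ℂ))

/-- The Fourier frequency `ω_k = 2πk/T`. -/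
def freq (T : ℕ) (k : ℤ) : ℝ := 2 * Real.pi * (k : ℝ) / (T : ℝ)

/-- The discrete Fourier transform `J_T(ω) = (2πT)^{-1/2} ∑_{t=1}^T X_t e^{itω}`. -/
def dft {Ω : Type*} (X : ℤ → Ω → ℝ) (T : ℕ) (ω : ℝ) (x : Ω) : ℂ :=
  (1 / (Real.sqrt (2 * Real.pi * (T : ℝ)) : ℂ)) *
    ∑ t ∈ Finset.Icc 1 T, (X (t : ℤ) x : ℂ) * Complex.exp (Complex.I * (t : ℂ) * (ω : ℂ))

/-- `A_T(φ; r) = T⁻¹ ∑_{k=1}^T φ(ω_k) J_T(ω_k) \overline{J_T(ω_{k+r})}`. Here `ω_k ∈ (0, 2π]`. -/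
def orthSample {Ω : Type*} (X : ℤ → Ω → ℝ) (φ : ℝ → ℂ) (T : ℕ) (r : ℤ) (x : Ω) : ℂ :=
  (1 / (T : ℂ)) *
    ∑ k ∈ Finset.Icc 1 T, φ (freq T (k : ℤ)) * dft X T (freq T (k : ℤ)) x *
      (starRingEnd ℂ) (dft X T (freq T ((k : ℤ) + r)) x)

/-- The variance estimator `V̂_M(0) = (T/M) ∑_{r=1}^M |A_T(φ; r)|²`. -/
def varEstimator {Ω : Type*} (X : ℤ → Ω → ℝ) (φ : ℝ → ℂ) (T M : ℕ) (x : Ω) : ℝ :=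
  ((T : ℝ) / (M : ℝ)) * ∑ r ∈ Finset.Icc 1 M, ‖orthSample X φ T (r : ℤ) x‖ ^ 2

/-- The limiting variance `V(0)`, that is
`(2π)⁻¹ ∫ f(ω)² (|φ(ω)|² + φ(ω) \overline{φ(-ω)}) dω
  + (2π)⁻¹ ∫ ∫ φ(ω₁) \overline{φ(ω₂)} f₄(ω₁, -ω₁, -ω₂) dω₁ dω₂`, all integrals over `[0, 2π]`.
The function `φ` lives on `[0, 2π]` and `φ(-ω)` refers to its `2π`-periodic extension, which is
`φ(2π - ω)` for `ω ∈ [0, 2π]`. -/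
def limitVariance {Ω : Type*} [MeasurableSpace Ω] (P : Measure Ω) (X : ℤ → Ω → ℝ)
    (φ : ℝ → ℂ) : ℂ :=
  (1 / (2 * Real.pi) : ℂ) *
      (∫ ω in (0 : ℝ)..(2 * Real.pi), spectralDensity P X ω ^ 2 *
        ((‖φ ω‖ : ℂ) ^ 2 + φ ω * (starRingEnd ℂ) (φ (2 * Real.pi - ω)))) +
    (1 / (2 * Real.pi) : ℂ) *
      (∫ ω₁ in (0 : ℝ)..(2 * Real.pi), ∫ ω₂ in (0 : ℝ)..(2 * Real.pi),
        φ ω₁ * (starRingEnd ℂ) (φ ω₂) * higherSpectralDensity P X ![ω₁, -ω₁, -ω₂])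

end

end OrthogonalSample

/-! Write `A_r` for `orthSample X φ T r`. The estimator averages `T |A_r|²` over `r`, so its bias
needs `E|A_r|²` and its variance needs the covariances of `|A_r|²` and `|A_s|²`.

Second moments are computed in the frequency domain. Summing a shift-invariant cumulant over
observed times instead of over all lags costs at most the first absolute moment of the cumulant
(`norm_sum_lags_sub_le`); this is where the weights `1 + |j_i|` enter. Hence `E[J_b J_a]` is `f`
when `T ∣ a + b` and negligible otherwise, up to `O(1/T)`, and fourth cumulants of the transform are
`(2π/T) f₄` on the same resonance condition, up to `O(1/T²)`. Consequently, if `T` does not divide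
`r`, `E A_r = O(1/T)`. For `1 ≤ r < T`, `T E|A_r|²` is a double sum whose two Gaussian pairings and
fourth cumulant give the three terms of `V(0)`. Replacing `ω_{k+r}` by `ω_k` costs `O(r/T)` and
passing from Riemann sums to integrals costs `O(1/T)`
(`exists_norm_integral_orthSample_sq_sub_limit_le`). Averaging over `r ≤ M < T` gives a bias of
order `M/T`.

For the covariances, the fourth moment of `A_r, conj A_r, A_s, conj A_s` is expanded in joint
cumulants. The second moments `E[A_r A_s]` and `E[A_r conj A_s]` are `O(1/T)` if `T` divides `r + s`
respectively `s - r`, and `O(1/T²)` otherwise; each `r` resonates with at most two `s`, which yields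
the term `1/M`. The cumulants of order three and four are handled in the time domain. There `A_r` is
a quadratic form in the data whose coefficients are `1/(2πT)` times discrete Fourier coefficients of
`φ`. As `φ` is Lipschitz but need not satisfy `φ(0) = φ(2π)`, these coefficients decay only like
`1/|j|`, so the row and column sums of the kernel are `L = O((1 + log T)/T)`. The cumulants of
quadratic forms expand into products of cumulants of `X` over those partitions that connect all the
index pairs. `connectedSum` generates these partitions by exploring from one pair, and
`partialSum_connectedSum_le` sums them in the order of exploration. The result is `O(T L³)` and `O(T
L⁴)`; for the latter, four pairs require cumulants up to order eight.

What remains in the variance is `(1 + log T)⁴ / T`. Both `M²/T²` and `1/M` can be small, but their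
sum is at least of order `T^(-2/3)`, which absorbs the logarithms (`one_add_log_pow_four_div_le`).

If `M ≥ T`, both right-hand sides are at least a constant, so a bounded second moment of the
estimator suffices. Indices divisible by `T` give an `A_r` that is not small, but there are at most
`M/T` of them (`exists_integral_varEstimator_sq_le`). -/

namespace OrthogonalSample

/-! ### Cumulants of set functions and the rooted moment-cumulant recursion -/

section SetCumulant

variable {ι : Type*} [DecidableEq ι] {R : Type*} [CommRing R]

/-- The cumulant of a set function `m`, obtained by Möbius inversion on set partitions. -/
def setCumulant (m : Finset ι → R) (B : Finset ι) : R :=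
  ∑ π : Finpartition B, (-1) ^ (π.parts.card - 1) * ((π.parts.card - 1).factorial : R) *
    ∏ C ∈ π.parts, m C

lemma finpartition_sup_erase {S : Finset ι} (σ : Finpartition S) {C : Finset ι}
    (hC : C ∈ σ.parts) : (σ.parts.erase C).sup id = S \ C := by
  ext x
  simp only [Finset.mem_sup, Finset.mem_erase, id, Finset.mem_sdiff]
  constructor
  · rintro ⟨t, ⟨htC, ht⟩, hx⟩
    exact ⟨σ.subset ht hx, fun hxC => htC (σ.eq_of_mem_parts ht hC hx hxC)⟩
  · rintro ⟨hxS, hxC⟩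
    obtain ⟨t, ht, hxt⟩ := σ.exists_mem hxS
    exact ⟨t, ⟨fun h => hxC (h ▸ hxt), ht⟩, hxt⟩

lemma card_parts_notMem {S : Finset ι} (σ : Finpartition S) {s : ι} (hs : s ∈ S) :
    (σ.parts.filter (fun C => s ∉ C)).card = σ.parts.card - 1 := by
  obtain ⟨t, ⟨ht, hst⟩, huniq⟩ := σ.existsUnique_mem hs
  have : σ.parts.filter (fun C => s ∉ C) = σ.parts.erase t := by
    ext C
    simp only [Finset.mem_filter, Finset.mem_erase]
    constructor
    · rintro ⟨hC, hsC⟩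
      exact ⟨fun h => hsC (h ▸ hst), hC⟩
    · rintro ⟨hCt, hC⟩
      exact ⟨hC, fun h => hCt (huniq C ⟨hC, h⟩)⟩
  rw [this, Finset.card_erase_of_mem ht]

/-- A partition of a proper subset `B` containing `s`, together with the single block `S \ B`, is a
partition of `S` with a marked block that avoids `s`. Removing the marked block inverts this, and
the number of blocks drops by one, whence the exponent `card - 2`. -/
lemma sum_ssubset_setCumulant (m : Finset ι → R) {S : Finset ι} {s : ι} (hs : s ∈ S) :
    ∑ B ∈ S.powerset.filter (fun B => s ∈ B ∧ B ≠ S), setCumulant m B * m (S \ B) =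
      ∑ σ : Finpartition S, ∑ _C ∈ σ.parts.filter (fun C => s ∉ C),
        (-1) ^ (σ.parts.card - 2) * ((σ.parts.card - 2).factorial : R) *
          ∏ C ∈ σ.parts, m C := by
  simp only [setCumulant, Finset.sum_mul]
  rw [Finset.sum_sigma', Finset.sum_sigma']
  have key : ∀ x : (Σ B : Finset ι, Finpartition B),
      x ∈ (S.powerset.filter (fun B => s ∈ B ∧ B ≠ S)).sigma
        (fun B => (Finset.univ : Finset (Finpartition B))) →
      x.1 ⊆ S ∧ s ∈ x.1 ∧ S \ x.1 ≠ ⊥ := by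
    intro x hx
    simp only [Finset.mem_sigma, Finset.mem_filter, Finset.mem_powerset, Finset.mem_univ,
      and_true] at hx
    refine ⟨hx.1, hx.2.1, fun h => hx.2.2 (Finset.Subset.antisymm hx.1 ?_)⟩
    exact Finset.sdiff_eq_empty_iff_subset.1 h
  have hnot : ∀ x : (Σ B : Finset ι, Finpartition B), S \ x.1 ≠ ⊥ →
      S \ x.1 ∉ x.2.parts := by
    intro x hx h
    obtain ⟨y, hy⟩ := x.2.nonempty_of_mem_parts h
    exact (Finset.mem_sdiff.1 hy).2 (x.2.subset h hy)
  refine Finset.sum_bij (fun x hx => ⟨x.2.extend (key x hx).2.2 disjoint_sdiff_self_right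
    (sup_sdiff_cancel_right (key x hx).1), S \ x.1⟩) ?_ ?_ ?_ ?_
  · intro x hx
    obtain ⟨h1, h2, h3⟩ := key x hx
    simp [Finpartition.extend, h2]
  · rintro ⟨B, π⟩ hx ⟨B', π'⟩ hx' h
    obtain ⟨h1, h2, h3⟩ := key _ hx
    obtain ⟨h1', h2', h3'⟩ := key _ hx'
    simp only [Sigma.mk.injEq, heq_eq_eq] at h
    obtain ⟨h4, h5⟩ := h
    have hB : B = B' := by
      have := congrArg (fun C => S \ C) h5
      simpa [Finset.sdiff_sdiff_eq_self h1, Finset.sdiff_sdiff_eq_self h1'] using this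
    subst hB
    have h6 := congrArg Finpartition.parts h4
    simp only [Finpartition.extend] at h6
    have hπ : π = π' := by
      apply Finpartition.ext
      rw [← Finset.erase_insert (hnot _ h3), h6]
      exact Finset.erase_insert (hnot _ h3')
    rw [hπ]
  · rintro ⟨σ, C⟩ hx
    simp only [Finset.mem_sigma, Finset.mem_univ, Finset.mem_filter, true_and] at hx
    have hCS := σ.subset hx.1
    refine ⟨⟨S \ C, σ.ofSubset (Finset.erase_subset C _) (finpartition_sup_erase σ hx.1)⟩, ?_, ?_⟩
    · simp only [Finset.mem_sigma, Finset.mem_filter, Finset.mem_powerset, Finset.mem_univ,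
        and_true]
      refine ⟨Finset.sdiff_subset, Finset.mem_sdiff.2 ⟨hs, hx.2⟩, fun h => ?_⟩
      obtain ⟨y, hy⟩ := σ.nonempty_of_mem_parts hx.1
      have := hCS hy
      rw [← h] at this
      exact (Finset.mem_sdiff.1 this).2 hy
    · simp only [Finpartition.extend, Finpartition.ofSubset, Sigma.mk.injEq, heq_eq_eq,
        Finset.sdiff_sdiff_eq_self hCS, and_true]
      apply Finpartition.ext
      exact Finset.insert_erase hx.1
  · intro x hx
    obtain ⟨h1, h2, h3⟩ := key x hx
    have hc : (insert (S \ x.1) x.2.parts).card = x.2.parts.card + 1 :=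
      Finset.card_insert_of_notMem (hnot x h3)
    simp only [Finpartition.extend, hc, Finset.prod_insert (hnot x h3)]
    have : x.2.parts.card + 1 - 2 = x.2.parts.card - 1 := by omega
    rw [this]
    ring

/-- The moment-cumulant recursion. -/
theorem sum_setCumulant_mul (m : Finset ι → R) (hm : m ∅ = 1) {S : Finset ι} {s : ι}
    (hs : s ∈ S) :
    ∑ B ∈ S.powerset.filter (fun B => s ∈ B), setCumulant m B * m (S \ B) = m S := by
  have hS : S ∈ S.powerset.filter (fun B => s ∈ B) := by simp [hs]
  rw [← Finset.sum_erase_add _ _ hS]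
  have : (S.powerset.filter (fun B => s ∈ B)).erase S =
      S.powerset.filter (fun B => s ∈ B ∧ B ≠ S) := by
    ext B; simp only [Finset.mem_erase, Finset.mem_filter]; tauto
  rw [this, sum_ssubset_setCumulant m hs, Finset.sdiff_self, hm, mul_one, setCumulant,
    ← Finset.sum_add_distrib]
  have hne : S ≠ ⊥ := fun h => by rw [h] at hs; simp at hs
  rw [Finset.sum_eq_single (Finpartition.indiscrete hne)]
  · simp [Finpartition.indiscrete, Finset.filter_singleton, hs]
  · intro σ _ hσ
    have hpos : 0 < σ.parts.card := Finset.card_pos.2 (σ.parts_nonempty hne)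
    have h1 : σ.parts.card ≠ 1 := by
      intro h
      obtain ⟨t, ht⟩ := Finset.card_eq_one.1 h
      apply hσ
      apply Finpartition.ext
      have := σ.sup_parts
      rw [ht] at this
      simp only [Finset.sup_singleton, id] at this
      rw [ht, this]; rfl
    -- With `k + 2` blocks there are `k + 1` choices of the marked block, each with coefficient
    -- `(-1)^k k!`. They cancel the Möbius coefficient `(-1)^(k+1) (k+1)!`, so that only the
    -- one-block partition survives.
    obtain ⟨k, hk⟩ : ∃ k, σ.parts.card = k + 2 := ⟨σ.parts.card - 2, by omega⟩
    rw [Finset.sum_const, card_parts_notMem σ hs, hk]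
    simp only [Nat.add_sub_cancel, nsmul_eq_mul, show k + 2 - 1 = k + 1 by omega,
      Nat.factorial_succ, pow_succ]
    push_cast
    ring
  · simp

/-- The recursion determines the cumulants. -/
lemma setCumulant_eq_of_recursion (m K : Finset ι → R) (hm : m ∅ = 1) (hK0 : K ∅ = setCumulant m ∅)
    (hK : ∀ S : Finset ι, S.Nonempty → ∃ s ∈ S,
      ∑ B ∈ S.powerset.filter (fun B => s ∈ B), K B * m (S \ B) = m S) (S : Finset ι) :
    setCumulant m S = K S := by
  induction S using Finset.strongInduction with
  | H S ih =>
    rcases S.eq_empty_or_nonempty with rfl | hS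
    · exact hK0.symm
    obtain ⟨s, hs, h⟩ := hK S hS
    have h' := sum_setCumulant_mul m hm hs
    have hmem : S ∈ S.powerset.filter (fun B => s ∈ B) := by simp [hs]
    rw [← Finset.sum_erase_add _ _ hmem, Finset.sdiff_self, hm, mul_one] at h h'
    have heq : ∑ B ∈ (S.powerset.filter (fun B => s ∈ B)).erase S, setCumulant m B * m (S \ B) =
        ∑ B ∈ (S.powerset.filter (fun B => s ∈ B)).erase S, K B * m (S \ B) := by
      refine Finset.sum_congr rfl fun B hB => ?_
      simp only [Finset.mem_erase, Finset.mem_filter, Finset.mem_powerset] at hB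
      rw [ih B (lt_of_le_of_ne hB.2.1 hB.1)]
    rw [heq] at h'
    linear_combination h' - h

/-- The only partition of the empty set has no block, and the truncated subtraction `0 - 1 = 0`
makes its coefficient one. The value is a by-product of the definition; it never enters the
recursion, whose blocks contain the root. -/
lemma setCumulant_empty (m : Finset ι → R) : setCumulant m ∅ = 1 := by
  have hp : ∀ π : Finpartition (∅ : Finset ι), π.parts = ∅ := fun π =>
    π.parts_eq_empty_iff.2 rfl
  have : (Finset.univ : Finset (Finpartition (∅ : Finset ι))).card = 1 :=
    Finset.card_eq_one.2 ⟨Finpartition.empty (Finset ι), by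
      ext x
      simp only [Finset.mem_univ, Finset.mem_singleton, true_iff]
      exact Finpartition.ext ((hp x).trans (hp _).symm)⟩
  simp [setCumulant, hp, this]

/-- Both sides satisfy the same rooted recursion, which determines cumulants. This avoids
transporting partitions along `f`. -/
lemma setCumulant_map {κ : Type*} [DecidableEq κ] (m : Finset ι → R) (hm : m ∅ = 1)
    (f : κ ↪ ι) (S : Finset κ) :
    setCumulant (fun C => m (C.map f)) S = setCumulant m (S.map f) := by
  refine setCumulant_eq_of_recursion (fun C => m (C.map f)) (fun C => setCumulant m (C.map f))
    (by simpa using hm) (by simp [setCumulant_empty]) (fun S hS => ?_) S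
  obtain ⟨s, hs⟩ := hS
  refine ⟨s, hs, ?_⟩
  rw [← sum_setCumulant_mul m hm (Finset.mem_map_of_mem f hs)]
  refine Finset.sum_bij (fun B _ => B.map f) ?_ ?_ ?_ ?_
  · intro B hB
    simpa [Finset.map_subset_map] using hB
  · intro B _ B' _ h
    exact Finset.map_injective f h
  · intro B hB
    simp only [Finset.mem_filter, Finset.mem_powerset] at hB
    obtain ⟨u, hu, rfl⟩ := Finset.subset_map_iff.1 hB.1
    exact ⟨u, by simpa [hu] using hB.2, rfl⟩
  · intro B hB
    rw [Finset.map_sdiff]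

end SetCumulant

/-! ### Joint moments and cumulants of the time series -/

section Moments

variable {Ω : Type*} [MeasurableSpace Ω] (P : Measure Ω) (X : ℤ → Ω → ℝ)

/-- The mixed moment of the observations at the times `u i`, `i ∈ S`. -/
noncomputable def mixedMoment {ι : Type*} (u : ι → ℤ) (S : Finset ι) : ℝ :=
  ∫ x, ∏ i ∈ S, X (u i) x ∂P

/-- The joint cumulant of the observations at the times `u i`, `i ∈ S`. -/
noncomputable def mixedCumulant {ι : Type*} [DecidableEq ι] (u : ι → ℤ) (S : Finset ι) : ℝ :=
  setCumulant (mixedMoment P X u) S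

lemma jointCumulant_eq_mixedCumulant {n : ℕ} (u : Fin n → ℤ) :
    jointCumulant P (fun i => X (u i)) = mixedCumulant P X u Finset.univ := rfl

lemma mixedMoment_empty [IsProbabilityMeasure P] {ι : Type*} (u : ι → ℤ) :
    mixedMoment P X u ∅ = 1 := by simp [mixedMoment]

lemma mixedMoment_map {ι κ : Type*} (u : ι → ℤ) (f : κ ↪ ι) (S : Finset κ) :
    mixedMoment P X u (S.map f) = mixedMoment P X (u ∘ f) S := by
  simp [mixedMoment, Finset.prod_map]

lemma mixedCumulant_map [IsProbabilityMeasure P] {ι κ : Type*} [DecidableEq ι] [DecidableEq κ]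
    (u : ι → ℤ) (f : κ ↪ ι) (S : Finset κ) :
    mixedCumulant P X u (S.map f) = mixedCumulant P X (u ∘ f) S := by
  rw [mixedCumulant, ← setCumulant_map _ (mixedMoment_empty P X u)]
  simp only [mixedMoment_map]
  rfl

variable {P X} {p : ℕ}

lemma mixedMoment_add (hX : StationaryCumulantCondition P X p) {ι : Type*} (u : ι → ℤ)
    (S : Finset ι) (hS : S.card ≤ p) (h : ℤ) :
    mixedMoment P X (fun i => u i + h) S = mixedMoment P X u S := by
  have := hX.moment_shift S.card hS (fun i => u (S.equivFin.symm i)) h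
  have e : ∀ v : ι → ℤ, ∫ x, ∏ i, X (v (S.equivFin.symm i)) x ∂P = mixedMoment P X v S := by
    intro v
    unfold mixedMoment
    congr 1; ext x
    rw [← Finset.prod_coe_sort S (fun i => X (v i) x)]
    exact Fintype.prod_equiv S.equivFin.symm _ _ (fun i => rfl)
  rw [← e, ← e]
  exact this

lemma mixedCumulant_add (hX : StationaryCumulantCondition P X p) {ι : Type*} [DecidableEq ι]
    (u : ι → ℤ) (S : Finset ι) (hS : S.card ≤ p) (h : ℤ) :
    mixedCumulant P X (fun i => u i + h) S = mixedCumulant P X u S := by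
  unfold mixedCumulant setCumulant
  refine Finset.sum_congr rfl fun π _ => ?_
  congr 1
  refine Finset.prod_congr rfl fun C hC => ?_
  exact mixedMoment_add hX u C ((Finset.card_le_card (π.subset hC)).trans hS) h

/-- A joint cumulant depends on the lags only. -/
lemma mixedCumulant_univ_eq_kappa (hX : StationaryCumulantCondition P X p) {n : ℕ}
    (hn : n + 1 ≤ p) (u : Fin (n + 1) → ℤ) :
    mixedCumulant P X u Finset.univ = kappa P X (fun l => u l.succ - u 0) := by
  rw [kappa, jointCumulant_eq_mixedCumulant, ← mixedCumulant_add hX u _ (by simpa using hn) (-u 0)]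
  congr 1
  ext i
  refine Fin.cases ?_ (fun l => ?_) i <;> simp [sub_eq_add_neg]

lemma mixedCumulant_eq_kappa [IsProbabilityMeasure P] (hX : StationaryCumulantCondition P X p)
    {ι : Type*} [DecidableEq ι] {n : ℕ} (hn : n + 1 ≤ p) (f : Fin (n + 1) ↪ ι) (u : ι → ℤ) :
    mixedCumulant P X u (Finset.univ.map f) = kappa P X (fun l => u (f l.succ) - u (f 0)) := by
  rw [mixedCumulant_map, mixedCumulant_univ_eq_kappa hX hn]
  rfl

lemma mixedMoment_eq_sum_cumulant [IsProbabilityMeasure P] {ι : Type*} [DecidableEq ι]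
    (u : ι → ℤ) {S : Finset ι} {s : ι} (hs : s ∈ S) :
    ∑ B ∈ S.powerset.filter (fun B => s ∈ B), mixedCumulant P X u B * mixedMoment P X u (S \ B) =
      mixedMoment P X u S :=
  sum_setCumulant_mul _ (mixedMoment_empty P X u) hs

lemma mixedCumulant_singleton [IsProbabilityMeasure P] (hmean : ∀ t : ℤ, ∫ x, X t x ∂P = 0)
    {ι : Type*} [DecidableEq ι] (u : ι → ℤ) (i : ι) : mixedCumulant P X u {i} = 0 := by
  have h := mixedMoment_eq_sum_cumulant (P := P) (X := X) u (Finset.mem_singleton_self i)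
  have e : ({i} : Finset ι).powerset.filter (fun B => i ∈ B) = {{i}} := by
    ext B
    simp only [Finset.mem_filter, Finset.mem_powerset, Finset.subset_singleton_iff,
      Finset.mem_singleton]
    constructor
    · rintro ⟨rfl | rfl, h⟩ <;> simp_all
    · rintro rfl; simp
  rw [e, Finset.sum_singleton, Finset.sdiff_self, mixedMoment_empty, mul_one] at h
  rw [h]
  simp [mixedMoment, hmean]

lemma mixedCumulant_pair [IsProbabilityMeasure P] (hmean : ∀ t : ℤ, ∫ x, X t x ∂P = 0)
    {ι : Type*} [DecidableEq ι] (u : ι → ℤ) {i j : ι} (hij : i ≠ j) :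
    mixedCumulant P X u {i, j} = ∫ x, X (u i) x * X (u j) x ∂P := by
  have h := mixedMoment_eq_sum_cumulant (P := P) (X := X) u (Finset.mem_insert_self i {j})
  have e : ({i, j} : Finset ι).powerset.filter (fun B => i ∈ B) = {{i}, {i, j}} := by
    ext B
    simp only [Finset.mem_filter, Finset.mem_powerset, Finset.mem_insert, Finset.mem_singleton]
    constructor
    · rintro ⟨hB, hi⟩
      by_cases hj : j ∈ B
      · exact Or.inr (Finset.Subset.antisymm hB
          (Finset.insert_subset hi (Finset.singleton_subset_iff.2 hj)))
      · refine Or.inl (Finset.Subset.antisymm (fun x hx => ?_) (Finset.singleton_subset_iff.2 hi))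
        rcases Finset.mem_insert.1 (hB hx) with rfl | h
        · simp
        · exact absurd (Finset.mem_singleton.1 h ▸ hx) hj
    · rintro (rfl | rfl) <;> simp
  have hne : ({i} : Finset ι) ≠ {i, j} := by
    intro h
    have : j ∈ ({i} : Finset ι) := by rw [h]; simp
    exact hij (Finset.mem_singleton.1 this).symm
  rw [e, Finset.sum_pair hne, Finset.sdiff_self, mixedMoment_empty, mul_one,
    mixedCumulant_singleton hmean, zero_mul, zero_add] at h
  rw [h, mixedMoment]
  simp [Finset.prod_pair hij]

lemma integral_mul_eq_kappa [IsProbabilityMeasure P] (hX : StationaryCumulantCondition P X p)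
    (hp : 2 ≤ p) (hmean : ∀ t : ℤ, ∫ x, X t x ∂P = 0) (s t : ℤ) :
    ∫ x, X s x * X t x ∂P = kappa P X (fun _ : Fin 1 => t - s) := by
  have h := mixedCumulant_univ_eq_kappa hX (n := 1) hp ![s, t]
  have e : (Finset.univ : Finset (Fin 2)) = {0, 1} := rfl
  rw [e, mixedCumulant_pair hmean _ (by decide)] at h
  simp only [Matrix.cons_val_zero, Matrix.cons_val_one] at h
  rw [h]
  congr 1
  ext l
  fin_cases l; simp

/-- The fourth moment of a mean zero series in terms of cumulants. -/
lemma integral_mul_four [IsProbabilityMeasure P] (hX : StationaryCumulantCondition P X p)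
    (hp : 4 ≤ p) (hmean : ∀ t : ℤ, ∫ x, X t x ∂P = 0) (a b c d : ℤ) :
    ∫ x, X a x * X b x * X c x * X d x ∂P = kappa P X ![b - a, c - a, d - a] +
      (∫ x, X a x * X b x ∂P) * (∫ x, X c x * X d x ∂P) +
      (∫ x, X a x * X c x ∂P) * (∫ x, X b x * X d x ∂P) +
      (∫ x, X a x * X d x ∂P) * (∫ x, X b x * X c x ∂P) := by
  have h := mixedMoment_eq_sum_cumulant (P := P) (X := X) ![a, b, c, d] (Finset.mem_univ
      (0 : Fin 4))
  -- Among the blocks containing the root, the singleton has cumulant zero and the triples leave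
  -- behind a mean, which is zero. The three pairs and the full block remain.
  have e : (Finset.univ : Finset (Fin 4)).powerset.filter (fun B => 0 ∈ B) =
      {{0}, {0, 1}, {0, 2}, {0, 3}, {0, 1, 2}, {0, 1, 3}, {0, 2, 3}, Finset.univ} := by decide
  rw [e] at h
  rw [Finset.sum_insert (by decide), Finset.sum_insert (by decide), Finset.sum_insert (by decide),
    Finset.sum_insert (by decide), Finset.sum_insert (by decide), Finset.sum_insert (by decide),
    Finset.sum_insert (by decide), Finset.sum_singleton, mixedCumulant_singleton hmean,
    mixedCumulant_pair hmean _ (by decide), mixedCumulant_pair hmean _ (by decide),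
    mixedCumulant_pair hmean _ (by decide), Finset.sdiff_self, mixedMoment_empty,
    mixedCumulant_univ_eq_kappa hX (n := 3) hp] at h
  have e1 : (Finset.univ : Finset (Fin 4)) \ {0, 1, 2} = {3} := by decide
  have e2 : (Finset.univ : Finset (Fin 4)) \ {0, 1, 3} = {2} := by decide
  have e3 : (Finset.univ : Finset (Fin 4)) \ {0, 2, 3} = {1} := by decide
  have e4 : (Finset.univ : Finset (Fin 4)) \ {0, 1} = {2, 3} := by decide
  have e5 : (Finset.univ : Finset (Fin 4)) \ {0, 2} = {1, 3} := by decide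
  have e6 : (Finset.univ : Finset (Fin 4)) \ {0, 3} = {1, 2} := by decide
  have hs : ∀ i : Fin 4, mixedMoment P X ![a, b, c, d] {i} = 0 := fun i => by
    simp [mixedMoment, hmean]
  have hpair : ∀ i j : Fin 4, i ≠ j → mixedMoment P X ![a, b, c, d] {i, j} =
      ∫ x, X (![a, b, c, d] i) x * X (![a, b, c, d] j) x ∂P := fun i j hij => by
    simp [mixedMoment, Finset.prod_pair hij]
  rw [e1, e2, e3, e4, e5, e6, hs, hs, hs, hpair _ _ (by decide), hpair _ _ (by decide),
    hpair _ _ (by decide)] at h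
  have hl : mixedMoment P X ![a, b, c, d] Finset.univ = ∫ x, X a x * X b x * X c x * X d x ∂P := by
    simp [mixedMoment, Fin.prod_univ_four]
  have hk : (fun l : Fin 3 => (![a, b, c, d] : Fin 4 → ℤ) l.succ - (![a, b, c, d] : Fin 4 → ℤ) 0) =
      ![b - a, c - a, d - a] := by
    ext l; fin_cases l <;> simp
  rw [hl, hk] at h
  simp only [Matrix.cons_val] at h
  linarith

end Moments

/-! ### Exploration of the connected partitions of a family of pairs -/

section Connected

/-- The two positions of each of the index pairs in `Q`. -/
def positions {n : ℕ} (Q : Finset (Fin n)) : Finset (Fin n × Fin 2) := Q ×ˢ Finset.univ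

/-- The index pairs that meet `B`. -/
def touched {n : ℕ} (B : Finset (Fin n × Fin 2)) : Finset (Fin n) := B.image Prod.fst

lemma mem_positions {n : ℕ} {Q : Finset (Fin n)} {i : Fin n × Fin 2} :
    i ∈ positions Q ↔ i.1 ∈ Q := by simp [positions]

lemma mem_touched {n : ℕ} {B : Finset (Fin n × Fin 2)} {q : Fin n} :
    q ∈ touched B ↔ ∃ i ∈ B, i.1 = q := by simp [touched]

/-- The part of a moment that comes from the partitions whose blocks, glued along the pairs in `Q`,
connect all of `Q` to the positions in `U`. The natural number bounds the number of blocks. -/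
def connectedSum {n : ℕ} {R : Type*} [CommRing R] (K : Finset (Fin n × Fin 2) → R)
    (pick : Finset (Fin n × Fin 2) → Fin n × Fin 2) :
    ℕ → Finset (Fin n × Fin 2) → Finset (Fin n) → R
  | 0, _, Q => if Q = ∅ then 1 else 0
  | N + 1, U, Q => if U = ∅ then (if Q = ∅ then 1 else 0) else
      ∑ B ∈ (U ∪ positions Q).powerset.filter (fun B => pick U ∈ B),
        K B * connectedSum K pick N ((U ∪ positions (Q ∩ touched B)) \ B) (Q \ touched B)

/-- Here `U` is the frontier: positions of pairs already reached that have no block yet. Expanding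
the moment at the root `pick U` chooses its block `B`. The pairs touched by `B` are now reached, so
their leftover positions join the frontier, while the untouched pairs stay in the moment. Iterating
until the frontier is empty and grouping by the set `Q` of all pairs reached factors out the moment
of the pairs never reached. Each step removes at least the root, so the number of positions bounds
the number of steps. -/
theorem sum_connectedSum_mul {n : ℕ} {R : Type*} [CommRing R] (K m : Finset (Fin n × Fin 2) → R)
    (pick : Finset (Fin n × Fin 2) → Fin n × Fin 2) (hpick : ∀ U, U.Nonempty → pick U ∈ U)
    (hrec : ∀ (S : Finset (Fin n × Fin 2)) (s), s ∈ S →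
      ∑ B ∈ S.powerset.filter (fun B => s ∈ B), K B * m (S \ B) = m S)
    (N : ℕ) (U : Finset (Fin n × Fin 2)) (W : Finset (Fin n)) (hUW : Disjoint U (positions W))
    (hN : (U ∪ positions W).card ≤ N) :
    ∑ Q ∈ W.powerset, connectedSum K pick N U Q * m (positions (W \ Q)) =
      m (U ∪ positions W) := by
  have base : ∀ W : Finset (Fin n), ∑ Q ∈ W.powerset,
      (if Q = ∅ then (1 : R) else 0) * m (positions (W \ Q)) = m (∅ ∪ positions W) := by
    intro W
    rw [Finset.sum_eq_single ∅]
    · simp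
    · intro Q _ hQ; simp [hQ]
    · simp
  induction N generalizing U W with
  | zero =>
    have h0 : U ∪ positions W = ∅ := Finset.card_eq_zero.1 (Nat.le_zero.1 hN)
    have hU : U = ∅ := (Finset.union_eq_empty.1 h0).1
    subst hU
    exact base W
  | succ N ih =>
    by_cases hU : U = ∅
    · subst hU
      simp [connectedSum]
    have hp := hpick U (Finset.nonempty_iff_ne_empty.2 hU)
    simp only [connectedSum, hU, if_false]
    rw [← hrec _ _ (Finset.mem_union_left _ hp)]
    have hdis : ∀ i ∈ U, i.1 ∉ W := fun i hi h =>
      Finset.disjoint_left.1 hUW hi (mem_positions.2 h)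
    have step : ∀ B ∈ (U ∪ positions W).powerset.filter (fun B => pick U ∈ B),
        K B * m ((U ∪ positions W) \ B) = ∑ Q ∈ (W \ touched B).powerset,
          K B * connectedSum K pick N ((U ∪ positions (W ∩ touched B)) \ B) Q *
            m (positions ((W \ touched B) \ Q)) := by
      intro B hB
      simp only [Finset.mem_filter, Finset.mem_powerset] at hB
      have hset : (U ∪ positions W) \ B =
          ((U ∪ positions (W ∩ touched B)) \ B) ∪ positions (W \ touched B) := by
        ext i
        simp only [Finset.mem_sdiff, Finset.mem_union, mem_positions, Finset.mem_inter]
        by_cases hiB : i ∈ B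
        · have : i.1 ∈ touched B := mem_touched.2 ⟨i, hiB, rfl⟩
          tauto
        · tauto
      have hcard : ((U ∪ positions (W ∩ touched B)) \ B ∪ positions (W \ touched B)).card ≤ N := by
        rw [← hset]
        have : ((U ∪ positions W) \ B).card < (U ∪ positions W).card :=
          Finset.card_lt_card (Finset.ssubset_iff_of_subset Finset.sdiff_subset |>.2
            ⟨pick U, Finset.mem_union_left _ hp, by simp [hB.2]⟩)
        omega
      rw [hset, ← ih _ _ _ hcard, Finset.mul_sum]
      · exact Finset.sum_congr rfl fun Q _ => by ring
      · rw [Finset.disjoint_left]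
        intro i hi hi'
        simp only [Finset.mem_sdiff, Finset.mem_union, mem_positions, Finset.mem_inter] at hi hi'
        rcases hi.1 with h | h
        · exact hdis i h hi'.1
        · exact hi'.2 h.2
    rw [Finset.sum_congr rfl step]
    simp only [Finset.sum_mul]
    rw [Finset.sum_sigma', Finset.sum_sigma']
    -- The pairs reached in total are those touched by the first block and those reached afterwards;
    -- `Q` is recovered by adding back `W ∩ touched B`.
    refine Finset.sum_bij' (fun x _ => ⟨x.2, x.1 \ touched x.2⟩)
      (fun x _ => ⟨x.2 ∪ (W ∩ touched x.1), x.1⟩) ?_ ?_ ?_ ?_ ?_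
    · rintro ⟨Q, B⟩ h
      simp only [Finset.mem_sigma, Finset.mem_powerset, Finset.mem_filter] at h ⊢
      refine ⟨⟨h.2.1.trans (Finset.union_subset_union_right ?_), h.2.2⟩,
        Finset.sdiff_subset_sdiff h.1 (Finset.Subset.refl _)⟩
      intro i hi
      exact mem_positions.2 (h.1 (mem_positions.1 hi))
    · rintro ⟨B, Q⟩ h
      simp only [Finset.mem_sigma, Finset.mem_powerset, Finset.mem_filter] at h ⊢
      refine ⟨Finset.union_subset (h.2.trans Finset.sdiff_subset) Finset.inter_subset_left, ?_,
        h.1.2⟩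
      intro i hi
      rcases Finset.mem_union.1 (h.1.1 hi) with h' | h'
      · exact Finset.mem_union_left _ h'
      · refine Finset.mem_union_right _ (mem_positions.2 (Finset.mem_union_right _ ?_))
        exact Finset.mem_inter.2 ⟨mem_positions.1 h', mem_touched.2 ⟨i, hi, rfl⟩⟩
    · rintro ⟨Q, B⟩ h
      simp only [Finset.mem_sigma, Finset.mem_powerset, Finset.mem_filter] at h
      simp only [Sigma.mk.injEq, heq_eq_eq, and_true]
      ext q
      simp only [Finset.mem_union, Finset.mem_sdiff, Finset.mem_inter]
      constructor
      · rintro (h' | ⟨hqW, hqB⟩)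
        · exact h'.1
        · obtain ⟨i, hi, rfl⟩ := mem_touched.1 hqB
          rcases Finset.mem_union.1 (h.2.1 hi) with h' | h'
          · exact absurd hqW (hdis i h')
          · exact mem_positions.1 h'
      · intro hq
        by_cases hqB : q ∈ touched B
        · exact Or.inr ⟨h.1 hq, hqB⟩
        · exact Or.inl ⟨hq, hqB⟩
    · rintro ⟨B, Q⟩ h
      simp only [Finset.mem_sigma, Finset.mem_powerset, Finset.mem_filter] at h
      simp only [Sigma.mk.injEq, heq_eq_eq, true_and]
      ext q
      simp only [Finset.mem_union, Finset.mem_sdiff, Finset.mem_inter]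
      constructor
      · tauto
      · intro hq
        exact ⟨Or.inl hq, (Finset.mem_sdiff.1 (h.2 hq)).2⟩
    · rintro ⟨Q, B⟩ h
      simp only [Finset.mem_sigma, Finset.mem_powerset, Finset.mem_filter] at h
      have h1 : Q ∩ touched B = W ∩ touched B := by
        ext q
        simp only [Finset.mem_inter]
        refine ⟨fun h' => ⟨h.1 h'.1, h'.2⟩, fun h' => ⟨?_, h'.2⟩⟩
        obtain ⟨i, hi, rfl⟩ := mem_touched.1 h'.2
        rcases Finset.mem_union.1 (h.2.1 hi) with h'' | h''
        · exact absurd h'.1 (hdis i h'')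
        · exact mem_positions.1 h''
      have h2 : (W \ touched B) \ (Q \ touched B) = W \ Q := by
        ext q
        have := @h.1 q
        have h3 : q ∈ Q ∩ touched B ↔ q ∈ W ∩ touched B := by rw [h1]
        simp only [Finset.mem_sdiff, Finset.mem_inter] at h3 ⊢
        tauto
      simp only [h1, h2]

end Connected

/-! ### Partial sums over some of the integer variables -/

section Marginal

variable {ι : Type*} [DecidableEq ι]

/-- The sum of a function of several integer variables over the variables indexed by `S`. -/
noncomputable def partialSum (S : Finset ι) (f : (ι → ℤ) → ℝ≥0∞) (v : ι → ℤ) : ℝ≥0∞ :=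
  ∑' y : S → ℤ, f (Function.updateFinset v S y)

lemma partialSum_mono {S : Finset ι} {f g : (ι → ℤ) → ℝ≥0∞} (h : ∀ u, f u ≤ g u) (v : ι → ℤ) :
    partialSum S f v ≤ partialSum S g v := ENNReal.tsum_le_tsum fun _ => h _

lemma partialSum_union {S S' : Finset ι} (h : Disjoint S S') (f : (ι → ℤ) → ℝ≥0∞) (v : ι → ℤ) :
    partialSum (S ∪ S') f v = partialSum S (partialSum S' f) v := by
  unfold partialSum
  rw [← (Equiv.piFinsetUnion (fun _ => ℤ) h).tsum_eq, ENNReal.tsum_prod']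
  simp only [Function.updateFinset_updateFinset h]

lemma partialSum_mul_left {S : Finset ι} {f g : (ι → ℤ) → ℝ≥0∞} {v : ι → ℤ}
    (hf : ∀ y, f (Function.updateFinset v S y) = f v) :
    partialSum S (fun u => f u * g u) v = f v * partialSum S g v := by
  unfold partialSum
  simp only [hf, ENNReal.tsum_mul_left]

lemma partialSum_mul_const (S : Finset ι) (f : (ι → ℤ) → ℝ≥0∞) (c : ℝ≥0∞) (v : ι → ℤ) :
    partialSum S (fun u => f u * c) v = partialSum S f v * c := by
  unfold partialSum
  rw [ENNReal.tsum_mul_right]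

lemma partialSum_sum {κ : Type*} (s : Finset κ) (S : Finset ι) (f : κ → (ι → ℤ) → ℝ≥0∞)
    (v : ι → ℤ) :
    partialSum S (fun u => ∑ k ∈ s, f k u) v = ∑ k ∈ s, partialSum S (f k) v := by
  unfold partialSum
  exact Summable.tsum_finsetSum (fun _ _ => ENNReal.summable)

lemma le_partialSum (S : Finset ι) (f : (ι → ℤ) → ℝ≥0∞) (v : ι → ℤ) : f v ≤ partialSum S f v := by
  refine le_trans (le_of_eq ?_) (ENNReal.le_tsum (fun i : S => v i))
  congr 1
  ext i
  by_cases h : i ∈ S <;> simp [Function.updateFinset, h]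

lemma partialSum_mono_set {S S' : Finset ι} (h : S ⊆ S') (f : (ι → ℤ) → ℝ≥0∞) (v : ι → ℤ) :
    partialSum S f v ≤ partialSum S' f v := by
  rw [← Finset.sdiff_union_of_subset h, partialSum_union Finset.sdiff_disjoint]
  exact le_partialSum _ _ _

lemma partialSum_empty (f : (ι → ℤ) → ℝ≥0∞) (v : ι → ℤ) : partialSum ∅ f v = f v := by
  unfold partialSum
  rw [tsum_eq_single default (fun b hb => absurd (Subsingleton.elim _ _) hb)]
  simp

lemma partialSum_singleton (i : ι) (f : (ι → ℤ) → ℝ≥0∞) (v : ι → ℤ) :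
    partialSum {i} f v = ∑' z : ℤ, f (Function.update v i z) := by
  unfold partialSum
  rw [← (Equiv.funUnique ({i} : Finset ι) ℤ).symm.tsum_eq]
  refine tsum_congr fun z => ?_
  rw [Function.updateFinset_singleton]
  rfl

end Marginal

/-! ### Summation of the connected partitions against pair weights -/

section Bound

variable {n : ℕ}

lemma updateFinset_apply_of_notMem {ι : Type*} [DecidableEq ι] {S : Finset ι} {v : ι → ℤ}
    {y : S → ℤ} {i : ι} (h : i ∉ S) : Function.updateFinset v S y i = v i := by
  simp [Function.updateFinset, h]

/-- The sums of a product of pair weights over positions that miss at least one of the positions of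
each pair. -/
lemma partialSum_prod_pairs_le (G : ℤ → ℤ → ℝ≥0∞) (L : ℝ≥0∞)
    (hG1 : ∀ x, ∑' y, G x y ≤ L) (hG2 : ∀ y, ∑' x, G x y ≤ L) (B : Finset (Fin n × Fin 2))
    (Q : Finset (Fin n)) (hQ : Q ⊆ touched B) (v : Fin n × Fin 2 → ℤ) :
    partialSum (positions Q \ B) (fun u => ∏ q ∈ Q, G (u (q, 0)) (u (q, 1))) v ≤ L ^ Q.card := by
  induction Q using Finset.induction_on generalizing v with
  | empty =>
    have : positions (∅ : Finset (Fin n)) \ B = ∅ := by simp [positions]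
    rw [this, partialSum_empty]; simp
  | insert q Q hq ih =>
    have hset : positions (insert q Q) \ B = (positions {q} \ B) ∪ (positions Q \ B) := by
      ext i; simp only [Finset.mem_sdiff, mem_positions, Finset.mem_insert, Finset.mem_union,
        Finset.mem_singleton]; tauto
    have hdis : Disjoint (positions {q} \ B) (positions Q \ B) := by
      rw [Finset.disjoint_left]
      intro i hi hi'
      simp only [Finset.mem_sdiff, mem_positions, Finset.mem_singleton] at hi hi'
      exact hq (hi.1 ▸ hi'.1)
    rw [hset, partialSum_union hdis, Finset.card_insert_of_notMem hq, pow_succ, mul_comm]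
    simp only [Finset.prod_insert hq]
    have h1 : ∀ u : Fin n × Fin 2 → ℤ, partialSum (positions Q \ B)
        (fun u => G (u (q, 0)) (u (q, 1)) * ∏ q ∈ Q, G (u (q, 0)) (u (q, 1))) u ≤
        G (u (q, 0)) (u (q, 1)) * L ^ Q.card := by
      intro u
      rw [partialSum_mul_left (f := fun u => G (u (q, 0)) (u (q, 1)))]
      · exact mul_le_mul_right (ih ((Finset.subset_insert _ _).trans hQ) u) _
      · intro y
        rw [updateFinset_apply_of_notMem, updateFinset_apply_of_notMem] <;>
        simp [mem_positions, hq]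
    refine (partialSum_mono h1 v).trans ?_
    rw [partialSum_mul_const]
    refine mul_le_mul_left ?_ _
    -- Since `B` contains a position of the pair, at most one position is summed, and the row or the
    -- column bound of `G` applies.
    obtain ⟨⟨q', i⟩, hiB, rfl⟩ := mem_touched.1 (hQ (Finset.mem_insert_self q Q))
    have hcases : i = 0 ∨ i = 1 := by omega
    rcases hcases with rfl | rfl
    · refine (partialSum_mono_set (S' := {(q', 1)}) ?_ _ v).trans ?_
      · rintro ⟨a, j⟩ ha
        simp only [Finset.mem_sdiff, mem_positions, Finset.mem_singleton] at ha ⊢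
        obtain ⟨rfl, hb⟩ := ha
        have : j ≠ 0 := by rintro rfl; exact hb hiB
        have : j = 1 := by omega
        rw [this]
      · rw [partialSum_singleton]
        simpa using hG1 _
    · refine (partialSum_mono_set (S' := {(q', 0)}) ?_ _ v).trans ?_
      · rintro ⟨a, j⟩ ha
        simp only [Finset.mem_sdiff, mem_positions, Finset.mem_singleton] at ha ⊢
        obtain ⟨rfl, hb⟩ := ha
        have : j ≠ 1 := by rintro rfl; exact hb hiB
        have : j = 0 := by omega
        rw [this]
      · rw [partialSum_singleton]
        simpa using hG2 _

/-- Dependence of set-indexed functions on the coordinates of the set only. -/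
def DependsOnIndex {ι : Type*} (K : (ι → ℤ) → Finset ι → ℝ) : Prop :=
  ∀ B u v, (∀ i ∈ B, u i = v i) → K u B = K v B

/-- The sums are carried out against the direction of exploration. For the first block `B`, the
pairs it does not touch are summed by induction with everything else frozen. Then each touched pair
has at most one position outside `B`, and its weight sums to at most `L`. Finally the positions in
`B` are summed with the root frozen, which costs `κ`. So each pair costs one factor `L`, never `L`
times a number of times. The factor `1 + 2^(2n) κ` per step covers the choice of the block and also
the case in which the exploration has stopped. -/
theorem partialSum_connectedSum_le (K : (Fin n × Fin 2 → ℤ) → Finset (Fin n × Fin 2) → ℝ)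
    (hdep : DependsOnIndex K) (κ : ℝ≥0∞)
    (hK : ∀ B, ∀ i ∈ B, ∀ v, partialSum (B.erase i) (fun u => ‖K u B‖ₑ) v ≤ κ)
    (pick : Finset (Fin n × Fin 2) → Fin n × Fin 2) (hpick : ∀ U, U.Nonempty → pick U ∈ U)
    (G : ℤ → ℤ → ℝ≥0∞) (L : ℝ≥0∞)
    (hG1 : ∀ x, ∑' y, G x y ≤ L) (hG2 : ∀ y, ∑' x, G x y ≤ L)
    (N : ℕ) (U : Finset (Fin n × Fin 2)) (Q : Finset (Fin n)) (hUQ : Disjoint U (positions Q))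
    (v : Fin n × Fin 2 → ℤ) :
    partialSum (positions Q) (fun u => (∏ q ∈ Q, G (u (q, 0)) (u (q, 1))) *
      ‖connectedSum (K u) pick N U Q‖ₑ) v ≤ (1 + 2 ^ (2 * n) * κ) ^ N * L ^ Q.card := by
  have base : ∀ (Q : Finset (Fin n)) (c : ℝ≥0∞), 1 ≤ c → partialSum (positions Q)
      (fun u => (∏ q ∈ Q, G (u (q, 0)) (u (q, 1))) * ‖if Q = ∅ then (1 : ℝ) else 0‖ₑ) v ≤
        c * L ^ Q.card := by
    intro Q c hc
    by_cases hQ : Q = ∅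
    · subst hQ
      have : positions (∅ : Finset (Fin n)) = ∅ := by simp [positions]
      rw [this, partialSum_empty]; simpa using hc
    · simp [hQ, partialSum]
  have h1 : ∀ N : ℕ, 1 ≤ (1 + 2 ^ (2 * n) * κ) ^ N := fun N => one_le_pow_of_one_le' (by simp) N
  induction N generalizing U Q v with
  | zero => exact base Q _ (h1 0)
  | succ N ih =>
    by_cases hU : U = ∅
    · simp only [connectedSum, hU, if_true]
      exact base Q _ (h1 _)
    have hp := hpick U (Finset.nonempty_iff_ne_empty.2 hU)
    simp only [connectedSum, hU, if_false]
    set F := (U ∪ positions Q).powerset.filter (fun B => pick U ∈ B) with hF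
    have hterm : ∀ B ∈ F, partialSum (positions Q) (fun u => (∏ q ∈ Q, G (u (q, 0)) (u (q, 1))) *
        (‖K u B‖ₑ * ‖connectedSum (K u) pick N ((U ∪ positions (Q ∩ touched B)) \ B)
          (Q \ touched B)‖ₑ)) v ≤ κ * ((1 + 2 ^ (2 * n) * κ) ^ N * L ^ Q.card) := by
      intro B hB
      simp only [hF, Finset.mem_filter, Finset.mem_powerset] at hB
      have hdU : ∀ i ∈ U, i.1 ∉ Q := fun i hi h =>
        Finset.disjoint_left.1 hUQ hi (mem_positions.2 h)
      set Q1 := Q ∩ touched B with hQ1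
      set Q2 := Q \ touched B with hQ2
      have hQ12 : Disjoint Q1 Q2 := by
        rw [Finset.disjoint_left]; intro q h h'
        exact (Finset.mem_sdiff.1 h').2 (Finset.mem_inter.1 h).2
      have hQu : Q1 ∪ Q2 = Q := by
        ext q; simp only [hQ1, hQ2, Finset.mem_union, Finset.mem_inter, Finset.mem_sdiff]; tauto
      have hpos : positions Q = positions Q1 ∪ positions Q2 := by
        ext i; simp only [← hQu, mem_positions, Finset.mem_union]
      have hposd : Disjoint (positions Q1) (positions Q2) := by
        rw [Finset.disjoint_left]; intro i h h'
        exact Finset.disjoint_left.1 hQ12 (mem_positions.1 h) (mem_positions.1 h')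
      have hnotB : ∀ i ∈ B, i ∉ positions Q2 := fun i hi h =>
        (Finset.mem_sdiff.1 (mem_positions.1 h)).2 (mem_touched.2 ⟨i, hi, rfl⟩)
      -- Neither the cumulant of `B` nor the weights of the touched pairs depend on the positions of
      -- the untouched pairs, so the latter can be summed first.
      rw [hpos, partialSum_union hposd]
      have hinner : ∀ u, partialSum (positions Q2) (fun u => (∏ q ∈ Q, G (u (q, 0)) (u (q, 1))) *
          (‖K u B‖ₑ * ‖connectedSum (K u) pick N ((U ∪ positions Q1) \ B) Q2‖ₑ)) u ≤
          ((∏ q ∈ Q1, G (u (q, 0)) (u (q, 1))) * ‖K u B‖ₑ) *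
            ((1 + 2 ^ (2 * n) * κ) ^ N * L ^ Q2.card) := by
        intro u
        have heq : (fun u : Fin n × Fin 2 → ℤ => (∏ q ∈ Q, G (u (q, 0)) (u (q, 1))) *
          (‖K u B‖ₑ * ‖connectedSum (K u) pick N ((U ∪ positions Q1) \ B) Q2‖ₑ)) =
          fun u => ((∏ q ∈ Q1, G (u (q, 0)) (u (q, 1))) * ‖K u B‖ₑ) *
            ((∏ q ∈ Q2, G (u (q, 0)) (u (q, 1))) *
              ‖connectedSum (K u) pick N ((U ∪ positions Q1) \ B) Q2‖ₑ) := by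
          ext u
          rw [← hQu, Finset.prod_union hQ12]
          ring
        rw [heq, partialSum_mul_left
          (f := fun u => (∏ q ∈ Q1, G (u (q, 0)) (u (q, 1))) * ‖K u B‖ₑ)]
        · refine mul_le_mul_right (ih _ _ ?_ u ?_) _
          · rw [Finset.disjoint_left]
            intro i hi hi'
            rcases Finset.mem_union.1 (Finset.mem_sdiff.1 hi).1 with h | h
            · exact hdU i h (Finset.mem_sdiff.1 (mem_positions.1 hi')).1
            · exact Finset.disjoint_left.1 hposd h hi'
          · intro Q c hc
            by_cases hQ : Q = ∅
            · subst hQ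
              have : positions (∅ : Finset (Fin n)) = ∅ := by simp [positions]
              rw [this, partialSum_empty]; simpa using hc
            · simp [hQ, partialSum]
        · intro y
          congr 1
          · refine Finset.prod_congr rfl fun q hq => ?_
            have hq2 : q ∉ Q2 := Finset.disjoint_left.1 hQ12 hq
            rw [updateFinset_apply_of_notMem, updateFinset_apply_of_notMem] <;>
            simp [mem_positions, hq2]
          · rw [hdep B _ u fun i hi => updateFinset_apply_of_notMem (hnotB i hi)]
      refine (partialSum_mono hinner v).trans ?_
      rw [partialSum_mul_const]
      have hsplit : positions Q1 = (positions Q1 ∩ B) ∪ (positions Q1 \ B) :=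
        by ext i; simp only [Finset.mem_union, Finset.mem_inter, Finset.mem_sdiff]; tauto
      have hsd : Disjoint (positions Q1 ∩ B) (positions Q1 \ B) := by
        rw [Finset.disjoint_left]; intro i h h'
        exact (Finset.mem_sdiff.1 h').2 (Finset.mem_inter.1 h).2
      have hfirst : partialSum (positions Q1)
          (fun u => (∏ q ∈ Q1, G (u (q, 0)) (u (q, 1))) * ‖K u B‖ₑ) v ≤ κ * L ^ Q1.card := by
        rw [hsplit, partialSum_union hsd]
        have h2 : ∀ u, partialSum (positions Q1 \ B)
            (fun u => (∏ q ∈ Q1, G (u (q, 0)) (u (q, 1))) * ‖K u B‖ₑ) u ≤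
              ‖K u B‖ₑ * L ^ Q1.card := by
          intro u
          have : (fun u : Fin n × Fin 2 → ℤ => (∏ q ∈ Q1, G (u (q, 0)) (u (q, 1))) * ‖K u B‖ₑ) =
            fun u => ‖K u B‖ₑ * ∏ q ∈ Q1, G (u (q, 0)) (u (q, 1)) := by ext u; ring
          rw [this, partialSum_mul_left (f := fun u => ‖K u B‖ₑ)]
          · exact mul_le_mul_right (partialSum_prod_pairs_le G L hG1 hG2 B Q1
              Finset.inter_subset_right u) _
          · intro y
            rw [hdep B _ u fun i hi => updateFinset_apply_of_notMem (by simp [hi])]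
        refine (partialSum_mono h2 v).trans ?_
        rw [partialSum_mul_const]
        -- The root lies in `U`, hence not over `Q`, and is not summed. This is what allows the
        -- cumulant bound, in which one coordinate must stay fixed.
        refine mul_le_mul_left ((partialSum_mono_set (S' := B.erase (pick U)) ?_ _ v).trans
          (hK B _ hB.2 v)) _
        intro i hi
        obtain ⟨h3, h4⟩ := Finset.mem_inter.1 hi
        refine Finset.mem_erase.2 ⟨?_, h4⟩
        rintro rfl
        exact hdU _ hp (Finset.mem_inter.1 (mem_positions.1 h3)).1
      calc _ ≤ κ * L ^ Q1.card * ((1 + 2 ^ (2 * n) * κ) ^ N * L ^ Q2.card) :=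
            mul_le_mul_left hfirst _
        _ = κ * ((1 + 2 ^ (2 * n) * κ) ^ N * L ^ (Q1.card + Q2.card)) := by rw [pow_add]; ring
        _ = _ := by rw [← Finset.card_union_of_disjoint hQ12, hQu]
    calc _ ≤ partialSum (positions Q) (fun u => ∑ B ∈ F, (∏ q ∈ Q, G (u (q, 0)) (u (q, 1))) *
        (‖K u B‖ₑ * ‖connectedSum (K u) pick N ((U ∪ positions (Q ∩ touched B)) \ B)
          (Q \ touched B)‖ₑ)) v := by
          refine partialSum_mono (fun u => ?_) v
          rw [← Finset.mul_sum]
          refine mul_le_mul_right ?_ _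
          refine (enorm_sum_le _ _).trans (le_of_eq ?_)
          simp only [enorm_mul]
      _ = ∑ B ∈ F, _ := partialSum_sum _ _ _ _
      _ ≤ ∑ B ∈ F, κ * ((1 + 2 ^ (2 * n) * κ) ^ N * L ^ Q.card) := Finset.sum_le_sum hterm
      _ = F.card * (κ * ((1 + 2 ^ (2 * n) * κ) ^ N * L ^ Q.card)) := by
          rw [Finset.sum_const, nsmul_eq_mul]
      _ ≤ 2 ^ (2 * n) * (κ * ((1 + 2 ^ (2 * n) * κ) ^ N * L ^ Q.card)) := by
          refine mul_le_mul_left ?_ _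
          have : F.card ≤ 2 ^ (2 * n) := by
            refine (Finset.card_le_univ F).trans (le_of_eq ?_)
            simp [mul_comm]
          exact_mod_cast this
      _ = (2 ^ (2 * n) * κ) * ((1 + 2 ^ (2 * n) * κ) ^ N * L ^ Q.card) := by ring
      _ ≤ (1 + 2 ^ (2 * n) * κ) * ((1 + 2 ^ (2 * n) * κ) ^ N * L ^ Q.card) :=
          mul_le_mul_left le_add_self _
      _ = _ := by rw [pow_succ]; ring

end Bound

/-! ### Summability of the cumulants with one time held fixed -/

section Mass

variable {Ω : Type*} [MeasurableSpace Ω] {P : Measure Ω} {X : ℤ → Ω → ℝ} {p : ℕ}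

lemma summable_abs_kappa (hX : StationaryCumulantCondition P X p) {m : ℕ} (hm : 1 ≤ m)
    (hmp : m + 1 ≤ p) : Summable (fun j : Fin m → ℤ => |kappa P X j|) := by
  refine (hX.summable_kappa m hm hmp ⟨0, hm⟩).of_nonneg_of_le (fun _ => abs_nonneg _) fun j => ?_
  exact le_mul_of_one_le_left (abs_nonneg _) (by simp)

variable (P X p) in
/-- The total mass of the cumulants of the orders `2, …, p`. -/
noncomputable def cumulantMass : ℝ≥0∞ :=
  ∑ m ∈ Finset.Ico 1 p, ∑' j : Fin m → ℤ, ‖kappa P X j‖ₑ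

lemma cumulantMass_ne_top (hX : StationaryCumulantCondition P X p) : cumulantMass P X p ≠ ⊤ := by
  refine ENNReal.sum_ne_top.2 fun m hm => ?_
  rw [Finset.mem_Ico] at hm
  have := (summable_abs_kappa hX hm.1 (by omega)).tsum_ofReal_ne_top
  simpa [Real.enorm_eq_ofReal_abs] using this

/-- By stationarity the cumulant depends only on the lags relative to the fixed time `v i`, and
summing the other times is summing over all lags. Singletons have no summability assumption but
vanish because the mean is zero. -/
lemma partialSum_mixedCumulant_le [IsProbabilityMeasure P]
    (hX : StationaryCumulantCondition P X p) (hmean : ∀ t : ℤ, ∫ x, X t x ∂P = 0)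
    {ι : Type*} [DecidableEq ι] (B : Finset ι) (hB : B.card ≤ p) (i : ι) (hi : i ∈ B) (v : ι → ℤ) :
    partialSum (B.erase i) (fun u => ‖mixedCumulant P X u B‖ₑ) v ≤ cumulantMass P X p := by
  obtain ⟨m, hm⟩ : ∃ m, (B.erase i).card = m := ⟨_, rfl⟩
  have hBm : m + 1 = B.card := by rw [← hm, Finset.card_erase_add_one hi]
  rcases Nat.eq_zero_or_pos m with rfl | hpos
  · have h0 : B = {i} := by
      have := Finset.card_eq_zero.1 hm
      rw [← Finset.insert_erase hi, this]
      rfl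
    subst h0
    simp [mixedCumulant_singleton hmean, partialSum]
  · let e : Fin m ≃ (B.erase i : Finset ι) := ((B.erase i).equivFinOfCardEq hm).symm
    -- The enumeration of `B` starts with `i`, so that `v i` becomes the reference time of `kappa`.
    let f : Fin (m + 1) ↪ ι := ⟨Fin.cons i (fun l => (e l : ι)), by
      rw [Fin.cons_injective_iff]
      refine ⟨?_, Subtype.val_injective.comp e.injective⟩
      rintro ⟨l, hl⟩
      exact (Finset.mem_erase.1 (e l).2).1 hl⟩
    have hf : Finset.univ.map f = B := by
      apply Finset.eq_of_subset_of_card_le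
      · intro y hy
        obtain ⟨l, _, rfl⟩ := Finset.mem_map.1 hy
        refine Fin.cases hi (fun l => ?_) l
        exact (Finset.mem_erase.1 (e l).2).2
      · simp [hBm]
    have hval : ∀ y : (↥(B.erase i)) → ℤ,
        mixedCumulant P X (Function.updateFinset v (B.erase i) y) B =
          kappa P X (fun l => y (e l) - v i) := by
      intro y
      have h := mixedCumulant_eq_kappa hX (by omega) f (Function.updateFinset v (B.erase i) y)
      rw [hf] at h
      rw [h]
      congr 1
      ext l
      have h1 : f l.succ = (e l : ι) := rfl
      have h2 : f 0 = i := rfl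
      rw [h1, h2]
      congr 1
      · simp only [Function.updateFinset, (e l).2, dif_pos]
      · simp [Function.updateFinset]
    unfold partialSum
    simp only [hval]
    have hle : ∑' j : Fin m → ℤ, ‖kappa P X j‖ₑ ≤ cumulantMass P X p :=
      Finset.single_le_sum (f := fun m => ∑' j : Fin m → ℤ, ‖kappa P X j‖ₑ)
        (fun _ _ => zero_le) (Finset.mem_Ico.2 ⟨hpos, by omega⟩)
    refine le_trans (le_of_eq ?_) hle
    exact (Equiv.arrowCongr e.symm (Equiv.subRight (v i))).tsum_eq
      (fun j : Fin m → ℤ => ‖kappa P X j‖ₑ)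

lemma mixedMoment_congr {ι : Type*} {u v : ι → ℤ} {S : Finset ι} (h : ∀ i ∈ S, u i = v i) :
    mixedMoment P X u S = mixedMoment P X v S := by
  unfold mixedMoment
  congr 1; ext x
  exact Finset.prod_congr rfl fun i hi => by rw [h i hi]

lemma dependsOnIndex_mixedCumulant {ι : Type*} [DecidableEq ι] :
    DependsOnIndex (fun (u : ι → ℤ) B => mixedCumulant P X u B) := by
  intro B u v h
  simp only [mixedCumulant, setCumulant]
  refine Finset.sum_congr rfl fun π _ => ?_
  congr 1
  exact Finset.prod_congr rfl fun C hC => mixedMoment_congr fun i hi => h i (π.subset hC hi)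

end Mass

/-! ### Connected sums rooted at the pair `0` -/

section RootedSum

open Classical in
/-- A choice of an element of each nonempty set of positions. -/
noncomputable def pickPosition {n : ℕ} (U : Finset (Fin (n + 1) × Fin 2)) : Fin (n + 1) × Fin 2 :=
  if h : U.Nonempty then h.choose else 0

lemma pickPosition_mem {n : ℕ} (U : Finset (Fin (n + 1) × Fin 2)) (h : U.Nonempty) :
    pickPosition U ∈ U := by
  rw [pickPosition, dif_pos h]; exact h.choose_spec

variable {Ω : Type*} [MeasurableSpace Ω] {P : Measure Ω} {X : ℤ → Ω → ℝ} {p : ℕ}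

variable (P X) in
/-- The connected part of the moment of all the `n + 1` pairs at the times `u`. -/
noncomputable def pairCumulant {n : ℕ} (Q : Finset (Fin (n + 1)))
    (u : Fin (n + 1) × Fin 2 → ℤ) : ℝ :=
  connectedSum (mixedCumulant P X u) pickPosition (2 * (n + 1)) (positions {0}) Q

/-- The case of the frontier consisting of the two positions of pair `0`. There are `2 * (n + 1)`
positions in all, so this many steps exhaust every exploration. -/
lemma sum_pairCumulant_mul [IsProbabilityMeasure P] {n : ℕ} (W : Finset (Fin (n + 1)))
    (hW : 0 ∉ W) (u : Fin (n + 1) × Fin 2 → ℤ) :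
    ∑ Q ∈ W.powerset, pairCumulant P X Q u * mixedMoment P X u (positions (W \ Q)) =
      mixedMoment P X u (positions (insert 0 W)) := by
  have h := sum_connectedSum_mul (mixedCumulant P X u) (mixedMoment P X u) pickPosition
    pickPosition_mem (fun S s hs => mixedMoment_eq_sum_cumulant u hs) (2 * (n + 1))
    (positions {0}) W ?_ ?_
  · unfold pairCumulant
    rw [h]
    congr 1
    ext i; simp [mem_positions]
  · rw [Finset.disjoint_left]
    intro i hi hi'
    rw [mem_positions, Finset.mem_singleton] at hi
    rw [mem_positions, hi] at hi'
    exact hW hi'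
  · refine (Finset.card_le_univ _).trans (le_of_eq ?_)
    simp [mul_comm]

/-- With both times of pair `0` frozen, the connected bound gives `L ^ n` for the other pairs. The
second time of pair `0` contributes one more `L`, and only its first time ranges freely over `T`
values. -/
theorem tsum_pairCumulant_le [IsProbabilityMeasure P] {n : ℕ} (hn : 2 * (n + 1) ≤ p)
    (hX : StationaryCumulantCondition P X p) (hmean : ∀ t : ℤ, ∫ x, X t x ∂P = 0)
    (G : ℤ → ℤ → ℝ≥0∞) (L : ℝ≥0∞) (T : ℕ)
    (hG : ∀ x y, x ∉ Finset.Icc (1 : ℤ) T → G x y = 0)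
    (hG1 : ∀ x, ∑' y, G x y ≤ L) (hG2 : ∀ y, ∑' x, G x y ≤ L) :
    ∑' u : Fin (n + 1) × Fin 2 → ℤ, (∏ q, G (u (q, 0)) (u (q, 1))) *
      ‖pairCumulant P X (Finset.univ.erase 0) u‖ₑ ≤
      T * ((1 + 2 ^ (2 * (n + 1)) * cumulantMass P X p) ^ (2 * (n + 1)) * L ^ (n + 1)) := by
  set c := (1 + 2 ^ (2 * (n + 1)) * cumulantMass P X p) ^ (2 * (n + 1)) with hc
  set Q : Finset (Fin (n + 1)) := Finset.univ.erase 0 with hQ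
  set F : (Fin (n + 1) × Fin 2 → ℤ) → ℝ≥0∞ := fun u => (∏ q, G (u (q, 0)) (u (q, 1))) *
      ‖pairCumulant P X Q u‖ₑ with hF
  have h0 : ∑' u, F u = partialSum Finset.univ F 0 := by
    unfold partialSum
    rw [← (Equiv.piCongrLeft' (fun _ : Fin (n + 1) × Fin 2 => ℤ)
      (Equiv.subtypeUnivEquiv Finset.mem_univ).symm).symm.tsum_eq]
    refine tsum_congr fun y => ?_
    congr 1
    ext i
    simp [Function.updateFinset, Equiv.piCongrLeft']
  have hsets : (Finset.univ : Finset (Fin (n + 1) × Fin 2)) =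
      {(0, 0)} ∪ ({(0, 1)} ∪ positions Q) := by
    ext ⟨q, i⟩
    simp only [Finset.mem_univ, Finset.mem_union, Finset.mem_singleton, Prod.mk.injEq,
      mem_positions, hQ, Finset.mem_erase, and_true, true_iff]
    have hi : i = 0 ∨ i = 1 := by omega
    tauto
  have hd1 : Disjoint ({(0, 0)} : Finset (Fin (n + 1) × Fin 2)) ({(0, 1)} ∪ positions Q) := by
    rw [Finset.disjoint_singleton_left]; simp [mem_positions, hQ]
  have hd2 : Disjoint ({(0, 1)} : Finset (Fin (n + 1) × Fin 2)) (positions Q) := by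
    rw [Finset.disjoint_singleton_left]; simp [mem_positions, hQ]
  have hFeq : F = fun u => G (u (0, 0)) (u (0, 1)) * ((∏ q ∈ Q, G (u (q, 0)) (u (q, 1))) *
      ‖pairCumulant P X Q u‖ₑ) := by
    ext u
    rw [hF, ← mul_assoc]
    simp only
    rw [hQ, Finset.mul_prod_erase Finset.univ (fun q : Fin (n + 1) => G (u (q, 0)) (u (q, 1)))
      (Finset.mem_univ 0)]
  have hcard : Q.card = n := by simp [hQ]
  have hin : ∀ u, partialSum (positions Q) F u ≤ G (u (0, 0)) (u (0, 1)) * (c * L ^ n) := by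
    intro u
    rw [hFeq, partialSum_mul_left (f := fun u => G (u (0, 0)) (u (0, 1)))]
    · refine mul_le_mul_right ?_ _
      have := partialSum_connectedSum_le (fun u B => mixedCumulant P X u B)
        dependsOnIndex_mixedCumulant (cumulantMass P X p)
        (fun B i hi v => partialSum_mixedCumulant_le hX hmean B
          ((Finset.card_le_univ B).trans (by simpa [mul_comm] using hn)) i hi v)
        pickPosition pickPosition_mem G L hG1 hG2 (2 * (n + 1)) (positions {0}) Q ?_ u
      · rw [hcard] at this
        exact this
      · rw [Finset.disjoint_left]
        intro i hi hi'
        rw [mem_positions, Finset.mem_singleton] at hi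
        rw [mem_positions, hi] at hi'
        simp [hQ] at hi'
    · intro y
      rw [updateFinset_apply_of_notMem, updateFinset_apply_of_notMem] <;> simp [mem_positions, hQ]
  have hmid : ∀ u, partialSum ({(0, 1)} ∪ positions Q) F u ≤
      (if u (0, 0) ∈ Finset.Icc (1 : ℤ) T then 1 else 0) * (c * L ^ (n + 1)) := by
    intro u
    rw [partialSum_union hd2]
    refine (partialSum_mono hin u).trans ?_
    rw [partialSum_mul_const, partialSum_singleton]
    simp only [Function.update_self, ne_eq, Prod.mk.injEq, zero_ne_one, and_false,
      not_false_eq_true, Function.update_of_ne]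
    split_ifs with h
    · rw [one_mul]
      calc _ ≤ L * (c * L ^ n) := mul_le_mul_left (hG1 _) _
        _ = _ := by ring
    · simp [hG _ _ h]
  rw [h0, hsets, partialSum_union hd1]
  refine (partialSum_mono hmid 0).trans ?_
  rw [partialSum_mul_const, partialSum_singleton]
  refine mul_le_mul_left (le_of_eq ?_) _
  simp only [Function.update_self]
  rw [tsum_eq_sum (s := Finset.Icc (1 : ℤ) T) (fun b hb => by simp only [hb, if_false])]
  rw [Finset.sum_congr rfl (fun b hb => if_pos hb)]
  simp

end RootedSum

/-! ### Third and fourth cumulants of complex variables and their multilinearity -/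

section ComplexCumulants

variable {Ω : Type*} [MeasurableSpace Ω] (P : Measure Ω)

/-- The third joint cumulant of complex random variables. -/
noncomputable def cum3 (A B C : Ω → ℂ) : ℂ :=
  ∫ x, A x * (B x * C x) ∂P - (∫ x, A x ∂P) * (∫ x, B x * C x ∂P) -
    (∫ x, B x ∂P) * (∫ x, A x * C x ∂P) - (∫ x, C x ∂P) * (∫ x, A x * B x ∂P) +
    2 * ((∫ x, A x ∂P) * ((∫ x, B x ∂P) * (∫ x, C x ∂P)))

/-- The fourth joint cumulant of complex random variables. -/
noncomputable def cum4 (A B C D : Ω → ℂ) : ℂ :=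
  ∫ x, A x * (B x * (C x * D x)) ∂P
    - (∫ x, A x ∂P) * (∫ x, B x * (C x * D x) ∂P) - (∫ x, B x ∂P) * (∫ x, A x * (C x * D x) ∂P)
    - (∫ x, C x ∂P) * (∫ x, A x * (B x * D x) ∂P) - (∫ x, D x ∂P) * (∫ x, A x * (B x * C x) ∂P)
    - (∫ x, A x * B x ∂P) * (∫ x, C x * D x ∂P) - (∫ x, A x * C x ∂P) * (∫ x, B x * D x ∂P)
    - (∫ x, A x * D x ∂P) * (∫ x, B x * C x ∂P)
    + 2 * ((∫ x, A x * B x ∂P) * ((∫ x, C x ∂P) * (∫ x, D x ∂P)))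
    + 2 * ((∫ x, A x * C x ∂P) * ((∫ x, B x ∂P) * (∫ x, D x ∂P)))
    + 2 * ((∫ x, A x * D x ∂P) * ((∫ x, B x ∂P) * (∫ x, C x ∂P)))
    + 2 * ((∫ x, A x ∂P) * ((∫ x, D x ∂P) * (∫ x, B x * C x ∂P)))
    + 2 * ((∫ x, A x ∂P) * ((∫ x, C x ∂P) * (∫ x, B x * D x ∂P)))
    + 2 * ((∫ x, A x ∂P) * ((∫ x, B x ∂P) * (∫ x, C x * D x ∂P)))
    - 6 * ((∫ x, A x ∂P) * ((∫ x, B x ∂P) * ((∫ x, C x ∂P) * (∫ x, D x ∂P))))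

lemma cum3_swap12 (A B C : Ω → ℂ) : cum3 P A B C = cum3 P B A C := by
  simp only [cum3, mul_comm, mul_left_comm]; ring

lemma cum3_swap13 (A B C : Ω → ℂ) : cum3 P A B C = cum3 P C B A := by
  simp only [cum3, mul_comm, mul_left_comm]; ring

lemma cum4_swap12 (A B C D : Ω → ℂ) : cum4 P A B C D = cum4 P B A C D := by
  simp only [cum4, mul_comm, mul_left_comm]; ring

lemma cum4_swap13 (A B C D : Ω → ℂ) : cum4 P A B C D = cum4 P C B A D := by
  simp only [cum4, mul_comm, mul_left_comm]; ring

lemma cum4_swap14 (A B C D : Ω → ℂ) : cum4 P A B C D = cum4 P D B C A := by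
  simp only [cum4, mul_comm, mul_left_comm]; ring

/-- The fourth moment in terms of second moments, means and higher cumulants. -/
lemma integral_four_eq (A B C D : Ω → ℂ) :
    ∫ x, A x * (B x * (C x * D x)) ∂P =
      (∫ x, A x * B x ∂P) * (∫ x, C x * D x ∂P) + (∫ x, A x * C x ∂P) * (∫ x, B x * D x ∂P) +
      (∫ x, A x * D x ∂P) * (∫ x, B x * C x ∂P) + cum4 P A B C D +
      ((∫ x, A x ∂P) * cum3 P B C D + (∫ x, B x ∂P) * cum3 P A C D +
        (∫ x, C x ∂P) * cum3 P A B D + (∫ x, D x ∂P) * cum3 P A B C) -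
      2 * ((∫ x, A x ∂P) * ((∫ x, B x ∂P) * ((∫ x, C x ∂P) * (∫ x, D x ∂P)))) := by
  simp only [cum3, cum4]; ring

variable {P}

lemma memLp_mul_two {A B : Ω → ℂ} (hA : MemLp A 4 P) (hB : MemLp B 4 P) :
    MemLp (fun x => A x * B x) 2 P := by
  have : ENNReal.HolderTriple 4 4 2 := ⟨by
    have h : (4 : ℝ≥0∞) = 2 * 2 := by norm_num
    rw [h, ENNReal.mul_inv (by simp) (by simp), ← mul_add, ENNReal.inv_two_add_inv_two, mul_one]⟩
  exact hB.mul hA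

lemma memLp_mul_four {A B : Ω → ℝ} (hA : MemLp A 8 P) (hB : MemLp B 8 P) :
    MemLp (fun x => A x * B x) 4 P := by
  have : ENNReal.HolderTriple 8 8 4 := ⟨by
    have h : (8 : ℝ≥0∞) = 4 * 2 := by norm_num
    rw [h, ENNReal.mul_inv (by simp) (by simp), ← mul_add, ENNReal.inv_two_add_inv_two, mul_one]⟩
  exact hB.mul hA

lemma integrable_mul_two [IsProbabilityMeasure P] {A B : Ω → ℂ} (hA : MemLp A 4 P)
    (hB : MemLp B 4 P) :
    Integrable (fun x => A x * B x) P := (memLp_mul_two hA hB).integrable (by norm_num)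

lemma integrable_mul_three [IsProbabilityMeasure P] {A B C : Ω → ℂ} (hA : MemLp A 4 P)
    (hB : MemLp B 4 P)
    (hC : MemLp C 4 P) : Integrable (fun x => A x * (B x * C x)) P :=
  (hA.mono_exponent (by norm_num : (2 : ℝ≥0∞) ≤ 4)).integrable_mul (memLp_mul_two hB hC)

lemma integrable_mul_four {A B C D : Ω → ℂ} (hA : MemLp A 4 P) (hB : MemLp B 4 P)
    (hC : MemLp C 4 P) (hD : MemLp D 4 P) :
    Integrable (fun x => A x * (B x * (C x * D x))) P := by
  refine ((memLp_mul_two hA hB).integrable_mul (memLp_mul_two hC hD)).congr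
    (Filter.Eventually.of_forall fun x => ?_)
  simp only [Pi.mul_apply, mul_assoc]

lemma integral_sum_mul {κ : Type*} (I : Finset κ) (a : κ → ℂ) (Z : κ → Ω → ℂ) (W : Ω → ℂ)
    (h : ∀ p ∈ I, Integrable (fun x => Z p x * W x) P) :
    ∫ x, (∑ p ∈ I, a p * Z p x) * W x ∂P = ∑ p ∈ I, a p * ∫ x, Z p x * W x ∂P := by
  simp only [Finset.sum_mul, mul_assoc]
  rw [integral_finsetSum I (fun p hp => (h p hp).const_mul (a p))]
  simp only [integral_const_mul]

lemma integral_sum_smul {κ : Type*} (I : Finset κ) (a : κ → ℂ) (Z : κ → Ω → ℂ)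
    (h : ∀ p ∈ I, Integrable (Z p) P) :
    ∫ x, (∑ p ∈ I, a p * Z p x) ∂P = ∑ p ∈ I, a p * ∫ x, Z p x ∂P := by
  rw [integral_finsetSum I (fun p hp => (h p hp).const_mul (a p))]
  simp only [integral_const_mul]

lemma cum3_sum [IsProbabilityMeasure P] {κ : Type*} (I : Finset κ) (a : κ → ℂ) (Z : κ → Ω → ℂ)
    {B C : Ω → ℂ}
    (hZ : ∀ p, MemLp (Z p) 4 P) (hB : MemLp B 4 P) (hC : MemLp C 4 P) :
    cum3 P (fun x => ∑ p ∈ I, a p * Z p x) B C = ∑ p ∈ I, a p * cum3 P (Z p) B C := by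
  have h1 : (1 : ℝ≥0∞) ≤ 4 := by norm_num
  simp only [cum3]
  rw [integral_sum_smul I a Z (fun p _ => (hZ p).integrable h1),
    integral_sum_mul I a Z B (fun p _ => integrable_mul_two (hZ p) hB),
    integral_sum_mul I a Z C (fun p _ => integrable_mul_two (hZ p) hC),
    integral_sum_mul I a Z _ (fun p _ => integrable_mul_three (hZ p) hB hC)]
  simp only [Finset.sum_mul, Finset.mul_sum, ← Finset.sum_sub_distrib, ← Finset.sum_add_distrib]
  exact Finset.sum_congr rfl fun p _ => by ring

lemma cum4_sum [IsProbabilityMeasure P] {κ : Type*} (I : Finset κ) (a : κ → ℂ) (Z : κ → Ω → ℂ)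
    {B C D : Ω → ℂ}
    (hZ : ∀ p, MemLp (Z p) 4 P) (hB : MemLp B 4 P) (hC : MemLp C 4 P) (hD : MemLp D 4 P) :
    cum4 P (fun x => ∑ p ∈ I, a p * Z p x) B C D = ∑ p ∈ I, a p * cum4 P (Z p) B C D := by
  have h1 : (1 : ℝ≥0∞) ≤ 4 := by norm_num
  simp only [cum4]
  rw [integral_sum_smul I a Z (fun p _ => (hZ p).integrable h1),
    integral_sum_mul I a Z B (fun p _ => integrable_mul_two (hZ p) hB),
    integral_sum_mul I a Z C (fun p _ => integrable_mul_two (hZ p) hC),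
    integral_sum_mul I a Z D (fun p _ => integrable_mul_two (hZ p) hD),
    integral_sum_mul I a Z _ (fun p _ => integrable_mul_three (hZ p) hB hC),
    integral_sum_mul I a Z _ (fun p _ => integrable_mul_three (hZ p) hB hD),
    integral_sum_mul I a Z _ (fun p _ => integrable_mul_three (hZ p) hC hD),
    integral_sum_mul I a Z _ (fun p _ => integrable_mul_four (hZ p) hB hC hD)]
  simp only [Finset.sum_mul, Finset.mul_sum, ← Finset.sum_sub_distrib, ← Finset.sum_add_distrib]
  exact Finset.sum_congr rfl fun p _ => by ring

lemma memLp_sum_mul {κ : Type*} (I : Finset κ) (a : κ → ℂ) (Z : κ → Ω → ℂ)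
    (hZ : ∀ p, MemLp (Z p) 4 P) : MemLp (fun x => ∑ p ∈ I, a p * Z p x) 4 P :=
  memLp_finsetSum I fun p _ => (hZ p).const_mul (a p)

/-- Linearity is established in the first slot only; the symmetry lemmas bring each slot there in
turn. -/
lemma cum3_sum_sum [IsProbabilityMeasure P] {κ : Type*} (I : Finset κ) (a b c : κ → ℂ)
    (Z : κ → Ω → ℂ)
    (hZ : ∀ p, MemLp (Z p) 4 P) :
    cum3 P (fun x => ∑ p ∈ I, a p * Z p x) (fun x => ∑ p ∈ I, b p * Z p x)
      (fun x => ∑ p ∈ I, c p * Z p x) =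
    ∑ p ∈ I, ∑ q ∈ I, ∑ r ∈ I, a p * (b q * (c r * cum3 P (Z p) (Z q) (Z r))) := by
  have hS := fun a => memLp_sum_mul (P := P) I a Z hZ
  rw [cum3_sum I a Z hZ (hS b) (hS c)]
  refine Finset.sum_congr rfl fun p _ => ?_
  rw [cum3_swap12, cum3_sum I b Z hZ (hZ p) (hS c), Finset.mul_sum]
  refine Finset.sum_congr rfl fun q _ => ?_
  rw [cum3_swap13, cum3_sum I c Z hZ (hZ p) (hZ q), Finset.mul_sum, Finset.mul_sum]
  refine Finset.sum_congr rfl fun r _ => ?_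
  rw [cum3_swap13 P (Z r), cum3_swap12 P (Z q)]

lemma cum4_sum_sum [IsProbabilityMeasure P] {κ : Type*} (I : Finset κ) (a b c d : κ → ℂ)
    (Z : κ → Ω → ℂ)
    (hZ : ∀ p, MemLp (Z p) 4 P) :
    cum4 P (fun x => ∑ p ∈ I, a p * Z p x) (fun x => ∑ p ∈ I, b p * Z p x)
      (fun x => ∑ p ∈ I, c p * Z p x) (fun x => ∑ p ∈ I, d p * Z p x) =
    ∑ p ∈ I, ∑ q ∈ I, ∑ r ∈ I, ∑ s ∈ I,
      a p * (b q * (c r * (d s * cum4 P (Z p) (Z q) (Z r) (Z s)))) := by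
  have hS := fun a => memLp_sum_mul (P := P) I a Z hZ
  rw [cum4_sum I a Z hZ (hS b) (hS c) (hS d)]
  refine Finset.sum_congr rfl fun p _ => ?_
  rw [cum4_swap12, cum4_sum I b Z hZ (hZ p) (hS c) (hS d), Finset.mul_sum]
  refine Finset.sum_congr rfl fun q _ => ?_
  rw [cum4_swap12, cum4_swap13, cum4_sum I c Z hZ (hZ q) (hZ p) (hS d), Finset.mul_sum,
    Finset.mul_sum]
  refine Finset.sum_congr rfl fun r _ => ?_
  rw [cum4_swap13, cum4_swap14, cum4_sum I d Z hZ (hZ q) (hZ r) (hZ p), Finset.mul_sum,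
    Finset.mul_sum, Finset.mul_sum]
  refine Finset.sum_congr rfl fun s _ => ?_
  rw [cum4_swap14]

end ComplexCumulants

/-! ### Cumulants of products of pairs are the connected sums -/

section Quadratic

variable {Ω : Type*} [MeasurableSpace Ω] {P : Measure Ω} {X : ℤ → Ω → ℝ} {p : ℕ}

/-- The product of the observations at two times. -/
noncomputable def pairProd (X : ℤ → Ω → ℝ) (p : ℤ × ℤ) (x : Ω) : ℂ :=
  ((X p.1 x * X p.2 x : ℝ) : ℂ)

lemma memLp_pairProd [IsProbabilityMeasure P] (hX : StationaryCumulantCondition P X 8)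
    (p : ℤ × ℤ) : MemLp (pairProd X p) 4 P :=
  (memLp_mul_four (hX.memLp p.1) (hX.memLp p.2)).ofReal

/-- The times of a list of pairs. -/
def pairTimes {n : ℕ} (p : Fin n → ℤ × ℤ) (i : Fin n × Fin 2) : ℤ :=
  if i.2 = 0 then (p i.1).1 else (p i.1).2

lemma mixedMoment_positions {n : ℕ} (p : Fin n → ℤ × ℤ) (Q : Finset (Fin n)) :
    ((mixedMoment P X (pairTimes p) (positions Q) : ℝ) : ℂ) = ∫ x, ∏ q ∈ Q, pairProd X
        (p q) x ∂P := by
  rw [mixedMoment, ← integral_complex_ofReal]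
  congr 1; ext x
  rw [positions, Finset.prod_product, Complex.ofReal_prod]
  refine Finset.prod_congr rfl fun q _ => ?_
  simp [pairProd, pairTimes, Fin.prod_univ_two]

/-- Cumulants and connected sums obey the same recursion rooted at pair `0`: the moment of a family
splits according to the subfamily connected to the root. The recursion is triangular in the
subfamilies, so its values at `∅`, `{1}`, `{2}` and `{1, 2}` determine the connected sum of all
three pairs. Coinciding times do no harm, since partitions are taken of positions and not of times.
-/
lemma cum3_pairProd [IsProbabilityMeasure P] (p : Fin 3 → ℤ × ℤ) :
    cum3 P (pairProd X (p 0)) (pairProd X (p 1)) (pairProd X (p 2)) =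
      ((pairCumulant P X (Finset.univ.erase (0 : Fin 3)) (pairTimes p) : ℝ) : ℂ) := by
  have key : ∀ W : Finset (Fin 3), 0 ∉ W → ∑ Q ∈ W.powerset,
      ((pairCumulant P X Q (pairTimes p) : ℝ) : ℂ) * ∫ x, ∏ q ∈ W \ Q, pairProd X (p q) x ∂P =
        ∫ x, ∏ q ∈ insert 0 W, pairProd X (p q) x ∂P := by
    intro W hW
    have := sum_pairCumulant_mul (P := P) (X := X) W hW (pairTimes p)
    rw [← mixedMoment_positions, ← this]
    push_cast
    simp only [mixedMoment_positions]
  have h0 := key ∅ (by decide)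
  have h1 := key {1} (by decide)
  have h2 := key {2} (by decide)
  have h12 := key {1, 2} (by decide)
  have hu : (Finset.univ : Finset (Fin 3)).erase 0 = {1, 2} := by decide
  rw [hu]
  have p1 : ({1} : Finset (Fin 3)).powerset = {∅, {1}} := by decide
  have p2 : ({2} : Finset (Fin 3)).powerset = {∅, {2}} := by decide
  have p12 : ({1, 2} : Finset (Fin 3)).powerset = {∅, {1}, {2}, {1, 2}} := by decide
  have d1 : ({1, 2} : Finset (Fin 3)) \ {1} = {2} := by decide
  have d2 : ({1, 2} : Finset (Fin 3)) \ {2} = {1} := by decide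
  simp only [Finset.powerset_empty, Finset.sum_singleton, Finset.sdiff_self, Finset.prod_empty,
    integral_const, probReal_univ, one_smul, mul_one, insert_empty_eq, Finset.prod_singleton] at h0
  rw [p1, Finset.sum_pair (by decide)] at h1
  rw [p2, Finset.sum_pair (by decide)] at h2
  rw [p12, Finset.sum_insert (by decide), Finset.sum_insert (by decide),
    Finset.sum_pair (by decide), d1, d2] at h12
  simp only [Finset.sdiff_empty, Finset.sdiff_self, Finset.prod_empty,
    integral_const, probReal_univ, one_smul, mul_one, Finset.prod_singleton] at h1 h2 h12
  have e01 : ∀ x, ∏ q ∈ ({0, 1} : Finset (Fin 3)), pairProd X (p q) x =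
      pairProd X (p 0) x * pairProd X (p 1) x := fun x => by simp
  have e02 : ∀ x, ∏ q ∈ ({0, 2} : Finset (Fin 3)), pairProd X (p q) x =
      pairProd X (p 0) x * pairProd X (p 2) x := fun x => by simp
  have e12 : ∀ x, ∏ q ∈ ({1, 2} : Finset (Fin 3)), pairProd X (p q) x =
      pairProd X (p 1) x * pairProd X (p 2) x := fun x => by simp
  have e012 : ∀ x, ∏ q ∈ ({0, 1, 2} : Finset (Fin 3)), pairProd X (p q) x =
      pairProd X (p 0) x * (pairProd X (p 1) x * pairProd X (p 2) x) := fun x => by simp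
  simp only [e01, e02, e12, e012] at h1 h2 h12
  simp only [cum3]
  linear_combination -h12 + (∫ x, pairProd X (p 2) x ∂P) * h1 + (∫ x, pairProd X (p 1) x ∂P) * h2 +
      ((∫ x, pairProd X (p 1) x * pairProd X (p 2) x ∂P) - 2 * (∫ x, pairProd X (p 1) x ∂P) *
      (∫ x, pairProd X (p 2) x ∂P)) * h0

/-- The same triangular recursion as for three pairs, over the eight subsets of `{1, 2, 3}`. -/
lemma cum4_pairProd [IsProbabilityMeasure P] (p : Fin 4 → ℤ × ℤ) :
    cum4 P (pairProd X (p 0)) (pairProd X (p 1)) (pairProd X (p 2)) (pairProd X (p 3)) =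
      ((pairCumulant P X (Finset.univ.erase (0 : Fin 4)) (pairTimes p) : ℝ) : ℂ) := by
  have key : ∀ W : Finset (Fin 4), 0 ∉ W → ∑ Q ∈ W.powerset,
      ((pairCumulant P X Q (pairTimes p) : ℝ) : ℂ) * ∫ x, ∏ q ∈ W \ Q, pairProd X (p q) x ∂P =
        ∫ x, ∏ q ∈ insert 0 W, pairProd X (p q) x ∂P := by
    intro W hW
    have := sum_pairCumulant_mul (P := P) (X := X) W hW (pairTimes p)
    rw [← mixedMoment_positions, ← this]
    push_cast
    simp only [mixedMoment_positions]
  have h0 := key ∅ (by decide)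
  simp only [Finset.powerset_empty, Finset.sum_singleton, Finset.sdiff_self, Finset.prod_empty,
    integral_const, probReal_univ, one_smul, mul_one, insert_empty_eq, Finset.prod_singleton] at h0
  have key1 : ∀ i : Fin 4, 0 ≠ i → ((pairCumulant P X ∅ (pairTimes p) : ℝ) : ℂ) *
      (∫ x, pairProd X (p i) x ∂P) + ((pairCumulant P X {i} (pairTimes p) : ℝ) : ℂ) =
        ∫ x, pairProd X (p 0) x * pairProd X (p i) x ∂P := by
    intro i hi
    have h := key {i} (by simpa using hi)
    have hp : ({i} : Finset (Fin 4)).powerset = {∅, {i}} := by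
      clear h hi; decide +revert
    rw [hp, Finset.sum_pair (by simp)] at h
    simp only [Finset.sdiff_empty, Finset.sdiff_self, Finset.prod_empty,
      integral_const, probReal_univ, one_smul, mul_one, Finset.prod_singleton,
      Finset.prod_pair hi] at h
    exact h
  have comb : ∀ i j : Fin 4, i ≠ j →
      ({i, j} : Finset (Fin 4)).powerset = {∅, {i}, {j}, {i, j}} ∧
      ({i, j} : Finset (Fin 4)) \ {i} = {j} ∧ ({i, j} : Finset (Fin 4)) \ {j} = {i} ∧
      (∅ : Finset (Fin 4)) ∉ ({{i}, {j}, {i, j}} : Finset (Finset (Fin 4))) ∧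
      ({i} : Finset (Fin 4)) ∉ ({{j}, {i, j}} : Finset (Finset (Fin 4))) ∧
      ({j} : Finset (Fin 4)) ≠ {i, j} := by decide
  have key2 : ∀ i j : Fin 4, 0 ≠ i → 0 ≠ j → i ≠ j →
      ((pairCumulant P X ∅ (pairTimes p) : ℝ) : ℂ) *
        (∫ x, pairProd X (p i) x * pairProd X (p j) x ∂P) +
      (((pairCumulant P X {i} (pairTimes p) : ℝ) : ℂ) * (∫ x, pairProd X (p j) x ∂P) +
      (((pairCumulant P X {j} (pairTimes p) : ℝ) : ℂ) * (∫ x, pairProd X (p i) x ∂P) +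
       ((pairCumulant P X {i, j} (pairTimes p) : ℝ) : ℂ))) =
        ∫ x, pairProd X (p 0) x * (pairProd X (p i) x * pairProd X (p j) x) ∂P := by
    intro i j hi hj hij
    have h := key {i, j} (by simpa using ⟨hi, hj⟩)
    obtain ⟨hp, d1, d2, n1, n2, n3⟩ := comb i j hij
    rw [hp, Finset.sum_insert n1, Finset.sum_insert n2, Finset.sum_pair n3, d1, d2] at h
    have e : ∀ x, ∏ q ∈ ({0, i, j} : Finset (Fin 4)), pairProd X (p q) x =
      pairProd X (p 0) x * (pairProd X (p i) x * pairProd X (p j) x) := fun x => by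
        rw [Finset.prod_insert (by simpa using ⟨hi, hj⟩), Finset.prod_pair hij]
    simp only [Finset.sdiff_empty, Finset.sdiff_self, Finset.prod_empty,
      integral_const, probReal_univ, one_smul, mul_one, Finset.prod_singleton,
      Finset.prod_pair hij, e] at h
    exact h
  have h1 := key1 1 (by decide)
  have h2 := key1 2 (by decide)
  have h3 := key1 3 (by decide)
  have h12 := key2 1 2 (by decide) (by decide) (by decide)
  have h13 := key2 1 3 (by decide) (by decide) (by decide)
  have h23 := key2 2 3 (by decide) (by decide) (by decide)
  have h123 := key {1, 2, 3} (by decide)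
  have hu : (Finset.univ : Finset (Fin 4)).erase 0 = {1, 2, 3} := by decide
  have hp : ({1, 2, 3} : Finset (Fin 4)).powerset =
    {∅, {1}, {2}, {3}, {1, 2}, {1, 3}, {2, 3}, {1, 2, 3}} := by decide
  have d1 : ({1, 2, 3} : Finset (Fin 4)) \ {1} = {2, 3} := by decide
  have d2 : ({1, 2, 3} : Finset (Fin 4)) \ {2} = {1, 3} := by decide
  have d3 : ({1, 2, 3} : Finset (Fin 4)) \ {3} = {1, 2} := by decide
  have d12 : ({1, 2, 3} : Finset (Fin 4)) \ {1, 2} = {3} := by decide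
  have d13 : ({1, 2, 3} : Finset (Fin 4)) \ {1, 3} = {2} := by decide
  have d23 : ({1, 2, 3} : Finset (Fin 4)) \ {2, 3} = {1} := by decide
  rw [hp, Finset.sum_insert (by decide), Finset.sum_insert (by decide),
    Finset.sum_insert (by decide), Finset.sum_insert (by decide), Finset.sum_insert (by decide),
    Finset.sum_insert (by decide), Finset.sum_pair (by decide), d1, d2, d3, d12, d13, d23] at h123
  have e12 : ∀ x, ∏ q ∈ ({1, 2} : Finset (Fin 4)), pairProd X (p q) x =
      pairProd X (p 1) x * pairProd X (p 2) x := fun x => by simp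
  have e13 : ∀ x, ∏ q ∈ ({1, 3} : Finset (Fin 4)), pairProd X (p q) x =
      pairProd X (p 1) x * pairProd X (p 3) x := fun x => by simp
  have e23 : ∀ x, ∏ q ∈ ({2, 3} : Finset (Fin 4)), pairProd X (p q) x =
      pairProd X (p 2) x * pairProd X (p 3) x := fun x => by simp
  have e123 : ∀ x, ∏ q ∈ ({1, 2, 3} : Finset (Fin 4)), pairProd X (p q) x =
      pairProd X (p 1) x * (pairProd X (p 2) x * pairProd X (p 3) x) := fun x => by simp
  have e0123 : ∀ x, ∏ q ∈ ({0, 1, 2, 3} : Finset (Fin 4)), pairProd X (p q) x =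
      pairProd X (p 0) x * (pairProd X (p 1) x * (pairProd X (p 2) x * pairProd X (p 3) x)) :=
    fun x => by simp
  simp only [Finset.sdiff_empty, Finset.sdiff_self, Finset.prod_empty,
      integral_const, probReal_univ, one_smul, mul_one, Finset.prod_singleton,
      e12, e13, e23, e123, e0123] at h123
  rw [hu]
  simp only [cum4]
  set E1 := ∫ x, pairProd X (p 1) x ∂P
  set E2 := ∫ x, pairProd X (p 2) x ∂P
  set E3 := ∫ x, pairProd X (p 3) x ∂P
  set E12 := ∫ x, pairProd X (p 1) x * pairProd X (p 2) x ∂P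
  set E13 := ∫ x, pairProd X (p 1) x * pairProd X (p 3) x ∂P
  set E23 := ∫ x, pairProd X (p 2) x * pairProd X (p 3) x ∂P
  -- Elimination in order of cardinality: the connected sums of smaller families are expressed by
  -- moments and substituted into the next ones.
  rw [← eq_sub_iff_add_eq'] at h1 h2 h3
  rw [h0] at h1 h2 h3
  rw [h0, h1, h2, ← eq_sub_iff_add_eq', ← eq_sub_iff_add_eq', ← eq_sub_iff_add_eq'] at h12
  rw [h0, h1, h3, ← eq_sub_iff_add_eq', ← eq_sub_iff_add_eq', ← eq_sub_iff_add_eq'] at h13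
  rw [h0, h2, h3, ← eq_sub_iff_add_eq', ← eq_sub_iff_add_eq', ← eq_sub_iff_add_eq'] at h23
  rw [h0, h1, h2, h3, h12, h13, h23] at h123
  linear_combination -h123

end Quadratic

/-! ### Bounds for the cumulants of quadratic forms -/

section QuadraticBound

variable {Ω : Type*} [MeasurableSpace Ω] {P : Measure Ω} {X : ℤ → Ω → ℝ}

/-- The pairs of observation times. -/
noncomputable def timePairs (T : ℕ) : Finset (ℤ × ℤ) := Finset.Icc (1 : ℤ) T ×ˢ Finset.Icc (1 : ℤ) T

/-- The quadratic form in the observations with coefficients `a`. -/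
noncomputable def quadForm (X : ℤ → Ω → ℝ) (T : ℕ) (a : ℤ × ℤ → ℂ) (x : Ω) : ℂ :=
  ∑ p ∈ timePairs T, a p * pairProd X p x

lemma memLp_quadForm [IsProbabilityMeasure P] (hX : StationaryCumulantCondition P X 8) (T : ℕ)
    (a : ℤ × ℤ → ℂ) : MemLp (quadForm X T a) 4 P :=
  memLp_sum_mul _ _ _ (memLp_pairProd hX)

/-- Coefficients dominated by a kernel whose row and column sums are at most `L`. -/
structure KernelBound (T : ℕ) (L : ℝ) (g : ℤ → ℤ → ℝ) : Prop where
  row : ∀ x ∈ Finset.Icc (1 : ℤ) T, ∑ y ∈ Finset.Icc (1 : ℤ) T, g x y ≤ L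
  col : ∀ y ∈ Finset.Icc (1 : ℤ) T, ∑ x ∈ Finset.Icc (1 : ℤ) T, g x y ≤ L
  nonneg : ∀ x y, 0 ≤ g x y

/-- The extension of a kernel by zero. -/
noncomputable def extKernel (T : ℕ) (g : ℤ → ℤ → ℝ) (x y : ℤ) : ℝ≥0∞ :=
  if x ∈ Finset.Icc (1 : ℤ) T then
    (if y ∈ Finset.Icc (1 : ℤ) T then ENNReal.ofReal (g x y) else 0) else 0

lemma extKernel_of_notMem {T : ℕ} {g : ℤ → ℤ → ℝ} (x y : ℤ) (hx : x ∉ Finset.Icc (1 : ℤ) T) :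
    extKernel T g x y = 0 := if_neg hx

lemma KernelBound.tsum_row {T : ℕ} {L : ℝ} {g : ℤ → ℤ → ℝ} (h : KernelBound T L g) (x : ℤ) :
    ∑' y, extKernel T g x y ≤ ENNReal.ofReal L := by
  by_cases hx : x ∈ Finset.Icc (1 : ℤ) T
  · simp only [extKernel, if_pos hx]
    rw [tsum_eq_sum (s := Finset.Icc (1 : ℤ) T) (fun b hb => if_neg hb),
      Finset.sum_congr rfl (fun b hb => if_pos hb),
      ← ENNReal.ofReal_sum_of_nonneg (fun _ _ => h.nonneg _ _)]
    exact ENNReal.ofReal_le_ofReal (h.row x hx)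
  · simp only [extKernel, if_neg hx, tsum_zero, zero_le]

lemma KernelBound.tsum_col {T : ℕ} {L : ℝ} {g : ℤ → ℤ → ℝ} (h : KernelBound T L g) (y : ℤ) :
    ∑' x, extKernel T g x y ≤ ENNReal.ofReal L := by
  by_cases hy : y ∈ Finset.Icc (1 : ℤ) T
  · simp only [extKernel, if_pos hy]
    rw [tsum_eq_sum (s := Finset.Icc (1 : ℤ) T) (fun b hb => if_neg hb),
      Finset.sum_congr rfl (fun b hb => if_pos hb),
      ← ENNReal.ofReal_sum_of_nonneg (fun _ _ => h.nonneg _ _)]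
    exact ENNReal.ofReal_le_ofReal (h.col y hy)
  · simp only [extKernel, if_neg hy, ite_self, tsum_zero, zero_le]

lemma enorm_le_extKernel {T : ℕ} {g : ℤ → ℤ → ℝ} {a : ℤ × ℤ → ℂ}
    (ha : ∀ p ∈ timePairs T, ‖a p‖ ≤ g p.1 p.2) {p : ℤ × ℤ} (hp : p ∈ timePairs T) :
    ‖a p‖ₑ ≤ extKernel T g p.1 p.2 := by
  have h := Finset.mem_product.1 hp
  rw [extKernel, if_pos h.1, if_pos h.2, ← ofReal_norm]
  exact ENNReal.ofReal_le_ofReal (ha p hp)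

lemma pairTimes_injective {n : ℕ} : Function.Injective (pairTimes (n := n)) := by
  intro p q h
  ext i
  · simpa [pairTimes] using congrFun h (i, 0)
  · simpa [pairTimes] using congrFun h (i, 1)

lemma sum_three_le_tsum {α : Type*} (I : Finset α) (F : (Fin 3 → α) → ℝ≥0∞) :
    ∑ p ∈ I, ∑ q ∈ I, ∑ r ∈ I, F ![p, q, r] ≤ ∑' u, F u := by
  have hinj : Function.Injective (fun x : α × α × α => ![x.1, x.2.1, x.2.2]) := by
    rintro ⟨a, b, c⟩ ⟨a', b', c'⟩ h
    have h0 := congrFun h 0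
    have h1 := congrFun h 1
    have h2 := congrFun h 2
    simp at h0 h1 h2
    simp [h0, h1, h2]
  refine le_trans ?_ (ENNReal.tsum_comp_le_tsum_of_injective hinj F)
  refine le_trans (le_of_eq ?_) (ENNReal.sum_le_tsum (I ×ˢ I ×ˢ I))
  simp only [Finset.sum_product]

lemma sum_four_le_tsum {α : Type*} (I : Finset α) (F : (Fin 4 → α) → ℝ≥0∞) :
    ∑ p ∈ I, ∑ q ∈ I, ∑ r ∈ I, ∑ s ∈ I, F ![p, q, r, s] ≤ ∑' u, F u := by
  have hinj : Function.Injective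
      (fun x : α × α × α × α => ![x.1, x.2.1, x.2.2.1, x.2.2.2]) := by
    rintro ⟨a, b, c, d⟩ ⟨a', b', c', d'⟩ h
    have h0 := congrFun h 0
    have h1 := congrFun h 1
    have h2 := congrFun h 2
    have h3 := congrFun h 3
    simp at h0 h1 h2 h3
    simp [h0, h1, h2, h3]
  refine le_trans ?_ (ENNReal.tsum_comp_le_tsum_of_injective hinj F)
  refine le_trans (le_of_eq ?_) (ENNReal.sum_le_tsum (I ×ˢ I ×ˢ I ×ˢ I))
  simp only [Finset.sum_product]

lemma norm_le_of_enorm_le {z : ℂ} {T n : ℕ} {c : ℝ≥0∞} (hc : c ≠ ⊤) {L : ℝ} (hL : 0 ≤ L)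
    (h : ‖z‖ₑ ≤ T * (c * ENNReal.ofReal L ^ n)) : ‖z‖ ≤ c.toReal * (T * L ^ n) := by
  have h2 : (T : ℝ≥0∞) * (c * ENNReal.ofReal L ^ n) ≠ ⊤ :=
    ENNReal.mul_ne_top (by simp) (ENNReal.mul_ne_top hc (ENNReal.pow_ne_top ENNReal.ofReal_ne_top))
  have := ENNReal.toReal_mono h2 h
  rw [toReal_enorm] at this
  simp only [ENNReal.toReal_mul, ENNReal.toReal_natCast, ENNReal.toReal_pow,
    ENNReal.toReal_ofReal hL] at this
  linarith

/-- By multilinearity the cumulant is a sum over three pairs of times of coefficients times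
connected sums. Connectedness leaves a single free time, hence one factor `T`; a product of three
unrelated sums would give `T ^ 3`. The constant depends on the cumulants of `X` only and is uniform
in `T` and the kernel. -/
theorem exists_norm_cum3_le [IsProbabilityMeasure P] (hX : StationaryCumulantCondition P X 8)
    (hmean : ∀ t : ℤ, ∫ x, X t x ∂P = 0) :
    ∃ c : ℝ, 0 ≤ c ∧ ∀ (T : ℕ) (L : ℝ) (g : ℤ → ℤ → ℝ), 0 ≤ L → KernelBound T L g →
      ∀ a₀ a₁ a₂ : ℤ × ℤ → ℂ, (∀ p ∈ timePairs T, ‖a₀ p‖ ≤ g p.1 p.2) →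
      (∀ p ∈ timePairs T, ‖a₁ p‖ ≤ g p.1 p.2) → (∀ p ∈ timePairs T, ‖a₂ p‖ ≤ g p.1 p.2) →
      ‖cum3 P (quadForm X T a₀) (quadForm X T a₁) (quadForm X T a₂)‖ ≤ c * (T * L ^ 3) := by
  refine ⟨((1 + 2 ^ (2 * (2 + 1)) * cumulantMass P X 8) ^ (2 * (2 + 1))).toReal,
    ENNReal.toReal_nonneg, ?_⟩
  intro T L g hL hg a₀ a₁ a₂ h0 h1 h2
  have hm := cumulantMass_ne_top hX
  have hfin : (1 + 2 ^ (2 * (2 + 1)) * cumulantMass P X 8) ^ (2 * (2 + 1)) ≠ ⊤ :=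
    ENNReal.pow_ne_top (ENNReal.add_ne_top.2 ⟨by simp, ENNReal.mul_ne_top (by simp) hm⟩)
  refine norm_le_of_enorm_le hfin hL ?_
  refine le_trans ?_ (tsum_pairCumulant_le (n := 2) (by norm_num) hX hmean (extKernel T g)
    (ENNReal.ofReal L) T extKernel_of_notMem hg.tsum_row hg.tsum_col)
  -- All terms are nonnegative now, so the finite sum over pairs may be enlarged to all integer
  -- times.
  refine le_trans ?_ (ENNReal.tsum_comp_le_tsum_of_injective pairTimes_injective _)
  refine le_trans ?_ (sum_three_le_tsum (timePairs T) _)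
  have hs := cum3_sum_sum (timePairs T) a₀ a₁ a₂ (pairProd X) (memLp_pairProd hX)
  change cum3 P (quadForm X T a₀) (quadForm X T a₁) (quadForm X T a₂) = _ at hs
  rw [hs]
  refine (enorm_sum_le _ _).trans (Finset.sum_le_sum fun p hp => ?_)
  refine (enorm_sum_le _ _).trans (Finset.sum_le_sum fun q hq => ?_)
  refine (enorm_sum_le _ _).trans (Finset.sum_le_sum fun r hr => ?_)
  have := cum3_pairProd (P := P) (X := X) ![p, q, r]
  simp only [Matrix.cons_val] at this
  rw [this, Fin.prod_univ_three]
  simp only [enorm_mul]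
  rw [mul_assoc, mul_assoc]
  have hreal : ∀ y : ℝ, ‖(y : ℂ)‖ₑ = ‖y‖ₑ := fun y => by
    rw [← ofReal_norm, ← ofReal_norm, Complex.norm_real]
  rw [hreal]
  exact mul_le_mul' (enorm_le_extKernel h0 hp) (mul_le_mul' (enorm_le_extKernel h1 hq)
    (mul_le_mul' (enorm_le_extKernel h2 hr) le_rfl))

/-- As for three forms. Four pairs have eight positions, and a block can contain all of them, which
is why cumulants up to order eight have to be summable. -/
theorem exists_norm_cum4_le [IsProbabilityMeasure P] (hX : StationaryCumulantCondition P X 8)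
    (hmean : ∀ t : ℤ, ∫ x, X t x ∂P = 0) :
    ∃ c : ℝ, 0 ≤ c ∧ ∀ (T : ℕ) (L : ℝ) (g : ℤ → ℤ → ℝ), 0 ≤ L → KernelBound T L g →
      ∀ a₀ a₁ a₂ a₃ : ℤ × ℤ → ℂ, (∀ p ∈ timePairs T, ‖a₀ p‖ ≤ g p.1 p.2) →
      (∀ p ∈ timePairs T, ‖a₁ p‖ ≤ g p.1 p.2) → (∀ p ∈ timePairs T, ‖a₂ p‖ ≤ g p.1 p.2) →
      (∀ p ∈ timePairs T, ‖a₃ p‖ ≤ g p.1 p.2) →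
      ‖cum4 P (quadForm X T a₀) (quadForm X T a₁) (quadForm X T a₂) (quadForm X T a₃)‖ ≤
        c * (T * L ^ 4) := by
  refine ⟨((1 + 2 ^ (2 * (3 + 1)) * cumulantMass P X 8) ^ (2 * (3 + 1))).toReal,
    ENNReal.toReal_nonneg, ?_⟩
  intro T L g hL hg a₀ a₁ a₂ a₃ h0 h1 h2 h3
  have hm := cumulantMass_ne_top hX
  have hfin : (1 + 2 ^ (2 * (3 + 1)) * cumulantMass P X 8) ^ (2 * (3 + 1)) ≠ ⊤ :=
    ENNReal.pow_ne_top (ENNReal.add_ne_top.2 ⟨by simp, ENNReal.mul_ne_top (by simp) hm⟩)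
  refine norm_le_of_enorm_le hfin hL ?_
  refine le_trans ?_ (tsum_pairCumulant_le (n := 3) (by norm_num) hX hmean (extKernel T g)
    (ENNReal.ofReal L) T extKernel_of_notMem hg.tsum_row hg.tsum_col)
  refine le_trans ?_ (ENNReal.tsum_comp_le_tsum_of_injective pairTimes_injective _)
  refine le_trans ?_ (sum_four_le_tsum (timePairs T) _)
  have hs := cum4_sum_sum (timePairs T) a₀ a₁ a₂ a₃ (pairProd X) (memLp_pairProd hX)
  change cum4 P (quadForm X T a₀) (quadForm X T a₁) (quadForm X T a₂) (quadForm X T a₃) = _ at hs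
  rw [hs]
  refine (enorm_sum_le _ _).trans (Finset.sum_le_sum fun p hp => ?_)
  refine (enorm_sum_le _ _).trans (Finset.sum_le_sum fun q hq => ?_)
  refine (enorm_sum_le _ _).trans (Finset.sum_le_sum fun r hr => ?_)
  refine (enorm_sum_le _ _).trans (Finset.sum_le_sum fun s hs => ?_)
  have := cum4_pairProd (P := P) (X := X) ![p, q, r, s]
  simp only [Matrix.cons_val] at this
  rw [this, Fin.prod_univ_four]
  simp only [enorm_mul]
  rw [mul_assoc, mul_assoc, mul_assoc]
  have hreal : ∀ y : ℝ, ‖(y : ℂ)‖ₑ = ‖y‖ₑ := fun y => by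
    rw [← ofReal_norm, ← ofReal_norm, Complex.norm_real]
  rw [hreal]
  exact mul_le_mul' (enorm_le_extKernel h0 hp) (mul_le_mul' (enorm_le_extKernel h1 hq)
    (mul_le_mul' (enorm_le_extKernel h2 hr) (mul_le_mul' (enorm_le_extKernel h3 hs) le_rfl)))

end QuadraticBound

/-! ### Roots of unity and sums over a full period -/

section Characters

/-- The root of unity `e^{2πin/T}`. -/
noncomputable def rootChar (T : ℕ) (n : ℤ) : ℂ := Complex.exp (Complex.I * (freq T n : ℂ))

lemma rootChar_add (T : ℕ) (m n : ℤ) : rootChar T (m + n) = rootChar T m * rootChar T n := by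
  rw [rootChar, rootChar, rootChar, ← Complex.exp_add]
  congr 1
  simp only [freq]; push_cast; ring

lemma rootChar_zero (T : ℕ) : rootChar T 0 = 1 := by simp [rootChar, freq]

lemma norm_rootChar (T : ℕ) (n : ℤ) : ‖rootChar T n‖ = 1 := by
  rw [rootChar, Complex.norm_exp_I_mul_ofReal]

lemma conj_rootChar (T : ℕ) (n : ℤ) : (starRingEnd ℂ) (rootChar T n) = rootChar T (-n) := by
  rw [rootChar, rootChar, ← Complex.exp_conj, map_mul, Complex.conj_I, Complex.conj_ofReal]
  congr 1
  simp only [freq]; push_cast; ring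

lemma rootChar_eq_one {T : ℕ} (hT : 1 ≤ T) {n : ℤ} (h : (T : ℤ) ∣ n) : rootChar T n = 1 := by
  obtain ⟨k, rfl⟩ := h
  rw [rootChar, Complex.exp_eq_one_iff]
  refine ⟨k, ?_⟩
  have : (T : ℂ) ≠ 0 := by exact_mod_cast (by omega : T ≠ 0)
  simp only [freq]; push_cast; field_simp

lemma rootChar_ne_one {T : ℕ} (hT : 1 ≤ T) {n : ℤ} (h : ¬ (T : ℤ) ∣ n) : rootChar T n ≠ 1 := by
  intro h1
  rw [rootChar, Complex.exp_eq_one_iff] at h1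
  obtain ⟨k, hk⟩ := h1
  apply h
  have hT' : (T : ℂ) ≠ 0 := by exact_mod_cast (by omega : T ≠ 0)
  have hpi : (Real.pi : ℂ) ≠ 0 := by exact_mod_cast Real.pi_ne_zero
  simp only [freq] at hk
  push_cast at hk
  field_simp at hk
  have : (n : ℂ) = (k : ℂ) * T := by
    linear_combination hk
  exact ⟨k, by exact_mod_cast (this.trans (mul_comm _ _))⟩

lemma rootChar_add_of_dvd {T : ℕ} (hT : 1 ≤ T) (m : ℤ) {n : ℤ} (h : (T : ℤ) ∣ n) :
    rootChar T (m + n) = rootChar T m := by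
  rw [rootChar_add, rootChar_eq_one hT h, mul_one]

lemma rootChar_natCast_mul (T : ℕ) (k : ℕ) (n : ℤ) : rootChar T (k * n) = rootChar T n ^ k := by
  induction k with
  | zero => simp [rootChar_zero]
  | succ k ih => rw [pow_succ, ← ih, ← rootChar_add]; congr 1; push_cast; ring

lemma sum_Icc_natCast {M : Type*} [AddCommMonoid M] (T : ℕ) (f : ℤ → M) :
    ∑ t ∈ Finset.Icc 1 T, f (t : ℤ) = ∑ t ∈ Finset.Icc (1 : ℤ) T, f t := by
  have : Finset.Icc (1 : ℤ) T = (Finset.Icc 1 T).image (fun n : ℕ => (n : ℤ)) := by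
    ext x
    simp only [Finset.mem_Icc, Finset.mem_image]
    constructor
    · intro h
      exact ⟨x.toNat, by omega, by omega⟩
    · rintro ⟨n, h, rfl⟩
      omega
  rw [this, Finset.sum_image (fun a _ b _ h => by exact_mod_cast h)]

lemma sum_Icc_eq_sum_range {M : Type*} [AddCommMonoid M] (T : ℕ) (f : ℤ → M) :
    ∑ t ∈ Finset.Icc (1 : ℤ) T, f t = ∑ k ∈ Finset.range T, f ((k : ℤ) + 1) := by
  rw [← sum_Icc_natCast, Finset.range_eq_Ico]
  have h := Finset.sum_Ico_add' (fun k : ℕ => f (k : ℤ)) 0 T 1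
  push_cast at h
  rw [h]
  rfl

lemma sum_rootChar {T : ℕ} (hT : 1 ≤ T) (n : ℤ) :
    ∑ t ∈ Finset.Icc (1 : ℤ) T, rootChar T (t * n) = if (T : ℤ) ∣ n then (T : ℂ) else 0 := by
  split_ifs with h
  · rw [Finset.sum_congr rfl fun t _ => rootChar_eq_one hT (Dvd.dvd.mul_left h t)]
    simp
  · rw [sum_Icc_eq_sum_range]
    have : ∀ k ∈ Finset.range T, rootChar T (((k : ℤ) + 1) * n) =
        rootChar T n * rootChar T n ^ k := by
      intro k _
      rw [← rootChar_natCast_mul, ← rootChar_add]; congr 1; ring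
    rw [Finset.sum_congr rfl this, ← Finset.mul_sum, geom_sum_eq (rootChar_ne_one hT h),
      ← rootChar_natCast_mul, rootChar_eq_one hT (Dvd.intro _ rfl)]
    simp

/-- The sum of a periodic function over a period. -/
lemma sum_Icc_add_of_periodic {M : Type*} [AddCommGroup M] (T : ℕ) (f : ℤ → M)
    (hf : ∀ n, f (n + T) = f n) (a : ℤ) :
    ∑ t ∈ Finset.Icc (1 : ℤ) T, f (t + a) = ∑ t ∈ Finset.Icc (1 : ℤ) T, f t := by
  have step : ∀ a : ℤ, ∑ t ∈ Finset.Icc (1 : ℤ) T, f (t + (a + 1)) =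
      ∑ t ∈ Finset.Icc (1 : ℤ) T, f (t + a) := by
    intro a
    rw [sum_Icc_eq_sum_range, sum_Icc_eq_sum_range]
    have h := Finset.sum_range_succ (fun k : ℕ => f ((k : ℤ) + 1 + a)) T
    rw [Finset.sum_range_succ' (fun k : ℕ => f ((k : ℤ) + 1 + a)) T] at h
    have h2 : f ((T : ℤ) + 1 + a) = f (((0 : ℕ) : ℤ) + 1 + a) := by
      rw [← hf (((0 : ℕ) : ℤ) + 1 + a)]; congr 1; push_cast; ring
    rw [h2] at h
    rw [← add_right_cancel h]
    refine Finset.sum_congr rfl fun k _ => ?_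
    congr 1; push_cast; ring
  induction a using Int.induction_on with
  | zero => simp
  | succ i ih => rw [step, ih]
  | pred i ih => rw [← ih, ← step]; simp

lemma sum_Icc_sub_of_periodic {M : Type*} [AddCommGroup M] (T : ℕ) (f : ℤ → M)
    (hf : ∀ n, f (n + T) = f n) (a : ℤ) :
    ∑ t ∈ Finset.Icc (1 : ℤ) T, f (a - t) = ∑ t ∈ Finset.Icc (1 : ℤ) T, f t := by
  rw [← sum_Icc_add_of_periodic T f hf (a - (T + 1))]
  refine Finset.sum_bij' (fun t _ => (T + 1 : ℤ) - t) (fun t _ => (T + 1 : ℤ) - t) ?_ ?_ ?_ ?_ ?_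
  · intro t ht; simp only [Finset.mem_Icc] at ht ⊢; omega
  · intro t ht; simp only [Finset.mem_Icc] at ht ⊢; omega
  · intro t _; ring
  · intro t _; ring
  · intro t _; congr 1; ring

end Characters

/-! ### Decay of the discrete Fourier coefficients of a Lipschitz weight -/

section Weights

/-- A bounded Lipschitz function on `[0, 2π]` with explicit constants. -/
structure LipWeight (φ : ℝ → ℂ) (B Λ : ℝ) : Prop where
  bound : ∀ ω ∈ Set.Icc 0 (2 * Real.pi), ‖φ ω‖ ≤ B
  lip : ∀ ω ∈ Set.Icc 0 (2 * Real.pi), ∀ ω' ∈ Set.Icc 0 (2 * Real.pi),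
    ‖φ ω - φ ω'‖ ≤ Λ * |ω - ω'|
  bound_nonneg : 0 ≤ B
  lip_nonneg : 0 ≤ Λ

lemma freq_mem {T : ℕ} {k : ℤ} (hk : k ∈ Finset.Icc (1 : ℤ) T) :
    freq T k ∈ Set.Icc 0 (2 * Real.pi) := by
  rw [Finset.mem_Icc] at hk
  have hT : (0 : ℝ) < T := by exact_mod_cast (by omega : (0 : ℤ) < T)
  have hk1 : (1 : ℝ) ≤ k := by exact_mod_cast hk.1
  have hk2 : (k : ℝ) ≤ T := by exact_mod_cast hk.2
  have := Real.pi_pos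
  constructor
  · unfold freq; positivity
  · unfold freq
    rw [div_le_iff₀ hT]
    gcongr

/-- The discrete Fourier coefficients of `φ`. -/
noncomputable def fourierCoef (φ : ℝ → ℂ) (T : ℕ) (j : ℤ) : ℂ :=
  (1 / (T : ℂ)) * ∑ k ∈ Finset.Icc (1 : ℤ) T, φ (freq T k) * rootChar T (j * k)

lemma fourierCoef_add {T : ℕ} (hT : 1 ≤ T) (φ : ℝ → ℂ) (j : ℤ) :
    fourierCoef φ T (j + T) = fourierCoef φ T j := by
  unfold fourierCoef
  congr 1
  refine Finset.sum_congr rfl fun k _ => ?_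
  rw [add_mul, rootChar_add_of_dvd hT _ (Dvd.intro _ rfl)]

lemma norm_fourierCoef_le {T : ℕ} (hT : 1 ≤ T) {φ : ℝ → ℂ} {B Λ : ℝ} (h : LipWeight φ B Λ) (j : ℤ) :
    ‖fourierCoef φ T j‖ ≤ B := by
  have hT' : (0 : ℝ) < T := by exact_mod_cast hT
  unfold fourierCoef
  rw [norm_mul, norm_div, norm_one, Complex.norm_natCast, div_mul_eq_mul_div, one_mul,
    div_le_iff₀ hT']
  refine (norm_sum_le _ _).trans ?_
  calc _ ≤ ∑ k ∈ Finset.Icc (1 : ℤ) T, B := Finset.sum_le_sum fun k hk => by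
        rw [norm_mul, norm_rootChar, mul_one]; exact h.bound _ (freq_mem hk)
    _ = B * T := by simp [mul_comm]

lemma sum_range_mul_sub (c w : ℕ → ℂ) (n : ℕ) :
    ∑ k ∈ Finset.range n, c k * (w (k + 1) - w k) =
      c n * w n - c 0 * w 0 - ∑ k ∈ Finset.range n, (c (k + 1) - c k) * w (k + 1) := by
  induction n with
  | zero => simp
  | succ n ih => rw [Finset.sum_range_succ, ih, Finset.sum_range_succ]; ring

/-- Multiplying by `rootChar T j - 1` turns the characters into differences, and summation by parts
moves the difference onto `φ`. The boundary terms give `2 * B`, since `φ` need not close up at `2π`,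
and the `T` increments of size at most `Λ * (2π / T)` give the rest. -/
lemma norm_rootChar_sub_one_mul_fourierCoef_le {T : ℕ} (hT : 1 ≤ T) {φ : ℝ → ℂ} {B Λ : ℝ}
    (h : LipWeight φ B Λ) (j : ℤ) :
    ‖rootChar T j - 1‖ * ‖fourierCoef φ T j‖ ≤ (2 * B + 2 * Real.pi * Λ) / T := by
  have hT' : (0 : ℝ) < T := by exact_mod_cast hT
  -- Summation by parts evaluates `c` at `T`, whose frequency would lie beyond `2π`. The minimum
  -- keeps it at `2π`, and the last increment becomes zero.
  set c : ℕ → ℂ := fun k => φ (freq T ((min (k + 1) T : ℕ) : ℤ)) with hc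
  have hmem : ∀ k, freq T ((min (k + 1) T : ℕ) : ℤ) ∈ Set.Icc 0 (2 * Real.pi) := fun k =>
    freq_mem (by rw [Finset.mem_Icc]; omega)
  set w : ℕ → ℂ := fun k => rootChar T (((k : ℤ) + 1) * j) with hw
  have heq : (rootChar T j - 1) * fourierCoef φ T j =
      (1 / (T : ℂ)) * ∑ k ∈ Finset.range T, c k * (w (k + 1) - w k) := by
    unfold fourierCoef
    rw [sum_Icc_eq_sum_range, mul_left_comm, Finset.mul_sum]
    congr 1
    refine Finset.sum_congr rfl fun k hk => ?_
    have h1 : min (k + 1) T = k + 1 := by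
      have := Finset.mem_range.1 hk; omega
    have h2 : w (k + 1) = rootChar T j * w k := by
      simp only [hw]; rw [← rootChar_add]; congr 1; push_cast; ring
    rw [h2]
    simp only [hc, h1, hw, mul_comm j]
    push_cast
    ring
  rw [← norm_mul, heq, sum_range_mul_sub, norm_mul, norm_div, norm_one, Complex.norm_natCast,
    div_mul_eq_mul_div, one_mul]
  refine div_le_div_of_nonneg_right ?_ hT'.le
  have hw1 : ∀ k, ‖w k‖ = 1 := fun k => norm_rootChar _ _
  have hstep : ∀ k ∈ Finset.range T, ‖(c (k + 1) - c k) * w (k + 1)‖ ≤ Λ * (2 * Real.pi / T) := by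
    intro k _
    rw [norm_mul, hw1, mul_one]
    refine (h.lip _ (hmem _) _ (hmem _)).trans ?_
    refine mul_le_mul_of_nonneg_left ?_ h.lip_nonneg
    have : freq T ((min (k + 1 + 1) T : ℕ) : ℤ) - freq T ((min (k + 1) T : ℕ) : ℤ) =
        (((min (k + 1 + 1) T : ℕ) : ℝ) - ((min (k + 1) T : ℕ) : ℝ)) * (2 * Real.pi / T) := by
      simp only [freq]; push_cast; ring
    rw [this, abs_mul, abs_of_nonneg (a := 2 * Real.pi / T) (by have := Real.pi_pos; positivity)]
    refine mul_le_of_le_one_left (by have := Real.pi_pos; positivity) ?_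
    rw [abs_le]
    have ha : ((min (k + 1) T : ℕ) : ℝ) ≤ (min (k + 1 + 1) T : ℕ) := by
      exact_mod_cast (by omega : min (k + 1) T ≤ min (k + 1 + 1) T)
    have hb : ((min (k + 1 + 1) T : ℕ) : ℝ) ≤ (min (k + 1) T : ℕ) + 1 := by
      exact_mod_cast (by omega : min (k + 1 + 1) T ≤ min (k + 1) T + 1)
    constructor <;> linarith
  calc _ ≤ ‖c T * w T‖ + ‖c 0 * w 0‖ + ∑ k ∈ Finset.range T, ‖(c (k + 1) - c k) * w (k + 1)‖ :=
        (norm_sub_le _ _).trans (add_le_add (norm_sub_le _ _) (norm_sum_le _ _))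
    _ ≤ B + B + ∑ k ∈ Finset.range T, Λ * (2 * Real.pi / T) := by
        refine add_le_add (add_le_add ?_ ?_) (Finset.sum_le_sum hstep)
        · rw [norm_mul, hw1, mul_one]; exact h.bound _ (hmem _)
        · rw [norm_mul, hw1, mul_one]; exact h.bound _ (hmem _)
    _ = _ := by
        rw [Finset.sum_const, Finset.card_range, nsmul_eq_mul]; field_simp; ring

/-- The modulus is `2 sin(πj/T)`. Jordan's inequality `sin x ≥ 2x/π` applies to `πj/T` if `j ≤ T/2`
and to `π - πj/T` otherwise. -/
lemma le_norm_rootChar_sub_one {T : ℕ} {j : ℕ} (hj1 : 1 ≤ j) (hj2 : j < T) :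
    4 * (min (j : ℝ) (T - j)) / T ≤ ‖rootChar T j - 1‖ := by
  have hT' : (0 : ℝ) < T := by exact_mod_cast (by omega : 0 < T)
  have hjT : (j : ℝ) ≤ T := by exact_mod_cast hj2.le
  have hpi := Real.pi_pos
  rw [rootChar, Complex.norm_exp_I_mul_ofReal_sub_one, Real.norm_eq_abs]
  refine le_trans ?_ (le_abs_self _)
  have hx : freq T (j : ℤ) / 2 = Real.pi * j / T := by simp only [freq]; push_cast; ring
  rw [hx]
  rcases le_total ((j : ℝ)) (T / 2) with h | h
  · have h1 := Real.mul_le_sin (x := Real.pi * j / T) (by positivity)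
      (by rw [div_le_div_iff₀ hT' two_pos]; nlinarith)
    have h2 : 2 / Real.pi * (Real.pi * j / T) = 2 * j / T := by field_simp
    rw [h2] at h1
    have h3 : 4 * (min (j : ℝ) (T - j)) / T ≤ 4 * j / T := by
      gcongr; exact min_le_left _ _
    have h4 : 4 * (j : ℝ) / T = 2 * (2 * j / T) := by ring
    linarith
  · have h1 := Real.mul_le_sin (x := Real.pi - Real.pi * j / T)
      (by rw [sub_nonneg, div_le_iff₀ hT']; gcongr)
      (by
        have : Real.pi * j / T ≥ Real.pi / 2 := by
          rw [ge_iff_le, div_le_div_iff₀ two_pos hT']; nlinarith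
        linarith)
    rw [Real.sin_pi_sub] at h1
    have h2 : 2 / Real.pi * (Real.pi - Real.pi * j / T) = 2 * (T - j) / T := by field_simp
    rw [h2] at h1
    have h3 : 4 * (min (j : ℝ) (T - j)) / T ≤ 4 * (T - j) / T := by
      gcongr; exact min_le_right _ _
    have h4 : 4 * ((T : ℝ) - j) / T = 2 * (2 * (T - j) / T) := by ring
    linarith

/-- The reciprocal of a minimum is bounded by the sum of the reciprocals; in this form both terms
add up to harmonic sums. -/
lemma norm_fourierCoef_le_inv {T : ℕ} {φ : ℝ → ℂ} {B Λ : ℝ}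
    (h : LipWeight φ B Λ) {j : ℕ} (hj1 : 1 ≤ j) (hj2 : j < T) :
    ‖fourierCoef φ T j‖ ≤ (2 * B + 2 * Real.pi * Λ) * ((1 : ℝ) / j + 1 / ((T - j : ℕ) : ℝ)) := by
  have hT' : (0 : ℝ) < T := by exact_mod_cast (by omega : 0 < T)
  have h1 := norm_rootChar_sub_one_mul_fourierCoef_le (T := T) (by omega) h (j : ℤ)
  have h2 := le_norm_rootChar_sub_one hj1 hj2
  have hB := h.bound_nonneg
  have hΛ := h.lip_nonneg
  have hpi := Real.pi_pos
  have hj' : (0 : ℝ) < j := by exact_mod_cast hj1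
  have hTj : (0 : ℝ) < (T : ℝ) - j := by rw [sub_pos]; exact_mod_cast hj2
  have hm : 0 < min (j : ℝ) (T - j) := lt_min hj' hTj
  rw [Nat.cast_sub hj2.le]
  have h3 : 4 * (min (j : ℝ) (T - j)) / T * ‖fourierCoef φ T j‖ ≤
      (2 * B + 2 * Real.pi * Λ) / T := (mul_le_mul_of_nonneg_right h2 (norm_nonneg _)).trans h1
  rw [div_mul_eq_mul_div, div_le_div_iff_of_pos_right hT'] at h3
  have h4 : ‖fourierCoef φ T j‖ ≤ (2 * B + 2 * Real.pi * Λ) * (1 / min (j : ℝ) (T - j)) := by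
    rw [mul_one_div, le_div_iff₀ hm]
    nlinarith [norm_nonneg (fourierCoef φ T j), mul_nonneg hm.le (norm_nonneg (fourierCoef φ T j))]
  refine h4.trans (mul_le_mul_of_nonneg_left ?_ (by positivity))
  rcases min_cases (j : ℝ) (T - j) with ⟨h5, _⟩ | ⟨h5, _⟩ <;> rw [h5]
  · have : 0 ≤ 1 / ((T : ℝ) - j) := by positivity
    linarith
  · have : 0 ≤ 1 / (j : ℝ) := by positivity
    linarith

/-- The absolute sum of the Fourier coefficients grows at most logarithmically. -/
lemma sum_norm_fourierCoef_le {T : ℕ} (hT : 1 ≤ T) {φ : ℝ → ℂ} {B Λ : ℝ} (h : LipWeight φ B Λ) :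
    ∑ j ∈ Finset.Icc (1 : ℤ) T, ‖fourierCoef φ T j‖ ≤
      (5 * B + 4 * Real.pi * Λ) * (1 + Real.log T) := by
  obtain ⟨n, rfl⟩ : ∃ n, T = n + 1 := ⟨T - 1, by omega⟩
  rw [sum_Icc_eq_sum_range, Finset.sum_range_succ]
  have hB := h.bound_nonneg
  have hΛ := h.lip_nonneg
  have hpi := Real.pi_pos
  have hlog : 0 ≤ Real.log ((n + 1 : ℕ) : ℝ) := Real.log_natCast_nonneg _
  have hharm : ∑ k ∈ Finset.range n, (1 : ℝ) / ((k : ℝ) + 1) ≤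
      1 + Real.log ((n + 1 : ℕ) : ℝ) := by
    have h1 := harmonic_le_one_add_log n
    rw [harmonic] at h1
    push_cast at h1
    simp only [one_div]
    rcases Nat.eq_zero_or_pos n with rfl | hn
    · simp
    · refine h1.trans (add_le_add le_rfl (Real.log_le_log (by exact_mod_cast hn) ?_))
      push_cast; linarith
  have hrefl : ∑ k ∈ Finset.range n, (1 : ℝ) / ((n - k : ℕ) : ℝ) =
      ∑ k ∈ Finset.range n, (1 : ℝ) / ((k : ℝ) + 1) := by
    rw [← Finset.sum_range_reflect]
    refine Finset.sum_congr rfl fun k hk => ?_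
    have := Finset.mem_range.1 hk
    have h2 : n - (n - 1 - k) = k + 1 := by omega
    rw [h2]; push_cast; rfl
  have hsum : ∑ k ∈ Finset.range n, ‖fourierCoef φ (n + 1) ((k : ℤ) + 1)‖ ≤
      (2 * B + 2 * Real.pi * Λ) * (2 * (1 + Real.log ((n + 1 : ℕ) : ℝ))) := by
    calc _ ≤ ∑ k ∈ Finset.range n, (2 * B + 2 * Real.pi * Λ) *
          ((1 : ℝ) / ((k : ℝ) + 1) + 1 / ((n - k : ℕ) : ℝ)) := by
          refine Finset.sum_le_sum fun k hk => ?_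
          have hk' := Finset.mem_range.1 hk
          have := norm_fourierCoef_le_inv h (T := n + 1) (j := k + 1) (by omega) (by omega)
          have h2 : n + 1 - (k + 1) = n - k := by omega
          rw [h2] at this
          push_cast at this ⊢
          exact this
      _ = (2 * B + 2 * Real.pi * Λ) * (∑ k ∈ Finset.range n, (1 : ℝ) / ((k : ℝ) + 1) +
          ∑ k ∈ Finset.range n, (1 : ℝ) / ((k : ℝ) + 1)) := by
          rw [← Finset.mul_sum, Finset.sum_add_distrib, hrefl]
      _ ≤ _ := by
          refine mul_le_mul_of_nonneg_left ?_ (by positivity)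
          linarith
  -- At `j = T` the character is trivial and only the bound `B` is available. Added to the `4 * B`
  -- from the two harmonic sums it makes `5 * B`.
  have hlast := norm_fourierCoef_le hT h ((n : ℤ) + 1)
  nlinarith [mul_nonneg hB hlog, mul_nonneg hΛ hlog]

end Weights

/-! ### The orthogonal sample as a quadratic form in the observations -/

section Coefficients

variable {Ω : Type*} {X : ℤ → Ω → ℝ}

lemma dft_freq (T : ℕ) (a : ℤ) (x : Ω) : dft X T (freq T a) x =
    (1 / (Real.sqrt (2 * Real.pi * (T : ℝ)) : ℂ)) *
      ∑ t ∈ Finset.Icc (1 : ℤ) T, (X t x : ℂ) * rootChar T (t * a) := by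
  rw [dft, ← sum_Icc_natCast]
  congr 1
  refine Finset.sum_congr rfl fun t _ => ?_
  congr 1
  rw [rootChar]
  congr 1
  simp only [freq]; push_cast; ring

lemma conj_dft_freq (T : ℕ) (a : ℤ) (x : Ω) :
    (starRingEnd ℂ) (dft X T (freq T a) x) = dft X T (freq T (-a)) x := by
  rw [dft_freq, dft_freq, map_mul, map_sum]
  congr 1
  · rw [map_div₀, map_one, Complex.conj_ofReal]
  · refine Finset.sum_congr rfl fun t _ => ?_
    rw [map_mul, Complex.conj_ofReal, conj_rootChar]
    congr 2; ring

lemma dft_freq_add {T : ℕ} (hT : 1 ≤ T) (a : ℤ) {b : ℤ} (hb : (T : ℤ) ∣ b) (x : Ω) :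
    dft X T (freq T (a + b)) x = dft X T (freq T a) x := by
  rw [dft_freq, dft_freq]
  congr 1
  refine Finset.sum_congr rfl fun t _ => ?_
  rw [mul_add, rootChar_add_of_dvd hT _ (Dvd.dvd.mul_left hb t)]

/-- The coefficients of `A_T(φ; r)` as a quadratic form. -/
noncomputable def orthCoef (φ : ℝ → ℂ) (T : ℕ) (r : ℤ) (p : ℤ × ℤ) : ℂ :=
  (1 / (2 * Real.pi * T) : ℂ) * (rootChar T (-(p.2 * r)) * fourierCoef φ T (p.1 - p.2))

lemma orthSample_eq (φ : ℝ → ℂ) (T : ℕ) (r : ℤ) (x : Ω) : orthSample X φ T r x =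
    (1 / (T : ℂ)) * ∑ k ∈ Finset.Icc (1 : ℤ) T, φ (freq T k) * dft X T (freq T k) x *
      dft X T (freq T (-(k + r))) x := by
  rw [orthSample, ← sum_Icc_natCast]
  simp only [conj_dft_freq]

lemma sqrt_sq_inv (T : ℕ) : (1 / (Real.sqrt (2 * Real.pi * (T : ℝ)) : ℂ)) *
    (1 / (Real.sqrt (2 * Real.pi * (T : ℝ)) : ℂ)) = 1 / (2 * Real.pi * T) := by
  rw [div_mul_div_comm, one_mul, ← Complex.ofReal_mul, Real.mul_self_sqrt (by
    have := Real.pi_pos; positivity)]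
  push_cast; rfl

/-- Collecting the coefficient of `X_t X_s`, the sum over `k` is the Fourier coefficient of `φ` at
`t - s`; the shift by `r` contributes only a phase in `s`. -/
lemma orthSample_eq_quadForm (φ : ℝ → ℂ) (T : ℕ) (r : ℤ) :
    orthSample X φ T r = quadForm X T (orthCoef φ T r) := by
  ext x
  rw [orthSample_eq, quadForm, timePairs]
  simp only [dft_freq]
  have h1 : ∀ k : ℤ, φ (freq T k) * ((1 / (Real.sqrt (2 * Real.pi * (T : ℝ)) : ℂ)) *
      ∑ t ∈ Finset.Icc (1 : ℤ) T, (X t x : ℂ) * rootChar T (t * k)) *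
      ((1 / (Real.sqrt (2 * Real.pi * (T : ℝ)) : ℂ)) *
      ∑ t ∈ Finset.Icc (1 : ℤ) T, (X t x : ℂ) * rootChar T (t * -(k + r))) =
      ∑ p ∈ Finset.Icc (1 : ℤ) T ×ˢ Finset.Icc (1 : ℤ) T, (1 / (2 * Real.pi * T) : ℂ) *
        (φ (freq T k) * (pairProd X p x * rootChar T (-(p.2 * r)) *
          rootChar T ((p.1 - p.2) * k))) := by
    intro k
    rw [Finset.sum_product]
    simp_rw [← Finset.mul_sum]
    rw [← sqrt_sq_inv]
    have : ∀ t ∈ Finset.Icc (1 : ℤ) T, ∀ s ∈ Finset.Icc (1 : ℤ) T,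
      pairProd X (t, s) x * rootChar T (-(s * r)) * rootChar T ((t - s) * k) =
      ((X t x : ℂ) * rootChar T (t * k)) * ((X s x : ℂ) * rootChar T (s * -(k + r))) := by
      intro t _ s _
      have h2 : rootChar T (t * k) * rootChar T (s * -(k + r)) =
          rootChar T (-(s * r)) * rootChar T ((t - s) * k) := by
        rw [← rootChar_add, ← rootChar_add]; congr 1; ring
      simp only [pairProd]
      push_cast
      linear_combination (-(X t x : ℂ) * X s x) * h2
    rw [Finset.sum_congr rfl fun t ht => Finset.sum_congr rfl (this t ht)]
    simp_rw [← Finset.mul_sum, ← Finset.sum_mul]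
    ring
  rw [Finset.sum_congr rfl fun k _ => h1 k, Finset.sum_comm, Finset.mul_sum]
  refine Finset.sum_congr rfl fun p _ => ?_
  rw [orthCoef, fourierCoef, ← Finset.mul_sum]
  simp only [Finset.mul_sum, Finset.sum_mul]
  refine Finset.sum_congr rfl fun k _ => by ring

/-- The kernel that dominates the coefficients of `A_T(φ; r)`. -/
noncomputable def orthKernel (φ : ℝ → ℂ) (T : ℕ) (x y : ℤ) : ℝ :=
  1 / (2 * Real.pi * T) * ‖fourierCoef φ T (x - y)‖

lemma norm_orthCoef (φ : ℝ → ℂ) (T : ℕ) (r : ℤ) (p : ℤ × ℤ) :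
    ‖orthCoef φ T r p‖ = orthKernel φ T p.1 p.2 := by
  have hpi := Real.pi_pos
  rw [orthCoef, orthKernel, norm_mul, norm_mul, norm_rootChar, one_mul, norm_div, norm_one]
  congr 2
  rw [norm_mul, norm_mul, Complex.norm_natCast, Complex.norm_real, Real.norm_eq_abs,
    abs_of_pos hpi]
  simp

/-- The kernel is a function of `x - y` of period `T`, so every row and every column sums to the
absolute sum of the Fourier coefficients over one period. One kernel serves all `r`, because `r`
enters through a phase. -/
lemma kernelBound_orthKernel {T : ℕ} (hT : 1 ≤ T) {φ : ℝ → ℂ} {B Λ : ℝ} (h : LipWeight φ B Λ) :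
    KernelBound T ((5 * B + 4 * Real.pi * Λ) * ((1 + Real.log T) / T)) (orthKernel φ T) := by
  have hT' : (0 : ℝ) < T := by exact_mod_cast hT
  have hpi := Real.pi_gt_three
  have hB := h.bound_nonneg
  have hΛ := h.lip_nonneg
  have hlog : 0 ≤ Real.log (T : ℝ) := Real.log_natCast_nonneg _
  have hper : ∀ n : ℤ, ‖fourierCoef φ T (n + T)‖ = ‖fourierCoef φ T n‖ := fun n => by
    rw [fourierCoef_add hT]
  have hs := sum_norm_fourierCoef_le hT h
  have hfin : 1 / (2 * Real.pi * T) * ∑ j ∈ Finset.Icc (1 : ℤ) T, ‖fourierCoef φ T j‖ ≤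
      (5 * B + 4 * Real.pi * Λ) * ((1 + Real.log T) / T) := by
    calc _ ≤ 1 / T * ((5 * B + 4 * Real.pi * Λ) * (1 + Real.log T)) := by
          refine mul_le_mul ?_ hs (Finset.sum_nonneg fun _ _ => norm_nonneg _) (by positivity)
          refine one_div_le_one_div_of_le hT' ?_
          nlinarith
      _ = _ := by ring
  refine ⟨fun x _ => ?_, fun y _ => ?_, fun x y => ?_⟩
  · unfold orthKernel
    rw [← Finset.mul_sum, sum_Icc_sub_of_periodic T (fun n => ‖fourierCoef φ T n‖) hper]
    exact hfin
  · unfold orthKernel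
    simp only [sub_eq_add_neg]
    rw [← Finset.mul_sum, sum_Icc_add_of_periodic T (fun n => ‖fourierCoef φ T n‖) hper]
    exact hfin
  · unfold orthKernel; positivity

lemma conj_quadForm (T : ℕ) (a : ℤ × ℤ → ℂ) (x : Ω) :
    (starRingEnd ℂ) (quadForm X T a x) = quadForm X T (fun p => (starRingEnd ℂ) (a p)) x := by
  simp only [quadForm, map_sum, map_mul, pairProd, Complex.conj_ofReal]

end Coefficients

/-! ### From sums over observed times to sums over all lags -/

section LagSums

lemma card_filter_add_notMem_le (T : ℕ) (n : ℤ) :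
    (((Finset.Icc (1 : ℤ) T).filter (fun t => t + n ∉ Finset.Icc (1 : ℤ) T)).card : ℝ)
        ≤ |(n : ℝ)| := by
  rcases le_total 0 n with h | h
  · have hsub : (Finset.Icc (1 : ℤ) T).filter (fun t => t + n ∉ Finset.Icc (1 : ℤ) T) ⊆
        Finset.Icc (T - n + 1 : ℤ) T := by
      intro t ht
      simp only [Finset.mem_filter, Finset.mem_Icc] at ht ⊢
      omega
    have h1 := Finset.card_le_card hsub
    rw [Int.card_Icc] at h1
    have h2 : ((((Finset.Icc (1 : ℤ) T).filter
        (fun t => t + n ∉ Finset.Icc (1 : ℤ) T)).card : ℤ)) ≤ n := by omega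
    rw [abs_of_nonneg (by exact_mod_cast h)]
    exact_mod_cast h2
  · have hsub : (Finset.Icc (1 : ℤ) T).filter (fun t => t + n ∉ Finset.Icc (1 : ℤ) T) ⊆
        Finset.Icc (1 : ℤ) (-n) := by
      intro t ht
      simp only [Finset.mem_filter, Finset.mem_Icc] at ht ⊢
      omega
    have h1 := Finset.card_le_card hsub
    rw [Int.card_Icc] at h1
    have h2 : ((((Finset.Icc (1 : ℤ) T).filter
        (fun t => t + n ∉ Finset.Icc (1 : ℤ) T)).card : ℤ)) ≤ -n := by omega
    rw [abs_of_nonpos (by exact_mod_cast h)]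
    exact_mod_cast h2

lemma card_filter_exists_le {m : ℕ} (T : ℕ) (j : Fin m → ℤ) :
    (((Finset.Icc (1 : ℤ) T).filter (fun t => ¬ ∀ l, j l + t ∈ Finset.Icc (1 : ℤ) T)).card : ℝ) ≤
      ∑ l, |(j l : ℝ)| := by
  have hsub : (Finset.Icc (1 : ℤ) T).filter (fun t => ¬ ∀ l, j l + t ∈ Finset.Icc (1 : ℤ) T) ⊆
      Finset.univ.biUnion (fun l =>
        (Finset.Icc (1 : ℤ) T).filter (fun t => t + j l ∉ Finset.Icc (1 : ℤ) T)) := by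
    intro t ht
    rw [Finset.mem_filter] at ht
    obtain ⟨l, hl⟩ := not_forall.1 ht.2
    exact Finset.mem_biUnion.2 ⟨l, Finset.mem_univ l, Finset.mem_filter.2
      ⟨ht.1, by rwa [add_comm]⟩⟩
  have h1 := (Finset.card_le_card hsub).trans Finset.card_biUnion_le
  calc _ ≤ ((∑ l, ((Finset.Icc (1 : ℤ) T).filter
        (fun t => t + j l ∉ Finset.Icc (1 : ℤ) T)).card : ℕ) : ℝ) := by exact_mod_cast h1
    _ ≤ _ := by
      rw [Nat.cast_sum]
      exact Finset.sum_le_sum fun l _ => card_filter_add_notMem_le T (j l)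

/-- Summation over all the lags against summation over the observed times. -/
theorem norm_sum_lags_sub_le {m : ℕ} (T : ℕ) (hT : 1 ≤ T) (κ : (Fin m → ℤ) → ℝ)
    (hκ : Summable (fun j => |κ j|)) (hκ1 : Summable (fun j => (∑ l, |(j l : ℝ)|) * |κ j|))
    (a : Fin m → ℤ) (b : ℤ) :
    ‖∑ t₀ ∈ Finset.Icc (1 : ℤ) T, ∑ t ∈ Fintype.piFinset (fun _ : Fin m => Finset.Icc (1 : ℤ) T),
        rootChar T (t₀ * b + ∑ l, t l * a l) * (κ (fun l => t l - t₀) : ℂ) -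
      (if (T : ℤ) ∣ b + ∑ l, a l then (T : ℂ) else 0) *
        ∑' j : Fin m → ℤ, (κ j : ℂ) * rootChar T (∑ l, j l * a l)‖ ≤
      ∑' j : Fin m → ℤ, (∑ l, |(j l : ℝ)|) * |κ j| := by
  set I := Finset.Icc (1 : ℤ) T with hI
  set F : (Fin m → ℤ) → ℂ := fun j => (κ j : ℂ) * rootChar T (∑ l, j l * a l) with hF
  have hFn : ∀ j, ‖F j‖ = |κ j| := fun j => by
    rw [hF]; simp only [norm_mul, norm_rootChar, mul_one, Complex.norm_real, Real.norm_eq_abs]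
  have hFs : Summable F := Summable.of_norm (by simpa only [hFn] using hκ)
  have hind : ∀ t₀ : ℤ, Summable (fun j : Fin m → ℤ => if ∀ l, j l + t₀ ∈ I then F j else 0) := by
    intro t₀
    refine Summable.of_norm_bounded (g := fun j => |κ j|) hκ fun j => ?_
    split_ifs
    · exact (hFn j).le
    · simp
  -- The substitution `t = j + t₀` separates a phase in `t₀`, whose exponent is the total frequency,
  -- from a sum over lags that depends on `t₀` only through the truncation.
  have hinner : ∀ t₀ : ℤ, ∑ t ∈ Fintype.piFinset (fun _ : Fin m => I),
      rootChar T (t₀ * b + ∑ l, t l * a l) * (κ (fun l => t l - t₀) : ℂ) =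
      rootChar T (t₀ * (b + ∑ l, a l)) *
        ∑' j : Fin m → ℤ, if ∀ l, j l + t₀ ∈ I then F j else 0 := by
    intro t₀
    rw [← (Equiv.subRight (fun _ : Fin m => t₀)).tsum_eq, tsum_eq_sum
      (s := Fintype.piFinset (fun _ : Fin m => I)), Finset.mul_sum]
    · refine Finset.sum_congr rfl fun t ht => ?_
      rw [Fintype.mem_piFinset] at ht
      rw [if_pos (by intro l; simpa using ht l)]
      simp only [hF, Equiv.subRight_apply, Pi.sub_apply]
      have : rootChar T (t₀ * b + ∑ l, t l * a l) =
          rootChar T (t₀ * (b + ∑ l, a l)) * rootChar T (∑ l, (t l - t₀) * a l) := by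
        rw [← rootChar_add]; congr 1
        simp only [sub_mul, Finset.sum_sub_distrib, mul_add, Finset.mul_sum]; ring
      rw [this]
      have e : (t - fun _ => t₀) = fun l => t l - t₀ := rfl
      rw [e]; ring
    · intro t ht
      rw [if_neg]
      intro h
      apply ht
      rw [Fintype.mem_piFinset]
      intro l; simpa using h l
  have hmain : (if (T : ℤ) ∣ b + ∑ l, a l then (T : ℂ) else 0) * ∑' j, F j =
      ∑ t₀ ∈ I, rootChar T (t₀ * (b + ∑ l, a l)) * ∑' j, F j := by
    rw [← Finset.sum_mul, sum_rootChar hT]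
  rw [hmain, Finset.sum_congr rfl fun t₀ _ => hinner t₀, ← Finset.sum_sub_distrib]
  have hbound : ∀ t₀ ∈ I, ‖rootChar T (t₀ * (b + ∑ l, a l)) *
        (∑' j : Fin m → ℤ, if ∀ l, j l + t₀ ∈ I then F j else 0) -
        rootChar T (t₀ * (b + ∑ l, a l)) * ∑' j, F j‖ ≤
      ∑' j : Fin m → ℤ, if ¬ ∀ l, j l + t₀ ∈ I then |κ j| else 0 := by
    intro t₀ _
    rw [← mul_sub, norm_mul, norm_rootChar, one_mul, ← (hind t₀).tsum_sub hFs]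
    have hs : Summable (fun j : Fin m → ℤ => if ¬ ∀ l, j l + t₀ ∈ I then |κ j| else 0) := by
      refine hκ.of_nonneg_of_le (fun j => ?_) fun j => ?_
      · split_ifs <;> simp
      · split_ifs <;> simp
    refine tsum_of_norm_bounded hs.hasSum fun j => ?_
    split_ifs
    · simp
    · simp [hFn]
  refine (norm_sum_le _ _).trans ((Finset.sum_le_sum hbound).trans ?_)
  -- After interchanging the sums, each lag vector `j` is counted once for every `t₀` at which it
  -- leaves the observed window, hence at most `∑ |j l|` times.
  rw [← Summable.tsum_finsetSum]
  · refine Summable.tsum_le_tsum (fun j => ?_) ?_ hκ1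
    · rw [← Finset.sum_filter, Finset.sum_const, nsmul_eq_mul]
      exact mul_le_mul_of_nonneg_right (card_filter_exists_le T j) (abs_nonneg _)
    · refine summable_sum fun t₀ _ => hκ.of_nonneg_of_le (fun j => ?_) fun j => ?_
      · split_ifs <;> simp
      · split_ifs <;> simp
  · intro t₀ _
    refine hκ.of_nonneg_of_le (fun j => ?_) fun j => ?_
    · split_ifs <;> simp
    · split_ifs <;> simp

end LagSums

/-! ### Boundedness and Lipschitz continuity of spectral densities -/

section SpectralDensity

variable {Ω : Type*} [MeasurableSpace Ω] {P : Measure Ω} {X : ℤ → Ω → ℝ} {p : ℕ}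

lemma summable_sum_abs_mul_kappa (hX : StationaryCumulantCondition P X p) {m : ℕ} (hm : 1 ≤ m)
    (hmp : m + 1 ≤ p) : Summable (fun j : Fin m → ℤ => (∑ l, |(j l : ℝ)|) * |kappa P X j|) := by
  simp only [Finset.sum_mul]
  refine summable_sum fun l _ => (hX.summable_kappa m hm hmp l).of_nonneg_of_le
    (fun j => by positivity) fun j => ?_
  exact mul_le_mul_of_nonneg_right (by linarith) (abs_nonneg _)

lemma norm_exp_sub_exp_le (x y : ℝ) :
    ‖Complex.exp (Complex.I * x) - Complex.exp (Complex.I * y)‖ ≤ |x - y| := by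
  have h : Complex.exp (Complex.I * x) - Complex.exp (Complex.I * y) =
      Complex.exp (Complex.I * y) * (Complex.exp (Complex.I * ((x - y : ℝ) : ℂ)) - 1) := by
    rw [mul_sub, ← Complex.exp_add]; push_cast; ring_nf
  rw [h, norm_mul, Complex.norm_exp_I_mul_ofReal, one_mul]
  exact Real.norm_exp_I_mul_ofReal_sub_one_le

lemma phase_eq {m : ℕ} (j : Fin m → ℤ) (ω : Fin m → ℝ) :
    Complex.I * ∑ i, (j i : ℂ) * (ω i : ℂ) = Complex.I * ((∑ i, (j i : ℝ) * ω i : ℝ) : ℂ) := by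
  push_cast; rfl

/-- The exponentials are Lipschitz in the frequencies with constants `|j_l|`, so the first absolute
moment of the cumulants bounds the slope. One constant is used for the size and for the slope. -/
lemma higherSpectralDensity_lipschitz (hX : StationaryCumulantCondition P X p) {m : ℕ}
    (hm : 1 ≤ m) (hmp : m + 1 ≤ p) : ∃ C : ℝ, 0 ≤ C ∧
      (∀ ω : Fin m → ℝ, ‖higherSpectralDensity P X ω‖ ≤ C) ∧
      ∀ ω ω' : Fin m → ℝ, ‖higherSpectralDensity P X ω - higherSpectralDensity P X ω'‖ ≤
        C * ∑ l, |ω l - ω' l| := by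
  have hκ := summable_abs_kappa hX hm hmp
  have hκ1 := summable_sum_abs_mul_kappa hX hm hmp
  have hpi := Real.pi_gt_three
  have hn0 : ‖(1 / (2 * Real.pi) ^ m : ℂ)‖ ≤ 1 := by
    rw [norm_div, norm_one, norm_pow, norm_mul, Complex.norm_real, Real.norm_eq_abs,
      abs_of_pos (by linarith), Complex.norm_ofNat]
    refine div_le_one_of_le₀ (one_le_pow₀ (by linarith)) (by positivity)
  have hterm : ∀ ω : Fin m → ℝ, ∀ j : Fin m → ℤ,
      ‖(kappa P X j : ℂ) * Complex.exp (Complex.I * ∑ i, (j i : ℂ) * (ω i : ℂ))‖ =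
        |kappa P X j| := by
    intro ω j
    rw [phase_eq, norm_mul, Complex.norm_exp_I_mul_ofReal, mul_one, Complex.norm_real,
      Real.norm_eq_abs]
  have hsum : ∀ ω : Fin m → ℝ, Summable (fun j : Fin m → ℤ =>
      (kappa P X j : ℂ) * Complex.exp (Complex.I * ∑ i, (j i : ℂ) * (ω i : ℂ))) := fun ω =>
    Summable.of_norm (by simpa only [hterm] using hκ)
  refine ⟨(∑' j : Fin m → ℤ, |kappa P X j|) +
    ∑' j : Fin m → ℤ, (∑ l, |(j l : ℝ)|) * |kappa P X j|, ?_, ?_, ?_⟩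
  · exact add_nonneg (tsum_nonneg fun _ => abs_nonneg _) (tsum_nonneg fun _ => by positivity)
  · intro ω
    have h1 : ‖higherSpectralDensity P X ω‖ ≤ ∑' j : Fin m → ℤ, |kappa P X j| := by
      rw [higherSpectralDensity, norm_mul]
      refine (mul_le_of_le_one_left (norm_nonneg _) hn0).trans ?_
      exact tsum_of_norm_bounded hκ.hasSum fun j => (hterm ω j).le
    exact h1.trans (le_add_of_nonneg_right (tsum_nonneg fun _ => by positivity))
  · intro ω ω'
    rw [higherSpectralDensity, higherSpectralDensity, ← mul_sub, norm_mul,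
      ← (hsum ω).tsum_sub (hsum ω')]
    refine (mul_le_of_le_one_left (norm_nonneg _) hn0).trans ?_
    have hb : ∀ j : Fin m → ℤ,
        ‖(kappa P X j : ℂ) * Complex.exp (Complex.I * ∑ i, (j i : ℂ) * (ω i : ℂ)) -
          (kappa P X j : ℂ) * Complex.exp (Complex.I * ∑ i, (j i : ℂ) * (ω' i : ℂ))‖ ≤
        (∑ l, |(j l : ℝ)|) * |kappa P X j| * ∑ l, |ω l - ω' l| := by
      intro j
      rw [← mul_sub, norm_mul, Complex.norm_real, Real.norm_eq_abs, phase_eq, phase_eq]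
      have h1 := norm_exp_sub_exp_le (∑ i, (j i : ℝ) * ω i) (∑ i, (j i : ℝ) * ω' i)
      have h2 : |(∑ i, (j i : ℝ) * ω i) - ∑ i, (j i : ℝ) * ω' i| ≤
          (∑ l, |(j l : ℝ)|) * ∑ l, |ω l - ω' l| := by
        rw [← Finset.sum_sub_distrib]
        refine (Finset.abs_sum_le_sum_abs _ _).trans ?_
        rw [Finset.sum_mul]
        refine Finset.sum_le_sum fun i _ => ?_
        rw [← mul_sub, abs_mul]
        exact mul_le_mul_of_nonneg_left (Finset.single_le_sum (f := fun l => |ω l - ω' l|)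
          (fun _ _ => abs_nonneg _) (Finset.mem_univ i)) (abs_nonneg _)
      calc _ ≤ |kappa P X j| * ((∑ l, |(j l : ℝ)|) * ∑ l, |ω l - ω' l|) :=
            mul_le_mul_of_nonneg_left (h1.trans h2) (abs_nonneg _)
        _ = _ := by ring
    refine (tsum_of_norm_bounded (hκ1.mul_right _).hasSum hb).trans ?_
    rw [tsum_mul_right]
    exact mul_le_mul_of_nonneg_right (le_add_of_nonneg_left (tsum_nonneg fun _ => abs_nonneg _))
      (Finset.sum_nonneg fun _ _ => abs_nonneg _)

lemma higherSpectralDensity_freq {m : ℕ} (T : ℕ) (a : Fin m → ℤ) :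
    higherSpectralDensity P X (fun l => freq T (a l)) = (1 / (2 * Real.pi) ^ m : ℂ) *
      ∑' j : Fin m → ℤ, (kappa P X j : ℂ) * rootChar T (∑ l, j l * a l) := by
  rw [higherSpectralDensity]
  congr 1
  refine tsum_congr fun j => ?_
  congr 1
  rw [phase_eq, rootChar]
  congr 3
  simp only [freq]
  push_cast
  rw [Finset.mul_sum, Finset.sum_div]
  exact Finset.sum_congr rfl fun i _ => by ring

/-- Places the ordinary spectral density in the general family at `m = 1`, so that the estimates for
arbitrary order apply to it. -/
lemma spectralDensity_eq [IsProbabilityMeasure P] (hX : StationaryCumulantCondition P X p)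
    (hp : 2 ≤ p) (hmean : ∀ t : ℤ, ∫ x, X t x ∂P = 0) (ω : ℝ) :
    spectralDensity P X ω = higherSpectralDensity P X (fun _ : Fin 1 => ω) := by
  rw [spectralDensity, higherSpectralDensity, pow_one,
    ← (Equiv.funUnique (Fin 1) ℤ).tsum_eq]
  congr 1
  refine tsum_congr fun j => ?_
  have hX2 : ∀ t, MemLp (X t) 2 P := fun t =>
    (hX.memLp t).mono_exponent (by exact_mod_cast hp)
  have hc : cov[X 0, X (j 0); P] = kappa P X j := by
    rw [covariance_eq_sub (hX2 _) (hX2 _), hmean, zero_mul, sub_zero]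
    have := integral_mul_eq_kappa hX hp hmean 0 (j 0)
    simp only [Pi.mul_apply]
    rw [this]
    congr 1
    ext i; fin_cases i; simp
  simp only [Equiv.funUnique_apply, Fin.default_eq_zero, hc, Fin.sum_univ_one, mul_assoc]

end SpectralDensity

/-! ### Second moments and fourth cumulants of the discrete Fourier transform -/

section DftMoments

variable {Ω : Type*} {X : ℤ → Ω → ℝ}

/-- The discrete Fourier transform at a Fourier frequency. -/
noncomputable def fdft (X : ℤ → Ω → ℝ) (T : ℕ) (a : ℤ) (x : Ω) : ℂ := dft X T (freq T a) x

/-- The coefficients of the discrete Fourier transform. -/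
noncomputable def dftCoef (T : ℕ) (a t : ℤ) : ℂ :=
  (1 / (Real.sqrt (2 * Real.pi * (T : ℝ)) : ℂ)) * rootChar T (t * a)

lemma fdft_eq (T : ℕ) (a : ℤ) : fdft X T a =
    fun x => ∑ t ∈ Finset.Icc (1 : ℤ) T, dftCoef T a t * (X t x : ℂ) := by
  ext x
  rw [fdft, dft_freq, Finset.mul_sum]
  exact Finset.sum_congr rfl fun t _ => by rw [dftCoef]; ring

variable [MeasurableSpace Ω] {P : Measure Ω}

lemma memLp_ofReal (hX : StationaryCumulantCondition P X 8) [IsProbabilityMeasure P] (t : ℤ) :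
    MemLp (fun x => (X t x : ℂ)) 4 P :=
  ((hX.memLp t).mono_exponent (by norm_num : (4 : ℝ≥0∞) ≤ ((8 : ℕ) : ℝ≥0∞))).ofReal

lemma memLp_fdft [IsProbabilityMeasure P] (hX : StationaryCumulantCondition P X 8) (T : ℕ)
    (a : ℤ) : MemLp (fdft X T a) 4 P := by
  rw [fdft_eq]
  exact memLp_sum_mul _ _ (fun t x => (X t x : ℂ)) (memLp_ofReal hX)

lemma integral_ofReal_eq_zero (hmean : ∀ t : ℤ, ∫ x, X t x ∂P = 0) (t : ℤ) :
    ∫ x, (X t x : ℂ) ∂P = 0 := by rw [integral_complex_ofReal, hmean]; simp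

lemma integral_fdft [IsProbabilityMeasure P] (hX : StationaryCumulantCondition P X 8)
    (hmean : ∀ t : ℤ, ∫ x, X t x ∂P = 0) (T : ℕ) (a : ℤ) : ∫ x, fdft X T a x ∂P = 0 := by
  rw [fdft_eq, integral_sum_smul _ _ (fun t x => (X t x : ℂ))
    (fun t _ => (memLp_ofReal hX t).integrable (by norm_num))]
  simp [integral_ofReal_eq_zero hmean]

lemma integral_ofReal_mul (hX : StationaryCumulantCondition P X 8) [IsProbabilityMeasure P]
    (hmean : ∀ t : ℤ, ∫ x, X t x ∂P = 0) (s t : ℤ) :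
    ∫ x, (X s x : ℂ) * (X t x : ℂ) ∂P = (kappa P X (fun _ : Fin 1 => t - s) : ℂ) := by
  rw [← integral_mul_eq_kappa hX (by norm_num) hmean, ← integral_complex_ofReal]
  push_cast; rfl

lemma cum4_ofReal (hX : StationaryCumulantCondition P X 8) [IsProbabilityMeasure P]
    (hmean : ∀ t : ℤ, ∫ x, X t x ∂P = 0) (a b c d : ℤ) :
    cum4 P (fun x => (X a x : ℂ)) (fun x => (X b x : ℂ)) (fun x => (X c x : ℂ))
      (fun x => (X d x : ℂ)) = (kappa P X ![b - a, c - a, d - a] : ℂ) := by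
  have h := integral_mul_four hX (by norm_num) hmean a b c d
  have h' := congrArg (fun r : ℝ => (r : ℂ)) h
  push_cast at h'
  simp only [cum4, integral_ofReal_eq_zero hmean]
  have e4 : ∫ x, (X a x : ℂ) * ((X b x : ℂ) * ((X c x : ℂ) * (X d x : ℂ))) ∂P =
      ((∫ x, X a x * X b x * X c x * X d x ∂P : ℝ) : ℂ) := by
    rw [← integral_complex_ofReal]
    congr 1; ext x; push_cast; ring
  have e2 : ∀ s t, ∫ x, (X s x : ℂ) * (X t x : ℂ) ∂P = ((∫ x, X s x * X t x ∂P : ℝ) : ℂ) := by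
    intro s t
    rw [← integral_complex_ofReal]
    push_cast; rfl
  rw [e4]
  simp only [e2]
  rw [h']; ring

lemma sum_piFinset_one {M : Type*} [AddCommMonoid M] (I : Finset ℤ) (F : (Fin 1 → ℤ) → M) :
    ∑ p ∈ Fintype.piFinset (fun _ : Fin 1 => I), F p = ∑ t ∈ I, F (fun _ => t) := by
  refine Finset.sum_bij' (fun p _ => p 0) (fun t _ _ => t) ?_ ?_ ?_ ?_ ?_
  · intro p hp; exact Fintype.mem_piFinset.1 hp 0
  · intro t ht; exact Fintype.mem_piFinset.2 fun _ => ht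
  · intro p _; ext l; fin_cases l; rfl
  · intro t _; rfl
  · intro p _; congr 1; ext l; fin_cases l; rfl

lemma sum_piFinset_three {M : Type*} [AddCommMonoid M] (I : Finset ℤ) (F : (Fin 3 → ℤ) → M) :
    ∑ p ∈ Fintype.piFinset (fun _ : Fin 3 => I), F p =
      ∑ r ∈ I, ∑ s ∈ I, ∑ t ∈ I, F ![r, s, t] := by
  have e : ∑ r ∈ I, ∑ s ∈ I, ∑ t ∈ I, F ![r, s, t] =
      ∑ x ∈ I ×ˢ I ×ˢ I, F ![x.1, x.2.1, x.2.2] := by simp only [Finset.sum_product]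
  rw [e]
  refine Finset.sum_bij' (fun p _ => (p 0, p 1, p 2)) (fun x _ => ![x.1, x.2.1, x.2.2])
    ?_ ?_ ?_ ?_ ?_
  · intro p hp
    have := Fintype.mem_piFinset.1 hp
    simp only [Finset.mem_product]
    exact ⟨this 0, this 1, this 2⟩
  · intro x hx
    simp only [Finset.mem_product] at hx
    rw [Fintype.mem_piFinset]
    intro l; fin_cases l
    · exact hx.1
    · exact hx.2.1
    · exact hx.2.2
  · intro p _; ext l; fin_cases l <;> rfl
  · intro x _; rfl
  · intro p _; congr 1; ext l; fin_cases l <;> rfl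

lemma integral_fdft_mul [IsProbabilityMeasure P] (hX : StationaryCumulantCondition P X 8)
    (hmean : ∀ t : ℤ, ∫ x, X t x ∂P = 0) (T : ℕ) (b a : ℤ) :
    ∫ x, fdft X T b x * fdft X T a x ∂P = (1 / (2 * Real.pi * T) : ℂ) *
      ∑ t₀ ∈ Finset.Icc (1 : ℤ) T, ∑ t ∈ Fintype.piFinset (fun _ : Fin 1 => Finset.Icc (1 : ℤ) T),
        rootChar T (t₀ * b + ∑ l, t l * a) * (kappa P X (fun l => t l - t₀) : ℂ) := by
  have h1 : ∫ x, fdft X T b x * fdft X T a x ∂P =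
      ∑ t₀ ∈ Finset.Icc (1 : ℤ) T, dftCoef T b t₀ * ∫ x, (X t₀ x : ℂ) * fdft X T a x ∂P := by
    rw [fdft_eq T b]
    exact integral_sum_mul _ _ (fun t x => (X t x : ℂ)) _
      (fun t _ => integrable_mul_two (memLp_ofReal hX t) (memLp_fdft hX T a))
  rw [h1, Finset.mul_sum]
  refine Finset.sum_congr rfl fun t₀ _ => ?_
  have h2 : ∫ x, (X t₀ x : ℂ) * fdft X T a x ∂P =
      ∑ t ∈ Finset.Icc (1 : ℤ) T, dftCoef T a t * (kappa P X (fun _ : Fin 1 => t - t₀) : ℂ) := by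
    rw [fdft_eq T a]
    simp only [mul_comm (X t₀ _ : ℂ)]
    rw [integral_sum_mul _ _ (fun t x => (X t x : ℂ)) _
      (fun t _ => integrable_mul_two (memLp_ofReal hX t) (memLp_ofReal hX t₀))]
    refine Finset.sum_congr rfl fun t _ => ?_
    rw [← integral_ofReal_mul hX hmean]
    simp only [mul_comm]
  rw [h2, sum_piFinset_one, Finset.mul_sum, Finset.mul_sum]
  refine Finset.sum_congr rfl fun t _ => ?_
  rw [Fin.sum_univ_one, rootChar_add, dftCoef, dftCoef, ← sqrt_sq_inv]
  ring

/-- The lag sum estimate for `m = 1`, divided by `2πT`: the sum over the base time gives `T` at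
resonance and zero otherwise. -/
theorem exists_norm_integral_fdft_sub_le [IsProbabilityMeasure P]
    (hX : StationaryCumulantCondition P X 8) (hmean : ∀ t : ℤ, ∫ x, X t x ∂P = 0) :
    ∃ C : ℝ, 0 ≤ C ∧ ∀ T : ℕ, 1 ≤ T → ∀ b a : ℤ,
      ‖∫ x, fdft X T b x * fdft X T a x ∂P -
        (if (T : ℤ) ∣ b + a then spectralDensity P X (freq T a) else 0)‖ ≤ C / T := by
  have hκ := summable_abs_kappa hX (le_refl 1) (by norm_num)
  have hκ1 := summable_sum_abs_mul_kappa hX (le_refl 1) (by norm_num)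
  refine ⟨∑' j : Fin 1 → ℤ, (∑ l, |(j l : ℝ)|) * |kappa P X j|,
    tsum_nonneg fun _ => by positivity, ?_⟩
  intro T hT b a
  have hT' : (0 : ℝ) < T := by exact_mod_cast hT
  have hTc : (T : ℂ) ≠ 0 := by exact_mod_cast hT'.ne'
  have hpi := Real.pi_gt_three
  have hpc : (Real.pi : ℂ) ≠ 0 := by exact_mod_cast Real.pi_ne_zero
  have h := norm_sum_lags_sub_le T hT (kappa P X) hκ hκ1 (fun _ => a) b
  have h0 := higherSpectralDensity_freq (P := P) (X := X) T (fun _ : Fin 1 => a)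
  rw [integral_fdft_mul hX hmean, spectralDensity_eq hX (by norm_num) hmean, h0]
  rw [Fin.sum_univ_one] at h
  have e : ∀ S U : ℂ, (1 / (2 * Real.pi * T) : ℂ) * S -
      (if (T : ℤ) ∣ b + a then (1 / (2 * Real.pi) ^ 1 : ℂ) * U else 0) =
      (1 / (2 * Real.pi * T) : ℂ) * (S - (if (T : ℤ) ∣ b + a then (T : ℂ) else 0) * U) := by
    intro S U
    split_ifs
    · field_simp
    · ring
  rw [e, norm_mul]
  have hn : ‖(1 / (2 * Real.pi * T) : ℂ)‖ ≤ 1 / T := by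
    rw [norm_div, norm_one, norm_mul, norm_mul, Complex.norm_natCast, Complex.norm_real,
      Real.norm_eq_abs, abs_of_pos (by linarith), Complex.norm_ofNat]
    exact one_div_le_one_div_of_le hT' (by nlinarith)
  refine (mul_le_mul hn h (norm_nonneg _) (by positivity)).trans (le_of_eq (by ring))

/-- The lag sum estimate for `m = 3`, divided by `(2πT)²`. At resonance the factor `T / (2πT)²`
equals `(2π/T) (2π)⁻³`, and the last power is the normalisation of the fourth order spectral
density. -/
theorem exists_norm_cum4_fdft_sub_le [IsProbabilityMeasure P]
    (hX : StationaryCumulantCondition P X 8) (hmean : ∀ t : ℤ, ∫ x, X t x ∂P = 0) :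
    ∃ C : ℝ, 0 ≤ C ∧ ∀ T : ℕ, 1 ≤ T → ∀ b a₁ a₂ a₃ : ℤ,
      ‖cum4 P (fdft X T b) (fdft X T a₁) (fdft X T a₂) (fdft X T a₃) -
        (if (T : ℤ) ∣ b + (a₁ + a₂ + a₃) then (2 * Real.pi / T : ℂ) *
          higherSpectralDensity P X ![freq T a₁, freq T a₂, freq T a₃] else 0)‖ ≤ C / T ^ 2 := by
  have hκ := summable_abs_kappa (m := 3) hX (by norm_num) (by norm_num)
  have hκ1 := summable_sum_abs_mul_kappa (m := 3) hX (by norm_num) (by norm_num)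
  refine ⟨∑' j : Fin 3 → ℤ, (∑ l, |(j l : ℝ)|) * |kappa P X j|,
    tsum_nonneg fun _ => by positivity, ?_⟩
  intro T hT b a₁ a₂ a₃
  have hT' : (0 : ℝ) < T := by exact_mod_cast hT
  have hTc : (T : ℂ) ≠ 0 := by exact_mod_cast hT'.ne'
  have hpi := Real.pi_gt_three
  have hpc : (Real.pi : ℂ) ≠ 0 := by exact_mod_cast Real.pi_ne_zero
  have h := norm_sum_lags_sub_le T hT (kappa P X) hκ hκ1 ![a₁, a₂, a₃] b
  have h0 := higherSpectralDensity_freq (P := P) (X := X) T ![a₁, a₂, a₃]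
  have hv : (fun l => freq T (![a₁, a₂, a₃] l)) = ![freq T a₁, freq T a₂, freq T a₃] := by
    ext l; fin_cases l <;> rfl
  have hsum : ∑ l, ![a₁, a₂, a₃] l = a₁ + a₂ + a₃ := by simp [Fin.sum_univ_three]
  have hc : cum4 P (fdft X T b) (fdft X T a₁) (fdft X T a₂) (fdft X T a₃) =
      (1 / (2 * Real.pi * T) : ℂ) ^ 2 * ∑ t₀ ∈ Finset.Icc (1 : ℤ) T,
        ∑ t ∈ Fintype.piFinset (fun _ : Fin 3 => Finset.Icc (1 : ℤ) T),
        rootChar T (t₀ * b + ∑ l, t l * ![a₁, a₂, a₃] l) *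
          (kappa P X (fun l => t l - t₀) : ℂ) := by
    rw [fdft_eq T b, fdft_eq T a₁, fdft_eq T a₂, fdft_eq T a₃,
      cum4_sum_sum (Finset.Icc (1 : ℤ) T) (dftCoef T b) (dftCoef T a₁) (dftCoef T a₂)
        (dftCoef T a₃) (fun t x => (X t x : ℂ)) (memLp_ofReal hX), Finset.mul_sum]
    refine Finset.sum_congr rfl fun t₀ _ => ?_
    rw [sum_piFinset_three, Finset.mul_sum]
    refine Finset.sum_congr rfl fun r _ => ?_
    rw [Finset.mul_sum]
    refine Finset.sum_congr rfl fun s _ => ?_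
    rw [Finset.mul_sum]
    refine Finset.sum_congr rfl fun t _ => ?_
    rw [cum4_ofReal hX hmean]
    have hk : (fun l : Fin 3 => (![r, s, t] : Fin 3 → ℤ) l - t₀) =
        ![r - t₀, s - t₀, t - t₀] := by ext l; fin_cases l <;> rfl
    rw [hk]
    simp only [Fin.sum_univ_three, Matrix.cons_val]
    rw [rootChar_add, rootChar_add, rootChar_add, ← sqrt_sq_inv]
    simp only [dftCoef]
    ring
  rw [hc, ← hv, h0]
  rw [hsum] at h
  have e : ∀ S U : ℂ, (1 / (2 * Real.pi * T) : ℂ) ^ 2 * S -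
      (if (T : ℤ) ∣ b + (a₁ + a₂ + a₃) then
        (2 * Real.pi / T : ℂ) * ((1 / (2 * Real.pi) ^ 3 : ℂ) * U) else 0) =
      (1 / (2 * Real.pi * T) : ℂ) ^ 2 *
        (S - (if (T : ℤ) ∣ b + (a₁ + a₂ + a₃) then (T : ℂ) else 0) * U) := by
    intro S U
    split_ifs
    · field_simp
    · ring
  rw [e, norm_mul, norm_pow]
  have hn : ‖(1 / (2 * Real.pi * T) : ℂ)‖ ≤ 1 / T := by
    rw [norm_div, norm_one, norm_mul, norm_mul, Complex.norm_natCast, Complex.norm_real,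
      Real.norm_eq_abs, abs_of_pos (by linarith), Complex.norm_ofNat]
    exact one_div_le_one_div_of_le hT' (by nlinarith)
  refine (mul_le_mul (pow_le_pow_left₀ (norm_nonneg _) hn 2) h (norm_nonneg _)
    (by positivity)).trans (le_of_eq (by ring))

end DftMoments

/-! ### Indicators of resonant frequencies -/

section Indicators

/-- The indicator of divisibility by `T`. -/
noncomputable def dvdInd (T : ℕ) (n : ℤ) : ℝ := if (T : ℤ) ∣ n then 1 else 0

lemma dvdInd_nonneg (T : ℕ) (n : ℤ) : 0 ≤ dvdInd T n := by unfold dvdInd; split_ifs <;> simp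

lemma dvdInd_add (T : ℕ) (n : ℤ) : dvdInd T (n + T) = dvdInd T n := by
  simp [dvdInd]

lemma sum_dvdInd {T : ℕ} (hT : 1 ≤ T) : ∑ l ∈ Finset.Icc (1 : ℤ) T, dvdInd T l = 1 := by
  rw [Finset.sum_eq_single (T : ℤ)]
  · simp [dvdInd]
  · intro l hl hne
    rw [Finset.mem_Icc] at hl
    rw [dvdInd, if_neg]
    intro h
    exact absurd (Int.le_of_dvd (by omega) h) (by omega)
  · intro h
    exact absurd (Finset.mem_Icc.2 ⟨by omega, le_rfl⟩) h

lemma sum_dvdInd_add {T : ℕ} (hT : 1 ≤ T) (c : ℤ) :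
    ∑ l ∈ Finset.Icc (1 : ℤ) T, dvdInd T (l + c) = 1 := by
  rw [sum_Icc_add_of_periodic T (dvdInd T) (dvdInd_add T), sum_dvdInd hT]

lemma sum_dvdInd_sub {T : ℕ} (hT : 1 ≤ T) (c : ℤ) :
    ∑ l ∈ Finset.Icc (1 : ℤ) T, dvdInd T (c - l) = 1 := by
  rw [sum_Icc_sub_of_periodic T (dvdInd T) (dvdInd_add T), sum_dvdInd hT]

lemma sum_dvdInd_unit {T : ℕ} (hT : 1 ≤ T) (c : ℤ) {ε : ℤ} (hε : ε = 1 ∨ ε = -1) :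
    ∑ l ∈ Finset.Icc (1 : ℤ) T, dvdInd T (c + ε * l) = 1 := by
  rcases hε with rfl | rfl
  · rw [← sum_dvdInd_add hT c]
    exact Finset.sum_congr rfl fun l _ => by congr 1; ring
  · rw [← sum_dvdInd_sub hT c]
    exact Finset.sum_congr rfl fun l _ => by congr 1; ring

end Indicators

/-! ### Moments of four values of the Fourier transform -/

section SecondMoments

variable {Ω : Type*} [MeasurableSpace Ω] {P : Measure Ω} {X : ℤ → Ω → ℝ}

variable (P X) in
/-- The second moment of two values of the discrete Fourier transform. -/
noncomputable def dftCov (T : ℕ) (b a : ℤ) : ℂ := ∫ x, fdft X T b x * fdft X T a x ∂P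

lemma dftCov_comm (T : ℕ) (b a : ℤ) : dftCov P X T b a = dftCov P X T a b := by
  simp only [dftCov, mul_comm]

variable (P X) in
/-- The fourth moment of four values of the discrete Fourier transform. -/
noncomputable def dftFour (T : ℕ) (a b c d : ℤ) : ℂ :=
  ∫ x, fdft X T a x * (fdft X T b x * (fdft X T c x * fdft X T d x)) ∂P

lemma dftFour_eq [IsProbabilityMeasure P] (hX : StationaryCumulantCondition P X 8)
    (hmean : ∀ t : ℤ, ∫ x, X t x ∂P = 0) (T : ℕ) (a b c d : ℤ) :
    dftFour P X T a b c d = dftCov P X T a b * dftCov P X T c d +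
      dftCov P X T a c * dftCov P X T b d + dftCov P X T a d * dftCov P X T b c +
      cum4 P (fdft X T a) (fdft X T b) (fdft X T c) (fdft X T d) := by
  rw [dftFour, integral_four_eq]
  simp only [integral_fdft hX hmean, dftCov]
  ring

/-- The constants of the frequency domain estimates. -/
structure FreqBounds (P : Measure Ω) (X : ℤ → Ω → ℝ) (F C : ℝ) : Prop where
  F_nonneg : 0 ≤ F
  C_nonneg : 0 ≤ C
  spectral : ∀ ω, ‖spectralDensity P X ω‖ ≤ F
  spectral_lip : ∀ ω ω', ‖spectralDensity P X ω - spectralDensity P X ω'‖ ≤ F * |ω - ω'|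
  fourth : ∀ ω : Fin 3 → ℝ, ‖higherSpectralDensity P X ω‖ ≤ F
  fourth_lip : ∀ ω ω' : Fin 3 → ℝ,
    ‖higherSpectralDensity P X ω - higherSpectralDensity P X ω'‖ ≤ F * ∑ l, |ω l - ω' l|
  cov : ∀ T : ℕ, 1 ≤ T → ∀ b a : ℤ,
    ‖dftCov P X T b a - dvdInd T (b + a) * spectralDensity P X (freq T a)‖ ≤ C / T
  cum : ∀ T : ℕ, 1 ≤ T → ∀ b a₁ a₂ a₃ : ℤ,
    ‖cum4 P (fdft X T b) (fdft X T a₁) (fdft X T a₂) (fdft X T a₃) -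
      dvdInd T (b + (a₁ + a₂ + a₃)) * ((2 * Real.pi / T : ℂ) *
        higherSpectralDensity P X ![freq T a₁, freq T a₂, freq T a₃])‖ ≤ C / T ^ 2

theorem exists_freqBounds [IsProbabilityMeasure P] (hX : StationaryCumulantCondition P X 8)
    (hmean : ∀ t : ℤ, ∫ x, X t x ∂P = 0) : ∃ F C : ℝ, FreqBounds P X F C := by
  obtain ⟨F1, hF1, h1, h1'⟩ := higherSpectralDensity_lipschitz (m := 1) hX (by norm_num)
    (by norm_num)
  obtain ⟨F2, hF2, h2, h2'⟩ := higherSpectralDensity_lipschitz (m := 3) hX (by norm_num)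
    (by norm_num)
  obtain ⟨C1, hC1, h3⟩ := exists_norm_integral_fdft_sub_le hX hmean
  obtain ⟨C2, hC2, h4⟩ := exists_norm_cum4_fdft_sub_le hX hmean
  refine ⟨max F1 F2, max C1 C2, ?_⟩
  constructor
  · exact le_max_of_le_left hF1
  · exact le_max_of_le_left hC1
  · intro ω
    rw [spectralDensity_eq hX (by norm_num) hmean]
    exact (h1 _).trans (le_max_left _ _)
  · intro ω ω'
    rw [spectralDensity_eq hX (by norm_num) hmean, spectralDensity_eq hX (by norm_num) hmean]
    refine (h1' _ _).trans ?_
    rw [Fin.sum_univ_one]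
    exact mul_le_mul_of_nonneg_right (le_max_left _ _) (abs_nonneg _)
  · intro ω
    exact (h2 _).trans (le_max_right _ _)
  · intro ω ω'
    exact (h2' _ _).trans (mul_le_mul_of_nonneg_right (le_max_right _ _)
      (Finset.sum_nonneg fun _ _ => abs_nonneg _))
  · intro T hT b a
    have := h3 T hT b a
    have e : (dvdInd T (b + a) : ℂ) * spectralDensity P X (freq T a) =
        if (T : ℤ) ∣ b + a then spectralDensity P X (freq T a) else 0 := by
      unfold dvdInd; split_ifs <;> simp
    rw [e]
    exact this.trans (by gcongr; exact le_max_left _ _)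
  · intro T hT b a₁ a₂ a₃
    have := h4 T hT b a₁ a₂ a₃
    have e : (dvdInd T (b + (a₁ + a₂ + a₃)) : ℂ) * ((2 * Real.pi / T : ℂ) *
        higherSpectralDensity P X ![freq T a₁, freq T a₂, freq T a₃]) =
        if (T : ℤ) ∣ b + (a₁ + a₂ + a₃) then (2 * Real.pi / T : ℂ) *
          higherSpectralDensity P X ![freq T a₁, freq T a₂, freq T a₃] else 0 := by
      unfold dvdInd; split_ifs <;> simp
    rw [e]
    exact this.trans (by gcongr; exact le_max_right _ _)

variable {F C : ℝ}

lemma FreqBounds.norm_dftCov_le (h : FreqBounds P X F C) {T : ℕ} (hT : 1 ≤ T) (b a : ℤ) :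
    ‖dftCov P X T b a‖ ≤ F * dvdInd T (b + a) + C / T := by
  have h1 := h.cov T hT b a
  have h2 : ‖(dvdInd T (b + a) : ℂ) * spectralDensity P X (freq T a)‖ ≤ F * dvdInd T (b + a) := by
    rw [norm_mul, Complex.norm_real, Real.norm_eq_abs, abs_of_nonneg (dvdInd_nonneg _ _), mul_comm]
    exact mul_le_mul_of_nonneg_right (h.spectral _) (dvdInd_nonneg _ _)
  calc _ = ‖(dvdInd T (b + a) : ℂ) * spectralDensity P X (freq T a) + (dftCov P X T b a -
        (dvdInd T (b + a) : ℂ) * spectralDensity P X (freq T a))‖ := by rw [add_sub_cancel]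
    _ ≤ _ := (norm_add_le _ _).trans (add_le_add h2 h1)

lemma dvdInd_mul_eq_zero {T : ℕ} {m n : ℤ} (h : ¬ (T : ℤ) ∣ m + n) :
    dvdInd T m * dvdInd T n = 0 := by
  unfold dvdInd
  split_ifs with h1 h2 <;> simp
  exact h (dvd_add h1 h2)

/-- When the total frequency is not a multiple of `T`, the two pairs cannot both be resonant, and
the only term without a factor `1/T` disappears. -/
lemma FreqBounds.norm_dftCov_mul_le (h : FreqBounds P X F C) {T : ℕ} (hT : 1 ≤ T) (a b c d : ℤ)
    (hn : ¬ (T : ℤ) ∣ (a + b) + (c + d)) :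
    ‖dftCov P X T a b * dftCov P X T c d‖ ≤
      F * (C / T) * (dvdInd T (a + b) + dvdInd T (c + d)) + (C / T) ^ 2 := by
  have hT' : (0 : ℝ) < T := by exact_mod_cast hT
  have hC := h.C_nonneg
  have hF := h.F_nonneg
  rw [norm_mul]
  refine (mul_le_mul (h.norm_dftCov_le hT a b) (h.norm_dftCov_le hT c d) (norm_nonneg _) ?_).trans
    (le_of_eq ?_)
  · have := dvdInd_nonneg T (a + b); positivity
  · have := dvdInd_mul_eq_zero hn
    linear_combination F ^ 2 * this

/-- All three pairings and the fourth cumulant are off resonance in total. The pairing `(a b)(c d)`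
has neither factor resonant; in the other two pairings at most one factor is, and the indicators
record where. -/
lemma FreqBounds.norm_dftFour_le (h : FreqBounds P X F C) [IsProbabilityMeasure P]
    (hX : StationaryCumulantCondition P X 8)
    (hmean : ∀ t : ℤ, ∫ x, X t x ∂P = 0) {T : ℕ} (hT : 1 ≤ T) (a b c d : ℤ)
    (h1 : ¬ (T : ℤ) ∣ a + b) (h2 : ¬ (T : ℤ) ∣ c + d) (h3 : ¬ (T : ℤ) ∣ (a + b) + (c + d)) :
    ‖dftFour P X T a b c d‖ ≤ F * (C / T) * (dvdInd T (a + c) + dvdInd T (b + d) +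
      dvdInd T (a + d) + dvdInd T (b + c)) + (3 * C ^ 2 + C) / T ^ 2 := by
  have hT' : (0 : ℝ) < T := by exact_mod_cast hT
  have i1 : ‖dftCov P X T a b * dftCov P X T c d‖ ≤ (C / T) ^ 2 := by
    have := h.norm_dftCov_mul_le hT a b c d h3
    rwa [dvdInd, dvdInd, if_neg h1, if_neg h2, add_zero, mul_zero, zero_add] at this
  have i2 := h.norm_dftCov_mul_le hT a c b d (by rwa [show a + c + (b + d) = a + b + (c
      + d) by ring])
  have i3 := h.norm_dftCov_mul_le hT a d b c (by rwa [show a + d + (b + c) = a + b + (c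
      + d) by ring])
  have i4 : ‖cum4 P (fdft X T a) (fdft X T b) (fdft X T c) (fdft X T d)‖ ≤ C / T ^ 2 := by
    have := h.cum T hT a b c d
    rwa [dvdInd, if_neg (by rwa [show a + (b + c + d) = a + b + (c + d) by ring]),
      Complex.ofReal_zero, zero_mul, sub_zero] at this
  rw [dftFour_eq hX hmean]
  refine (norm_add_le _ _).trans ((add_le_add (norm_add₃_le) le_rfl).trans ?_)
  have e : (3 * C ^ 2 + C) / (T : ℝ) ^ 2 = (C / T) ^ 2 + (C / T) ^ 2 + (C / T) ^ 2 + C / T ^ 2 := by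
    ring
  rw [e]
  linarith

end SecondMoments

/-! ### The orthogonal sample as a sum of products of Fourier transforms -/

section OrthSums

variable {Ω : Type*} {X : ℤ → Ω → ℝ} {φ : ℝ → ℂ} {B Λ : ℝ}

lemma orthSample_eq_sum (φ : ℝ → ℂ) (T : ℕ) (r : ℤ) : orthSample X φ T r = fun x =>
    ∑ k ∈ Finset.Icc (1 : ℤ) T, (1 / (T : ℂ) * φ (freq T k)) *
      (fdft X T k x * fdft X T (-(k + r)) x) := by
  ext x
  rw [orthSample_eq, Finset.mul_sum]
  exact Finset.sum_congr rfl fun k _ => by simp only [fdft]; ring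

lemma conj_orthSample_eq_sum (φ : ℝ → ℂ) (T : ℕ) (r : ℤ) :
    (fun x => (starRingEnd ℂ) (orthSample X φ T r x)) = fun x =>
    ∑ k ∈ Finset.Icc (1 : ℤ) T, (1 / (T : ℂ) * (starRingEnd ℂ) (φ (freq T k))) *
      (fdft X T (-k) x * fdft X T (k + r) x) := by
  ext x
  rw [orthSample_eq_sum, map_sum]
  refine Finset.sum_congr rfl fun k _ => ?_
  simp only [map_mul, map_div₀, map_one, Complex.conj_natCast, fdft, conj_dft_freq, neg_neg]

lemma norm_weight_le (hφ : LipWeight φ B Λ) {T : ℕ} {k : ℤ} (hk : k ∈ Finset.Icc (1 : ℤ) T) :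
    ‖(1 / (T : ℂ) * φ (freq T k))‖ ≤ B / T := by
  rw [norm_mul, norm_div, norm_one, Complex.norm_natCast, div_mul_eq_mul_div, one_mul]
  exact div_le_div_of_nonneg_right (hφ.bound _ (freq_mem hk)) (Nat.cast_nonneg _)

end OrthSums

/-! ### First and second moments of the orthogonal samples -/

section OrthMoments

variable {Ω : Type*} [MeasurableSpace Ω] {P : Measure Ω} {X : ℤ → Ω → ℝ} {φ : ℝ → ℂ}
  {B Λ F C : ℝ}

/-- The mean of `A_T(φ; r)` is of order `1/T`. -/
lemma norm_integral_orthSample_le [IsProbabilityMeasure P]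
    (hX : StationaryCumulantCondition P X 8) (h : FreqBounds P X F C)
    (hφ : LipWeight φ B Λ) {T : ℕ} (hT : 1 ≤ T) {r : ℤ} (hr : ¬ (T : ℤ) ∣ r) :
    ‖∫ x, orthSample X φ T r x ∂P‖ ≤ B * C / T := by
  have hT' : (0 : ℝ) < T := by exact_mod_cast hT
  rw [orthSample_eq_sum, integral_sum_smul _ _ (fun k x => fdft X T k x * fdft X T (-(k + r)) x)
    (fun k _ => integrable_mul_two (memLp_fdft hX T _) (memLp_fdft hX T _))]
  refine (norm_sum_le _ _).trans ?_
  have : ∀ k ∈ Finset.Icc (1 : ℤ) T, ‖(1 / (T : ℂ) * φ (freq T k)) *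
      ∫ x, fdft X T k x * fdft X T (-(k + r)) x ∂P‖ ≤ B / T * (C / T) := by
    intro k hk
    rw [norm_mul]
    refine mul_le_mul (norm_weight_le hφ hk) ?_ (norm_nonneg _)
      (div_nonneg hφ.bound_nonneg hT'.le)
    have := h.norm_dftCov_le hT k (-(k + r))
    rwa [dvdInd, if_neg (by
      rw [show k + -(k + r) = -r by ring, dvd_neg]; exact hr), mul_zero, zero_add] at this
  refine (Finset.sum_le_sum this).trans (le_of_eq ?_)
  rw [Finset.sum_const, Int.card_Icc, nsmul_eq_mul]
  simp only [add_sub_cancel_right, Int.toNat_natCast]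
  field_simp

lemma integral_sum_mul_sum [IsProbabilityMeasure P] (hX : StationaryCumulantCondition P X 8)
    (T : ℕ) (w v : ℤ → ℂ) (a b c d : ℤ → ℤ) :
    ∫ x, (∑ k ∈ Finset.Icc (1 : ℤ) T, w k * (fdft X T (a k) x * fdft X T (b k) x)) *
      (∑ l ∈ Finset.Icc (1 : ℤ) T, v l * (fdft X T (c l) x * fdft X T (d l) x)) ∂P =
    ∑ k ∈ Finset.Icc (1 : ℤ) T, ∑ l ∈ Finset.Icc (1 : ℤ) T, w k * v l *
      dftFour P X T (a k) (b k) (c l) (d l) := by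
  have hm := fun a => memLp_fdft (P := P) hX T a
  have hint : ∀ k l, Integrable (fun x => (fdft X T (a k) x * fdft X T (b k) x) *
      (fdft X T (c l) x * fdft X T (d l) x)) P := fun k l =>
    (memLp_mul_two (hm _) (hm _)).integrable_mul (memLp_mul_two (hm _) (hm _))
  have hW : MemLp (fun x => ∑ l ∈ Finset.Icc (1 : ℤ) T,
      v l * (fdft X T (c l) x * fdft X T (d l) x)) 2 P :=
    memLp_finsetSum _ fun l _ => (memLp_mul_two (hm _) (hm _)).const_mul _
  rw [integral_sum_mul _ w (fun k x => fdft X T (a k) x * fdft X T (b k) x) _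
    (fun k _ => (memLp_mul_two (hm _) (hm _)).integrable_mul hW)]
  refine Finset.sum_congr rfl fun k _ => ?_
  have e : ∫ x, (fdft X T (a k) x * fdft X T (b k) x) * (∑ l ∈ Finset.Icc (1 : ℤ) T,
      v l * (fdft X T (c l) x * fdft X T (d l) x)) ∂P =
      ∑ l ∈ Finset.Icc (1 : ℤ) T, v l * dftFour P X T (a k) (b k) (c l) (d l) := by
    have := integral_sum_mul (P := P) (Finset.Icc (1 : ℤ) T) v
      (fun l x => fdft X T (c l) x * fdft X T (d l) x)
      (fun x => fdft X T (a k) x * fdft X T (b k) x)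
      (fun l _ => by simpa only [mul_comm] using hint k l)
    simp only [mul_comm (fdft X T (a k) _ * fdft X T (b k) _)]
    rw [this]
    refine Finset.sum_congr rfl fun l _ => ?_
    congr 1
    rw [dftFour]
    congr 1; ext x; ring
  rw [e, Finset.mul_sum]
  exact Finset.sum_congr rfl fun l _ => by ring

/-- Second moments of two sums of products of Fourier transforms with mismatching frequencies. -/
lemma norm_sum_dftFour_le [IsProbabilityMeasure P] (hX : StationaryCumulantCondition P X 8)
    (hmean : ∀ t : ℤ, ∫ x, X t x ∂P = 0) (h : FreqBounds P X F C)
    {T : ℕ} (hT : 1 ≤ T) {B : ℝ} (hB : 0 ≤ B) (w v : ℤ → ℂ)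
    (hw : ∀ k ∈ Finset.Icc (1 : ℤ) T, ‖w k‖ ≤ B / T)
    (hv : ∀ k ∈ Finset.Icc (1 : ℤ) T, ‖v k‖ ≤ B / T) {r e ε : ℤ} (hε : ε = 1 ∨ ε = -1)
    (hr : ¬ (T : ℤ) ∣ r) (he : ¬ (T : ℤ) ∣ e) (her : ¬ (T : ℤ) ∣ e - r) :
    ‖∑ k ∈ Finset.Icc (1 : ℤ) T, ∑ l ∈ Finset.Icc (1 : ℤ) T, w k * v l *
      dftFour P X T k (-(k + r)) (ε * l) (-(ε * l) + e)‖ ≤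
      B ^ 2 * (4 * F * C + (3 * C ^ 2 + C)) / T ^ 2 := by
  have hT' : (0 : ℝ) < T := by exact_mod_cast hT
  have hε' : -ε = 1 ∨ -ε = -1 := by omega
  have hrow : ∀ k ∈ Finset.Icc (1 : ℤ) T, ‖∑ l ∈ Finset.Icc (1 : ℤ) T, w k * v l *
      dftFour P X T k (-(k + r)) (ε * l) (-(ε * l) + e)‖ ≤
      (B / T) ^ 2 * ((4 * F * C + (3 * C ^ 2 + C)) / T) := by
    intro k hk
    have hterm : ∀ l ∈ Finset.Icc (1 : ℤ) T, ‖w k * v l *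
        dftFour P X T k (-(k + r)) (ε * l) (-(ε * l) + e)‖ ≤ (B / T) ^ 2 *
        (F * (C / T) * (dvdInd T (k + ε * l) + dvdInd T ((-(k + r) + e) + (-ε) * l) +
          dvdInd T ((k + e) + (-ε) * l) + dvdInd T (-(k + r) + ε * l)) +
          (3 * C ^ 2 + C) / T ^ 2) := by
      intro l hl
      rw [norm_mul, norm_mul, sq]
      refine mul_le_mul (mul_le_mul (hw k hk) (hv l hl) (norm_nonneg _) (by positivity)) ?_
        (norm_nonneg _) (by positivity)
      have := h.norm_dftFour_le hX hmean hT k (-(k + r)) (ε * l) (-(ε * l) + e)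
        (by rw [show k + -(k + r) = -r by ring, dvd_neg]; exact hr)
        (by rw [show ε * l + (-(ε * l) + e) = e by ring]; exact he)
        (by rw [show k + -(k + r) + (ε * l + (-(ε * l) + e)) = e - r by ring]; exact her)
      rw [show -(k + r) + (-(ε * l) + e) = (-(k + r) + e) + (-ε) * l by ring,
        show k + (-(ε * l) + e) = (k + e) + (-ε) * l by ring] at this
      exact this
    refine (norm_sum_le _ _).trans ((Finset.sum_le_sum hterm).trans (le_of_eq ?_))
    -- For fixed `k` each of the four indicators is one for exactly one `l`. A term of size `1/T` on
    -- this sparse set weighs as much as `1/T²` on all `l`.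
    rw [← Finset.mul_sum, Finset.sum_add_distrib, ← Finset.mul_sum, Finset.sum_add_distrib,
      Finset.sum_add_distrib, Finset.sum_add_distrib, sum_dvdInd_unit hT _ hε,
      sum_dvdInd_unit hT _ hε', sum_dvdInd_unit hT _ hε', sum_dvdInd_unit hT _ hε,
      Finset.sum_const, Int.card_Icc, nsmul_eq_mul]
    simp only [add_sub_cancel_right, Int.toNat_natCast]
    field_simp
    ring
  refine (norm_sum_le _ _).trans ((Finset.sum_le_sum hrow).trans (le_of_eq ?_))
  rw [Finset.sum_const, Int.card_Icc, nsmul_eq_mul]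
  simp only [add_sub_cancel_right, Int.toNat_natCast]
  field_simp

/-- The frequencies in `A_r` add up to `-r` and those in `A_s` to `-s`, so the four transforms are
out of resonance unless `T ∣ r + s`. For a conjugated second factor the condition turns into `T ∣ s
- r`. -/
lemma norm_integral_orthSample_mul_le [IsProbabilityMeasure P]
    (hX : StationaryCumulantCondition P X 8)
    (hmean : ∀ t : ℤ, ∫ x, X t x ∂P = 0) (h : FreqBounds P X F C) (hφ : LipWeight φ B Λ)
    {T : ℕ} (hT : 1 ≤ T) {r s : ℤ} (hr : ¬ (T : ℤ) ∣ r) (hs : ¬ (T : ℤ) ∣ s)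
    (hrs : ¬ (T : ℤ) ∣ r + s) :
    ‖∫ x, orthSample X φ T r x * orthSample X φ T s x ∂P‖ ≤
      B ^ 2 * (4 * F * C + (3 * C ^ 2 + C)) / T ^ 2 := by
  have h1 := norm_sum_dftFour_le hX hmean h hT hφ.bound_nonneg _ _
    (fun k hk => norm_weight_le hφ hk) (fun k hk => norm_weight_le hφ hk)
    (ε := 1) (e := -s) (Or.inl rfl) hr (by rwa [dvd_neg])
    (by rw [show -s - r = -(r + s) by ring, dvd_neg]; exact hrs)
  rw [orthSample_eq_sum, orthSample_eq_sum, integral_sum_mul_sum hX]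
  convert h1 using 8
  · ring
  · ring

lemma norm_integral_orthSample_mul_conj_le [IsProbabilityMeasure P]
    (hX : StationaryCumulantCondition P X 8)
    (hmean : ∀ t : ℤ, ∫ x, X t x ∂P = 0) (h : FreqBounds P X F C) (hφ : LipWeight φ B Λ)
    {T : ℕ} (hT : 1 ≤ T) {r s : ℤ} (hr : ¬ (T : ℤ) ∣ r) (hs : ¬ (T : ℤ) ∣ s)
    (hrs : ¬ (T : ℤ) ∣ s - r) :
    ‖∫ x, orthSample X φ T r x * (starRingEnd ℂ) (orthSample X φ T s x) ∂P‖ ≤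
      B ^ 2 * (4 * F * C + (3 * C ^ 2 + C)) / T ^ 2 := by
  have h1 := norm_sum_dftFour_le hX hmean h hT hφ.bound_nonneg _
    (fun k => 1 / (T : ℂ) * (starRingEnd ℂ) (φ (freq T k)))
    (fun k hk => norm_weight_le hφ hk) (fun k hk => by
      have := norm_weight_le hφ hk
      rw [norm_mul] at this ⊢
      rwa [RCLike.norm_conj])
    (ε := -1) (e := s) (Or.inr rfl) hr hs hrs
  have e := congrFun (conj_orthSample_eq_sum (X := X) φ T s)
  simp only [e]
  rw [orthSample_eq_sum, integral_sum_mul_sum hX]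
  convert h1 using 8
  · ring
  · ring

variable (P X) in
/-- The leading term of the fourth moment in the second moment of `A_T(φ; r)`. -/
noncomputable def mainFour (T : ℕ) (r k l : ℤ) : ℂ :=
  dvdInd T (k - l) * (spectralDensity P X (freq T k) * spectralDensity P X (freq T (k + r))) +
  dvdInd T (k + r + l) * (spectralDensity P X (freq T k) * spectralDensity P X (freq T (k + r))) +
  (2 * Real.pi / T : ℂ) *
    higherSpectralDensity P X ![freq T k, -freq T (k + r), -freq T l]

lemma spectralDensity_freq_congr [IsProbabilityMeasure P]
    (hX : StationaryCumulantCondition P X 8) (hmean : ∀ t : ℤ, ∫ x, X t x ∂P = 0)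
    {T : ℕ} (hT : 1 ≤ T) {a b : ℤ} (hab : (T : ℤ) ∣ b - a) :
    spectralDensity P X (freq T a) = spectralDensity P X (freq T b) := by
  rw [spectralDensity_eq hX (by norm_num) hmean, spectralDensity_eq hX (by norm_num) hmean,
    higherSpectralDensity_freq T (fun _ => a), higherSpectralDensity_freq T (fun _ => b)]
  congr 1
  refine tsum_congr fun j => ?_
  congr 1
  rw [Fin.sum_univ_one, Fin.sum_univ_one, show j 0 * b = j 0 * a + j 0 * (b - a) by ring,
    rootChar_add_of_dvd hT _ (Dvd.dvd.mul_left hab _)]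

/-- Both covariances of a pairing resonate for the same `n`, and the square of an indicator is the
indicator. The densities need to agree with `u` and `v` only where the indicator is one, so that
frequencies may be replaced by congruent ones. -/
lemma FreqBounds.norm_mul_sub_le (h : FreqBounds P X F C) {T : ℕ} (hT : 1 ≤ T)
    {a b c d : ℤ} {n : ℤ} (h1 : dvdInd T (a + b) = dvdInd T n) (h2 : dvdInd T (c + d) = dvdInd T n)
    {u v : ℂ} (hu : dvdInd T n * spectralDensity P X (freq T b) = dvdInd T n * u)
    (hv : dvdInd T n * spectralDensity P X (freq T d) = dvdInd T n * v)
    (hun : ‖u‖ ≤ F) (hvn : ‖v‖ ≤ F) :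
    ‖dftCov P X T a b * dftCov P X T c d - dvdInd T n * (u * v)‖ ≤
      2 * F * (C / T) * dvdInd T n + C ^ 2 / T ^ 2 := by
  have hT' : (0 : ℝ) < T := by exact_mod_cast hT
  have i1 := h.cov T hT a b
  have i2 := h.cov T hT c d
  rw [h1, hu] at i1
  rw [h2, hv] at i2
  have hd := dvdInd_nonneg T n
  have hdd : (dvdInd T n : ℂ) * dvdInd T n = dvdInd T n := by
    unfold dvdInd; split_ifs <;> simp
  have hdn : ‖(dvdInd T n : ℂ)‖ = dvdInd T n := by
    rw [Complex.norm_real, Real.norm_eq_abs, abs_of_nonneg hd]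
  set x := dftCov P X T a b
  set y := dftCov P X T c d
  set δ : ℂ := (dvdInd T n : ℂ)
  have e : x * y - δ * (u * v) = (x - δ * u) * (y - δ * v) + δ * u * (y - δ * v) +
      (x - δ * u) * (δ * v) := by
    linear_combination (u * v) * hdd
  rw [e]
  refine norm_add₃_le.trans ?_
  rw [norm_mul, norm_mul, norm_mul, norm_mul, norm_mul, hdn]
  have hC := h.C_nonneg
  have hF := h.F_nonneg
  have j1 : ‖x - δ * u‖ * ‖y - δ * v‖ ≤ C / T * (C / T) :=
    mul_le_mul i1 i2 (norm_nonneg _) (by positivity)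
  have j2 : dvdInd T n * ‖u‖ * ‖y - δ * v‖ ≤ dvdInd T n * F * (C / T) :=
    mul_le_mul (mul_le_mul_of_nonneg_left hun hd) i2 (norm_nonneg _) (by positivity)
  have j3 : ‖x - δ * u‖ * (dvdInd T n * ‖v‖) ≤ C / T * (dvdInd T n * F) :=
    mul_le_mul i1 (mul_le_mul_of_nonneg_left hvn hd) (by positivity) (by positivity)
  have e2 : C ^ 2 / (T : ℝ) ^ 2 = C / T * (C / T) := by ring
  rw [e2]
  linarith

/-- The pairing of `l + r` with `-l` and of `k` with `-(k + r)` is never resonant as `T` does not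
divide `r`; the other two are the Gaussian terms. Taking `l + r` as the base frequency of the
cumulant leaves `k, -(k + r), -l` as arguments, which near `r = 0` are those of `f₄` in the limit.
-/
lemma FreqBounds.norm_dftFour_sub_mainFour_le (h : FreqBounds P X F C) [IsProbabilityMeasure P]
    (hX : StationaryCumulantCondition P X 8)
    (hmean : ∀ t : ℤ, ∫ x, X t x ∂P = 0) {T : ℕ} (hT : 1 ≤ T) {r : ℤ} (hr : ¬ (T : ℤ) ∣ r)
    (k l : ℤ) :
    ‖dftFour P X T (l + r) k (-(k + r)) (-l) - mainFour P X T r k l‖ ≤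
      2 * F * (C / T) * dvdInd T (k - l) + 2 * F * (C / T) * dvdInd T (k + r + l) +
        (3 * C ^ 2 + C) / T ^ 2 := by
  have hT' : (0 : ℝ) < T := by exact_mod_cast hT
  have hneg : ∀ n, dvdInd T (-n) = dvdInd T n := fun n => by simp [dvdInd]
  have i1 := h.norm_mul_sub_le hT (a := l + r) (b := k) (c := -(k + r)) (d := -l)
    (n := k + r + l) (u := spectralDensity P X (freq T k))
    (v := spectralDensity P X (freq T (k + r))) (by congr 1; ring)
    (by rw [← hneg]; congr 1; ring) rfl (by
      by_cases hd : (T : ℤ) ∣ k + r + l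
      · rw [spectralDensity_freq_congr hX hmean hT (a := -l) (b := k + r)
          (by rwa [sub_neg_eq_add])]
      · simp [dvdInd, hd]) (h.spectral _) (h.spectral _)
  have i2 := h.norm_mul_sub_le hT (a := -(k + r)) (b := l + r) (c := -l) (d := k)
    (n := k - l) (u := spectralDensity P X (freq T (k + r)))
    (v := spectralDensity P X (freq T k)) (by rw [← hneg]; congr 1; ring)
    (by congr 1; ring) (by
      by_cases hd : (T : ℤ) ∣ k - l
      · rw [spectralDensity_freq_congr hX hmean hT (a := l + r) (b := k + r)
          (by rwa [add_sub_add_right_eq_sub])]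
      · simp [dvdInd, hd]) rfl (h.spectral _) (h.spectral _)
  have i3 : ‖dftCov P X T (l + r) (-l) * dftCov P X T k (-(k + r))‖ ≤ C / T * (C / T) := by
    rw [norm_mul]
    have j1 := h.norm_dftCov_le hT (l + r) (-l)
    have j2 := h.norm_dftCov_le hT k (-(k + r))
    rw [dvdInd, if_neg (by rw [show l + r + -l = r by ring]; exact hr), mul_zero, zero_add] at j1
    rw [dvdInd, if_neg (by rw [show k + -(k + r) = -r by ring, dvd_neg]; exact hr), mul_zero,
      zero_add] at j2
    exact mul_le_mul j1 j2 (norm_nonneg _) (div_nonneg h.C_nonneg hT'.le)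
  have i4 := h.cum T hT (l + r) k (-(k + r)) (-l)
  have hz : l + r + (k + -(k + r) + -l) = 0 := by ring
  have hf : ∀ n, freq T (-n) = -freq T n := fun n => by simp only [freq]; push_cast; ring
  have h0 : dvdInd T 0 = 1 := by simp [dvdInd]
  rw [hz, h0, hf, hf, Complex.ofReal_one, one_mul] at i4
  rw [dftFour_eq hX hmean, mainFour, dftCov_comm (P := P) (X := X) T (l + r) (-(k + r)),
    dftCov_comm (P := P) (X := X) T k (-l)]
  have e : ∀ p q s c m1 m2 m3 : ℂ, p + q + s + c - (m2 + m1 + m3) =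
      (p - m1) + (q - m2) + s + (c - m3) := by intros; ring
  rw [e]
  refine (norm_add_le _ _).trans ((add_le_add norm_add₃_le i4).trans ?_)
  rw [mul_comm (spectralDensity P X (freq T (k + r)))] at i2
  have e2 : (3 * C ^ 2 + C) / (T : ℝ) ^ 2 = C ^ 2 / T ^ 2 + C ^ 2 / T ^ 2 + C / T * (C / T) +
      C / T ^ 2 := by ring
  rw [e2]
  linarith

variable (P X) in
/-- The leading term of `T E|A_T(φ; r)|²`. -/
noncomputable def mainVariance (φ : ℝ → ℂ) (T : ℕ) (r : ℤ) : ℂ :=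
  (1 / (T : ℂ)) * ∑ k ∈ Finset.Icc (1 : ℤ) T, ∑ l ∈ Finset.Icc (1 : ℤ) T,
    φ (freq T k) * (starRingEnd ℂ) (φ (freq T l)) * mainFour P X T r k l

theorem norm_integral_orthSample_sq_sub_le [IsProbabilityMeasure P]
    (hX : StationaryCumulantCondition P X 8)
    (hmean : ∀ t : ℤ, ∫ x, X t x ∂P = 0) (h : FreqBounds P X F C) (hφ : LipWeight φ B Λ)
    {T : ℕ} (hT : 1 ≤ T) {r : ℤ} (hr : ¬ (T : ℤ) ∣ r) :
    ‖T * ∫ x, orthSample X φ T r x * (starRingEnd ℂ) (orthSample X φ T r x) ∂P -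
      mainVariance P X φ T r‖ ≤ B ^ 2 * (4 * F * C + (3 * C ^ 2 + C)) / T := by
  have hT' : (0 : ℝ) < T := by exact_mod_cast hT
  have hTc : (T : ℂ) ≠ 0 := by exact_mod_cast hT'.ne'
  have hB := hφ.bound_nonneg
  have hC := h.C_nonneg
  have hF := h.F_nonneg
  have hE : ∫ x, orthSample X φ T r x * (starRingEnd ℂ) (orthSample X φ T r x) ∂P =
      ∑ k ∈ Finset.Icc (1 : ℤ) T, ∑ l ∈ Finset.Icc (1 : ℤ) T,
        (1 / (T : ℂ) * φ (freq T k)) * (1 / (T : ℂ) * (starRingEnd ℂ) (φ (freq T l))) *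
          dftFour P X T (l + r) k (-(k + r)) (-l) := by
    have e := congrFun (conj_orthSample_eq_sum (X := X) φ T r)
    simp only [e]
    rw [orthSample_eq_sum, integral_sum_mul_sum hX]
    refine Finset.sum_congr rfl fun k _ => Finset.sum_congr rfl fun l _ => ?_
    congr 1
    simp only [dftFour]
    congr 1; ext x; ring
  rw [hE, mainVariance, Finset.mul_sum, Finset.mul_sum, ← Finset.sum_sub_distrib]
  have hrow : ∀ k ∈ Finset.Icc (1 : ℤ) T, ‖(T : ℂ) * (∑ l ∈ Finset.Icc (1 : ℤ) T,
        (1 / (T : ℂ) * φ (freq T k)) * (1 / (T : ℂ) * (starRingEnd ℂ) (φ (freq T l))) *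
          dftFour P X T (l + r) k (-(k + r)) (-l)) - 1 / (T : ℂ) * ∑ l ∈ Finset.Icc (1 : ℤ) T,
        φ (freq T k) * (starRingEnd ℂ) (φ (freq T l)) * mainFour P X T r k l‖ ≤
      B ^ 2 / T * ((4 * F * C + (3 * C ^ 2 + C)) / T) := by
    intro k hk
    rw [Finset.mul_sum, Finset.mul_sum, ← Finset.sum_sub_distrib]
    have hterm : ∀ l ∈ Finset.Icc (1 : ℤ) T, ‖(T : ℂ) *
        ((1 / (T : ℂ) * φ (freq T k)) * (1 / (T : ℂ) * (starRingEnd ℂ) (φ (freq T l))) *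
          dftFour P X T (l + r) k (-(k + r)) (-l)) - 1 / (T : ℂ) *
        (φ (freq T k) * (starRingEnd ℂ) (φ (freq T l)) * mainFour P X T r k l)‖ ≤
        B ^ 2 / T * (2 * F * (C / T) * dvdInd T (k - l) +
          2 * F * (C / T) * dvdInd T (l + (k + r)) + (3 * C ^ 2 + C) / T ^ 2) := by
      intro l hl
      have e : (T : ℂ) *
        ((1 / (T : ℂ) * φ (freq T k)) * (1 / (T : ℂ) * (starRingEnd ℂ) (φ (freq T l))) *
          dftFour P X T (l + r) k (-(k + r)) (-l)) - 1 / (T : ℂ) *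
        (φ (freq T k) * (starRingEnd ℂ) (φ (freq T l)) * mainFour P X T r k l) =
        (1 / (T : ℂ) * (φ (freq T k) * (starRingEnd ℂ) (φ (freq T l)))) *
          (dftFour P X T (l + r) k (-(k + r)) (-l) - mainFour P X T r k l) := by
        field_simp
      rw [e, norm_mul]
      refine mul_le_mul ?_ ?_ (norm_nonneg _) (by positivity)
      · rw [norm_mul, norm_mul, RCLike.norm_conj, norm_div, norm_one, Complex.norm_natCast,
          div_mul_eq_mul_div, one_mul, sq]
        exact div_le_div_of_nonneg_right (mul_le_mul (hφ.bound _ (freq_mem hk))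
          (hφ.bound _ (freq_mem hl)) (norm_nonneg _) hB) hT'.le
      · have := h.norm_dftFour_sub_mainFour_le hX hmean hT hr k l
        rwa [add_comm (k + r) l] at this
    refine (norm_sum_le _ _).trans ((Finset.sum_le_sum hterm).trans (le_of_eq ?_))
    rw [← Finset.mul_sum, Finset.sum_add_distrib, Finset.sum_add_distrib, ← Finset.mul_sum,
      ← Finset.mul_sum, sum_dvdInd_sub hT, sum_dvdInd_add hT,
      Finset.sum_const, Int.card_Icc, nsmul_eq_mul]
    simp only [add_sub_cancel_right, Int.toNat_natCast]
    field_simp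
    ring
  refine (norm_sum_le _ _).trans ((Finset.sum_le_sum hrow).trans (le_of_eq ?_))
  rw [Finset.sum_const, Int.card_Icc, nsmul_eq_mul]
  simp only [add_sub_cancel_right, Int.toNat_natCast]
  field_simp

end OrthMoments

/-! ### Lipschitz weights and the error of Riemann sums -/

section LipWeights

variable {φ ψ : ℝ → ℂ} {B Λ B' Λ' : ℝ}

lemma LipWeight.mul (h : LipWeight φ B Λ) (h' : LipWeight ψ B' Λ') :
    LipWeight (fun ω => φ ω * ψ ω) (B * B') (B * Λ' + Λ * B') where
  bound ω hω := by
    rw [norm_mul]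
    exact mul_le_mul (h.bound ω hω) (h'.bound ω hω) (norm_nonneg _) h.bound_nonneg
  lip ω hω ω' hω' := by
    have e : φ ω * ψ ω - φ ω' * ψ ω' = φ ω * (ψ ω - ψ ω') + (φ ω - φ ω') * ψ ω' := by ring
    rw [e]
    refine (norm_add_le _ _).trans ?_
    rw [norm_mul, norm_mul, add_mul]
    refine add_le_add ?_ ?_
    · rw [mul_assoc]
      exact mul_le_mul (h.bound ω hω) (h'.lip ω hω ω' hω') (norm_nonneg _) h.bound_nonneg
    · rw [mul_right_comm]
      exact mul_le_mul (h.lip ω hω ω' hω') (h'.bound ω' hω') (norm_nonneg _)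
        (mul_nonneg h.lip_nonneg (abs_nonneg _))
  bound_nonneg := mul_nonneg h.bound_nonneg h'.bound_nonneg
  lip_nonneg := add_nonneg (mul_nonneg h.bound_nonneg h'.lip_nonneg)
    (mul_nonneg h.lip_nonneg h'.bound_nonneg)

lemma LipWeight.add (h : LipWeight φ B Λ) (h' : LipWeight ψ B' Λ') :
    LipWeight (fun ω => φ ω + ψ ω) (B + B') (Λ + Λ') where
  bound ω hω := (norm_add_le _ _).trans (add_le_add (h.bound ω hω) (h'.bound ω hω))
  lip ω hω ω' hω' := by
    rw [add_sub_add_comm, add_mul]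
    exact (norm_add_le _ _).trans (add_le_add (h.lip ω hω ω' hω') (h'.lip ω hω ω' hω'))
  bound_nonneg := add_nonneg h.bound_nonneg h'.bound_nonneg
  lip_nonneg := add_nonneg h.lip_nonneg h'.lip_nonneg

lemma LipWeight.conj (h : LipWeight φ B Λ) :
    LipWeight (fun ω => (starRingEnd ℂ) (φ ω)) B Λ where
  bound ω hω := by rw [RCLike.norm_conj]; exact h.bound ω hω
  lip ω hω ω' hω' := by rw [← map_sub, RCLike.norm_conj]; exact h.lip ω hω ω' hω'
  bound_nonneg := h.bound_nonneg
  lip_nonneg := h.lip_nonneg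

lemma reflect_mem {ω : ℝ} (hω : ω ∈ Set.Icc 0 (2 * Real.pi)) :
    2 * Real.pi - ω ∈ Set.Icc 0 (2 * Real.pi) := ⟨by linarith [hω.2], by linarith [hω.1]⟩

lemma LipWeight.reflect (h : LipWeight φ B Λ) :
    LipWeight (fun ω => φ (2 * Real.pi - ω)) B Λ where
  bound ω hω := h.bound _ (reflect_mem hω)
  lip ω hω ω' hω' := by
    refine (h.lip _ (reflect_mem hω) _ (reflect_mem hω')).trans (le_of_eq ?_)
    rw [sub_sub_sub_cancel_left, abs_sub_comm]
  bound_nonneg := h.bound_nonneg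
  lip_nonneg := h.lip_nonneg

lemma LipWeight.continuousOn (h : LipWeight φ B Λ) : ContinuousOn φ (Set.Icc 0 (2 * Real.pi)) := by
  have : LipschitzOnWith ⟨Λ, h.lip_nonneg⟩ φ (Set.Icc 0 (2 * Real.pi)) :=
    LipschitzOnWith.of_dist_le_mul fun ω hω ω' hω' => by
      rw [dist_eq_norm, Real.dist_eq]; exact h.lip ω hω ω' hω'
  exact this.continuousOn

lemma LipWeight.intervalIntegrable (h : LipWeight φ B Λ) {a b : ℝ}
    (ha : a ∈ Set.Icc 0 (2 * Real.pi)) (hb : b ∈ Set.Icc 0 (2 * Real.pi)) :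
    IntervalIntegrable φ volume a b :=
  (h.continuousOn.mono (Set.uIcc_subset_Icc ha hb)).intervalIntegrable

/-- The error of a Riemann sum over the Fourier frequencies. -/
theorem LipWeight.norm_riemann_sub_le (h : LipWeight φ B Λ) {T : ℕ} (hT : 1 ≤ T) :
    ‖(2 * Real.pi / T : ℂ) * ∑ k ∈ Finset.Icc (1 : ℤ) T, φ (freq T k) -
      ∫ ω in (0 : ℝ)..(2 * Real.pi), φ ω‖ ≤ Λ * (2 * Real.pi) ^ 2 / T := by
  have hT' : (0 : ℝ) < T := by exact_mod_cast hT
  have hpi := Real.pi_pos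
  have hmem : ∀ k : ℕ, k ≤ T → freq T (k : ℤ) ∈ Set.Icc 0 (2 * Real.pi) := by
    intro k hk
    have hk' : (k : ℝ) ≤ T := by exact_mod_cast hk
    constructor
    · unfold freq; positivity
    · unfold freq
      rw [div_le_iff₀ hT']
      push_cast
      gcongr
  have hstep : ∀ k : ℕ, freq T ((k : ℤ) + 1) - freq T (k : ℤ) = 2 * Real.pi / T := by
    intro k; simp only [freq]; push_cast; ring
  have hadj := intervalIntegral.sum_integral_adjacent_intervals (μ := volume) (f := φ)
    (a := fun k : ℕ => freq T (k : ℤ)) (n := T)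
    (fun k hk => h.intervalIntegrable (hmem k hk.le) (hmem (k + 1) hk))
  have h0 : freq T ((0 : ℕ) : ℤ) = 0 := by simp [freq]
  have h1 : freq T ((T : ℕ) : ℤ) = 2 * Real.pi := by
    simp only [freq]; push_cast; field_simp
  rw [h0, h1] at hadj
  rw [← hadj, sum_Icc_eq_sum_range, Finset.mul_sum, ← Finset.sum_sub_distrib]
  have hterm : ∀ k ∈ Finset.range T, ‖(2 * Real.pi / T : ℂ) * φ (freq T ((k : ℤ) + 1)) -
      ∫ ω in (freq T (k : ℤ))..(freq T ((k + 1 : ℕ) : ℤ)), φ ω‖ ≤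
        Λ * (2 * Real.pi / T) * (2 * Real.pi / T) := by
    intro k hk
    have hk' := Finset.mem_range.1 hk
    have hm1 := hmem k hk'.le
    have hm2 := hmem (k + 1) hk'
    push_cast at hm2 ⊢
    have hconst : (2 * Real.pi / T : ℂ) * φ (freq T ((k : ℤ) + 1)) =
        ∫ ω in (freq T (k : ℤ))..(freq T ((k : ℤ) + 1)), φ (freq T ((k : ℤ) + 1)) := by
      rw [intervalIntegral.integral_const, hstep, Complex.real_smul]
      push_cast; rfl
    rw [hconst, ← intervalIntegral.integral_sub intervalIntegrable_const
      (h.intervalIntegrable hm1 hm2)]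
    have hle : freq T (k : ℤ) ≤ freq T ((k : ℤ) + 1) := by
      have := hstep k
      have h2 : 0 < 2 * Real.pi / T := by positivity
      linarith
    have := intervalIntegral.norm_integral_le_of_norm_le_const (C := Λ * (2 * Real.pi / T))
      (f := fun ω => φ (freq T ((k : ℤ) + 1)) - φ ω) (a := freq T (k : ℤ))
      (b := freq T ((k : ℤ) + 1)) (fun ω hω => by
        rw [Set.uIoc_of_le hle] at hω
        have hωm : ω ∈ Set.Icc 0 (2 * Real.pi) := ⟨hm1.1.trans hω.1.le, hω.2.trans hm2.2⟩
        refine (h.lip _ hm2 _ hωm).trans (mul_le_mul_of_nonneg_left ?_ h.lip_nonneg)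
        rw [abs_of_nonneg (by linarith [hω.2]), ← hstep k]
        linarith [hω.1])
    rwa [hstep, abs_of_pos (by positivity)] at this
  refine (norm_sum_le _ _).trans ((Finset.sum_le_sum hterm).trans (le_of_eq ?_))
  rw [Finset.sum_const, Finset.card_range, nsmul_eq_mul]
  field_simp

/-- The error of a double Riemann sum. -/
theorem norm_double_riemann_sub_le {G : ℝ → ℝ → ℂ} {B Λ : ℝ}
    (h1 : ∀ x ∈ Set.Icc 0 (2 * Real.pi), LipWeight (fun y => G x y) B Λ)
    (h2 : ∀ y ∈ Set.Icc 0 (2 * Real.pi), LipWeight (fun x => G x y) B Λ) {T : ℕ} (hT : 1 ≤ T) :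
    ‖(2 * Real.pi / T : ℂ) ^ 2 * ∑ k ∈ Finset.Icc (1 : ℤ) T, ∑ l ∈ Finset.Icc (1 : ℤ) T,
        G (freq T k) (freq T l) -
      ∫ x in (0 : ℝ)..(2 * Real.pi), ∫ y in (0 : ℝ)..(2 * Real.pi), G x y‖ ≤
        2 * Λ * (2 * Real.pi) ^ 3 / T := by
  have hT' : (0 : ℝ) < T := by exact_mod_cast hT
  have hpi := Real.pi_pos
  have hz : (0 : ℝ) ∈ Set.Icc 0 (2 * Real.pi) := ⟨le_rfl, by positivity⟩
  have hz' : (2 * Real.pi) ∈ Set.Icc 0 (2 * Real.pi) := ⟨by positivity, le_rfl⟩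
  have hB := (h1 0 hz).bound_nonneg
  have hΛ := (h1 0 hz).lip_nonneg
  set H : ℝ → ℂ := fun x => ∫ y in (0 : ℝ)..(2 * Real.pi), G x y with hH
  -- Integrating out one variable preserves the Lipschitz bound in the other, so the double sum
  -- reduces to two applications of the one-dimensional estimate.
  have hHw : LipWeight H (B * (2 * Real.pi)) (Λ * (2 * Real.pi)) := by
    refine ⟨fun x hx => ?_, fun x hx x' hx' => ?_, by positivity, by positivity⟩
    · have := intervalIntegral.norm_integral_le_of_norm_le_const (C := B)
        (f := fun y => G x y) (a := 0) (b := 2 * Real.pi) (fun y hy => by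
          rw [Set.uIoc_of_le (by positivity)] at hy
          exact (h1 x hx).bound y ⟨hy.1.le, hy.2⟩)
      rwa [sub_zero, abs_of_pos (by positivity)] at this
    · rw [hH]
      simp only
      rw [← intervalIntegral.integral_sub ((h1 x hx).intervalIntegrable hz hz')
        ((h1 x' hx').intervalIntegrable hz hz')]
      have := intervalIntegral.norm_integral_le_of_norm_le_const (C := Λ * |x - x'|)
        (f := fun y => G x y - G x' y) (a := 0) (b := 2 * Real.pi) (fun y hy => by
          rw [Set.uIoc_of_le (by positivity)] at hy
          exact (h2 y ⟨hy.1.le, hy.2⟩).lip x hx x' hx')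
      rw [sub_zero, abs_of_pos (by positivity : (0 : ℝ) < 2 * Real.pi)] at this
      refine this.trans (le_of_eq (by ring))
  have hout := hHw.norm_riemann_sub_le hT
  have hin : ‖(2 * Real.pi / T : ℂ) ^ 2 * ∑ k ∈ Finset.Icc (1 : ℤ) T,
      ∑ l ∈ Finset.Icc (1 : ℤ) T, G (freq T k) (freq T l) -
      (2 * Real.pi / T : ℂ) * ∑ k ∈ Finset.Icc (1 : ℤ) T, H (freq T k)‖ ≤
        Λ * (2 * Real.pi) ^ 3 / T := by
    rw [sq, mul_assoc, ← mul_sub, Finset.mul_sum, ← Finset.sum_sub_distrib, norm_mul]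
    have hn : ‖(2 * Real.pi / T : ℂ)‖ = 2 * Real.pi / T := by
      rw [norm_div, norm_mul, Complex.norm_natCast, Complex.norm_real, Real.norm_eq_abs,
        abs_of_pos hpi, Complex.norm_ofNat]
    rw [hn]
    have : ‖∑ k ∈ Finset.Icc (1 : ℤ) T, ((2 * Real.pi / T : ℂ) * ∑ l ∈ Finset.Icc (1 : ℤ) T,
        G (freq T k) (freq T l) - H (freq T k))‖ ≤ Λ * (2 * Real.pi) ^ 2 := by
      refine (norm_sum_le _ _).trans ((Finset.sum_le_sum fun k hk =>
        (h1 _ (freq_mem hk)).norm_riemann_sub_le hT).trans (le_of_eq ?_))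
      rw [Finset.sum_const, Int.card_Icc, nsmul_eq_mul]
      simp only [add_sub_cancel_right, Int.toNat_natCast]
      field_simp
    refine (mul_le_mul_of_nonneg_left this (by positivity)).trans (le_of_eq (by ring))
  refine (norm_sub_le_norm_sub_add_norm_sub _
    ((2 * Real.pi / T : ℂ) * ∑ k ∈ Finset.Icc (1 : ℤ) T, H (freq T k)) _).trans
    ((add_le_add hin hout).trans (le_of_eq (by ring)))

end LipWeights

/-! ### Convergence of the second moment to the limiting variance -/

section Limit

variable {Ω : Type*} [MeasurableSpace Ω] {P : Measure Ω} {X : ℤ → Ω → ℝ} {φ : ℝ → ℂ}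
  {B Λ F C : ℝ}

variable (P X) in
/-- The integrand of the single integral in the limiting variance. -/
noncomputable def limitSingle (φ : ℝ → ℂ) (ω : ℝ) : ℂ :=
  spectralDensity P X ω ^ 2 *
    ((‖φ ω‖ : ℂ) ^ 2 + φ ω * (starRingEnd ℂ) (φ (2 * Real.pi - ω)))

variable (P X) in
/-- The integrand of the double integral in the limiting variance. -/
noncomputable def limitDouble (φ : ℝ → ℂ) (ω₁ ω₂ : ℝ) : ℂ :=
  φ ω₁ * (starRingEnd ℂ) (φ ω₂) * higherSpectralDensity P X ![ω₁, -ω₁, -ω₂]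

lemma FreqBounds.lipWeight_spectralDensity (h : FreqBounds P X F C) :
    LipWeight (spectralDensity P X) F F :=
  ⟨fun ω _ => h.spectral ω, fun ω _ ω' _ => h.spectral_lip ω ω', h.F_nonneg, h.F_nonneg⟩

lemma FreqBounds.exists_lipWeight_limitSingle (h : FreqBounds P X F C) (hφ : LipWeight φ B Λ) :
    ∃ B' Λ', LipWeight (limitSingle P X φ) B' Λ' := by
  have hf := h.lipWeight_spectralDensity
  have := (hf.mul hf).mul ((hφ.mul hφ.conj).add (hφ.mul hφ.reflect.conj))
  have e : limitSingle P X φ = fun ω => spectralDensity P X ω * spectralDensity P X ω *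
      (φ ω * (starRingEnd ℂ) (φ ω) + φ ω * (starRingEnd ℂ) (φ (2 * Real.pi - ω))) := by
    ext ω
    simp only [limitSingle]
    rw [← Complex.mul_conj', sq]
  rw [e]
  exact ⟨_, _, this⟩

lemma FreqBounds.exists_lipWeight_limitDouble (h : FreqBounds P X F C) (hφ : LipWeight φ B Λ) :
    ∃ B' Λ', (∀ x ∈ Set.Icc 0 (2 * Real.pi), LipWeight (fun y => limitDouble P X φ x y) B' Λ') ∧
      ∀ y ∈ Set.Icc 0 (2 * Real.pi), LipWeight (fun x => limitDouble P X φ x y) B' Λ' := by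
  have hB := hφ.bound_nonneg
  have hΛ := hφ.lip_nonneg
  have hF := h.F_nonneg
  have hb : ∀ x ∈ Set.Icc 0 (2 * Real.pi), ∀ y ∈ Set.Icc 0 (2 * Real.pi),
      ‖limitDouble P X φ x y‖ ≤ B * B * F := by
    intro x hx y hy
    rw [limitDouble, norm_mul, norm_mul, RCLike.norm_conj]
    exact mul_le_mul (mul_le_mul (hφ.bound x hx) (hφ.bound y hy) (norm_nonneg _) hB)
      (h.fourth _) (norm_nonneg _) (mul_nonneg hB hB)
  refine ⟨B * B * F, B * B * (2 * F) + B * Λ * F,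
    fun x hx => ⟨fun y hy => hb x hx y hy, ?_, by positivity, by positivity⟩,
    fun y hy => ⟨fun x hx => hb x hx y hy, ?_, by positivity, by positivity⟩⟩
  · intro y hy y' hy'
    have e : limitDouble P X φ x y - limitDouble P X φ x y' =
        φ x * (starRingEnd ℂ) (φ y) * (higherSpectralDensity P X ![x, -x, -y] -
          higherSpectralDensity P X ![x, -x, -y']) +
        φ x * (starRingEnd ℂ) (φ y - φ y') * higherSpectralDensity P X ![x, -x, -y'] := by
      simp only [limitDouble, map_sub]; ring
    have hl := h.fourth_lip ![x, -x, -y] ![x, -x, -y']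
    simp only [Fin.sum_univ_three, Matrix.cons_val, sub_self, abs_zero, zero_add] at hl
    rw [neg_sub_neg, abs_sub_comm] at hl
    rw [e]
    refine (norm_add_le _ _).trans ?_
    simp only [norm_mul, RCLike.norm_conj]
    have i1 : ‖φ x‖ * ‖φ y‖ * ‖higherSpectralDensity P X ![x, -x, -y] -
        higherSpectralDensity P X ![x, -x, -y']‖ ≤ B * B * (F * |y - y'|) :=
      mul_le_mul (mul_le_mul (hφ.bound x hx) (hφ.bound y hy) (norm_nonneg _) hB) hl
        (norm_nonneg _) (by positivity)
    have i2 : ‖φ x‖ * ‖φ y - φ y'‖ * ‖higherSpectralDensity P X ![x, -x, -y']‖ ≤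
        B * (Λ * |y - y'|) * F :=
      mul_le_mul (mul_le_mul (hφ.bound x hx) (hφ.lip y hy y' hy') (norm_nonneg _) hB)
        (h.fourth _) (norm_nonneg _) (by positivity)
    have i3 : 0 ≤ B * B * (F * |y - y'|) := by positivity
    linarith
  · intro x hx x' hx'
    have e : limitDouble P X φ x y - limitDouble P X φ x' y =
        φ x * (starRingEnd ℂ) (φ y) * (higherSpectralDensity P X ![x, -x, -y] -
          higherSpectralDensity P X ![x', -x', -y]) +
        (φ x - φ x') * (starRingEnd ℂ) (φ y) * higherSpectralDensity P X ![x', -x', -y] := by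
      simp only [limitDouble]; ring
    have hl := h.fourth_lip ![x, -x, -y] ![x', -x', -y]
    simp only [Fin.sum_univ_three, Matrix.cons_val, sub_self, abs_zero, add_zero] at hl
    rw [neg_sub_neg, abs_sub_comm x' x] at hl
    rw [e]
    refine (norm_add_le _ _).trans ?_
    simp only [norm_mul, RCLike.norm_conj]
    have i1 : ‖φ x‖ * ‖φ y‖ * ‖higherSpectralDensity P X ![x, -x, -y] -
        higherSpectralDensity P X ![x', -x', -y]‖ ≤ B * B * (F * (|x - x'| + |x - x'|)) :=
      mul_le_mul (mul_le_mul (hφ.bound x hx) (hφ.bound y hy) (norm_nonneg _) hB) hl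
        (norm_nonneg _) (by positivity)
    have i2 : ‖φ x - φ x'‖ * ‖φ y‖ * ‖higherSpectralDensity P X ![x', -x', -y]‖ ≤
        Λ * |x - x'| * B * F :=
      mul_le_mul (mul_le_mul (hφ.lip x hx x' hx') (hφ.bound y hy) (norm_nonneg _) (by positivity))
        (h.fourth _) (norm_nonneg _) (by positivity)
    linarith

variable (P X) in
/-- The Riemann sum of the limiting variance. -/
noncomputable def riemannVariance (φ : ℝ → ℂ) (T : ℕ) : ℂ :=
  (1 / (T : ℂ)) * ∑ k ∈ Finset.Icc (1 : ℤ) T, (limitSingle P X φ (freq T k) +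
    (2 * Real.pi / T : ℂ) * ∑ l ∈ Finset.Icc (1 : ℤ) T, limitDouble P X φ (freq T k) (freq T l))

theorem FreqBounds.exists_norm_riemannVariance_sub_le (h : FreqBounds P X F C)
    (hφ : LipWeight φ B Λ) : ∃ D : ℝ, 0 ≤ D ∧ ∀ T : ℕ, 1 ≤ T →
      ‖riemannVariance P X φ T - limitVariance P X φ‖ ≤ D / T := by
  obtain ⟨B1, Λ1, h1⟩ := h.exists_lipWeight_limitSingle hφ
  obtain ⟨B2, Λ2, h2, h2'⟩ := h.exists_lipWeight_limitDouble hφ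
  have hpi := Real.pi_gt_three
  have hΛ1 := h1.lip_nonneg
  have hΛ2 := (h2 0 ⟨le_rfl, by positivity⟩).lip_nonneg
  refine ⟨Λ1 * (2 * Real.pi) ^ 2 + 2 * Λ2 * (2 * Real.pi) ^ 3, by positivity, fun T hT => ?_⟩
  have hT' : (0 : ℝ) < T := by exact_mod_cast hT
  have hTc : (T : ℂ) ≠ 0 := by exact_mod_cast hT'.ne'
  have hpc : (Real.pi : ℂ) ≠ 0 := by exact_mod_cast Real.pi_ne_zero
  have i1 := h1.norm_riemann_sub_le hT
  have i2 := norm_double_riemann_sub_le h2 h2' hT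
  have e : riemannVariance P X φ T - limitVariance P X φ =
      (1 / (2 * Real.pi) : ℂ) * ((2 * Real.pi / T : ℂ) *
        ∑ k ∈ Finset.Icc (1 : ℤ) T, limitSingle P X φ (freq T k) -
        ∫ ω in (0 : ℝ)..(2 * Real.pi), limitSingle P X φ ω) +
      (1 / (2 * Real.pi) : ℂ) * ((2 * Real.pi / T : ℂ) ^ 2 * ∑ k ∈ Finset.Icc (1 : ℤ) T,
        ∑ l ∈ Finset.Icc (1 : ℤ) T, limitDouble P X φ (freq T k) (freq T l) -
        ∫ x in (0 : ℝ)..(2 * Real.pi), ∫ y in (0 : ℝ)..(2 * Real.pi), limitDouble P X φ x y) := by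
    simp only [riemannVariance, limitVariance, limitSingle, limitDouble]
    rw [Finset.sum_add_distrib, ← Finset.mul_sum]
    field_simp
    ring
  rw [e]
  have hn : ‖(1 / (2 * Real.pi) : ℂ)‖ ≤ 1 := by
    rw [norm_div, norm_one, norm_mul, Complex.norm_real, Real.norm_eq_abs,
      abs_of_pos (by linarith), Complex.norm_ofNat]
    exact div_le_one_of_le₀ (by linarith) (by linarith)
  refine (norm_add_le _ _).trans ?_
  rw [norm_mul, norm_mul, add_div]
  exact add_le_add ((mul_le_of_le_one_left (norm_nonneg _) hn).trans i1)
    ((mul_le_of_le_one_left (norm_nonneg _) hn).trans i2)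

lemma freq_add_sub (T : ℕ) (k r : ℤ) : freq T (k + r) - freq T k = 2 * Real.pi * r / T := by
  simp only [freq]; push_cast; ring

lemma sum_dvdInd_sub_mul {T : ℕ} {k : ℤ} (hk : k ∈ Finset.Icc (1 : ℤ) T) (g : ℤ → ℂ) :
    ∑ l ∈ Finset.Icc (1 : ℤ) T, (dvdInd T (k - l) : ℂ) * g l = g k := by
  rw [Finset.sum_eq_single k]
  · simp [dvdInd]
  · intro l hl hne
    rw [Finset.mem_Icc] at hk hl
    rw [dvdInd, if_neg]
    · simp
    · rintro ⟨c, hc⟩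
      have : c = 0 := by nlinarith
      subst this
      apply hne; linarith
  · intro h; exact absurd hk h

/-- The reflected index: `-(k + r)` modulo `T` has a frequency near to `2π - ω_k`. -/
lemma norm_sum_dvdInd_reflect_le (hφ : LipWeight φ B Λ) {T : ℕ} {r k : ℤ} (hr : 1 ≤ r)
    (hrT : r < T) (hk : k ∈ Finset.Icc (1 : ℤ) T) :
    ‖∑ l ∈ Finset.Icc (1 : ℤ) T, (dvdInd T (k + r + l) : ℂ) * (starRingEnd ℂ) (φ (freq T l)) -
      (starRingEnd ℂ) (φ (2 * Real.pi - freq T k))‖ ≤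
      Λ * (2 * Real.pi * r / T) + 2 * B * (if (T : ℤ) ≤ k + r then 1 else 0) := by
  have hT : 1 ≤ T := by omega
  have hT' : (0 : ℝ) < T := by exact_mod_cast hT
  have hpi := Real.pi_pos
  have hB := hφ.bound_nonneg
  have hΛ := hφ.lip_nonneg
  have hr' : (0 : ℝ) ≤ r := by exact_mod_cast (by omega : 0 ≤ r)
  have hone : ∑ l ∈ Finset.Icc (1 : ℤ) T, dvdInd T (k + r + l) = 1 := by
    rw [← sum_dvdInd_add hT (k + r)]
    exact Finset.sum_congr rfl fun l _ => by rw [add_comm]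
  have hone' : ∑ l ∈ Finset.Icc (1 : ℤ) T, (dvdInd T (k + r + l) : ℂ) = 1 := by
    exact_mod_cast congrArg (fun x : ℝ => (x : ℂ)) hone
  have e : ∑ l ∈ Finset.Icc (1 : ℤ) T, (dvdInd T (k + r + l) : ℂ) * (starRingEnd ℂ) (φ (freq T l)) -
      (starRingEnd ℂ) (φ (2 * Real.pi - freq T k)) =
      ∑ l ∈ Finset.Icc (1 : ℤ) T, (dvdInd T (k + r + l) : ℂ) *
        (starRingEnd ℂ) (φ (freq T l) - φ (2 * Real.pi - freq T k)) := by
    simp only [map_sub, mul_sub, Finset.sum_sub_distrib]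
    rw [← Finset.sum_mul, hone', one_mul]
  rw [e]
  have hterm : ∀ l ∈ Finset.Icc (1 : ℤ) T, ‖(dvdInd T (k + r + l) : ℂ) *
      (starRingEnd ℂ) (φ (freq T l) - φ (2 * Real.pi - freq T k))‖ ≤ dvdInd T (k + r + l) *
      (Λ * (2 * Real.pi * r / T) + 2 * B * (if (T : ℤ) ≤ k + r then 1 else 0)) := by
    intro l hl
    rw [norm_mul, Complex.norm_real, Real.norm_eq_abs, abs_of_nonneg (dvdInd_nonneg _ _),
      RCLike.norm_conj]
    by_cases hd : (T : ℤ) ∣ k + r + l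
    · refine mul_le_mul_of_nonneg_left ?_ (dvdInd_nonneg _ _)
      split_ifs with hc
      · have i1 := hφ.bound _ (freq_mem hl)
        have i2 := hφ.bound _ (reflect_mem (freq_mem hk))
        have i3 : 0 ≤ Λ * (2 * Real.pi * r / T) := by positivity
        refine (norm_sub_le _ _).trans ?_
        linarith
      · rw [Finset.mem_Icc] at hk hl
        -- Below the wrap-around, `0 < k + r + l < 2T`, so the only multiple of `T` available is `T`
        -- itself and `ω_l` differs from `2π - ω_k` by exactly `2πr/T`.
        have hl2 : k + r + l = T := by
          obtain ⟨c, hc'⟩ := hd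
          have h1 : 0 < c := by
            by_contra h0
            nlinarith
          have h2 : c < 2 := by
            by_contra h0
            nlinarith
          have : c = 1 := by omega
          rw [hc', this, mul_one]
        refine (hφ.lip _ (freq_mem (Finset.mem_Icc.2 hl)) _
          (reflect_mem (freq_mem (Finset.mem_Icc.2 hk)))).trans ?_
        have e2 : freq T l - (2 * Real.pi - freq T k) = -(2 * Real.pi * r / T) := by
          have hlr : (l : ℝ) = T - k - r := by
            have : l = T - k - r := by omega
            exact_mod_cast congrArg (fun z : ℤ => (z : ℝ)) this
          simp only [freq, hlr]; field_simp; ring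
        rw [e2, abs_neg, abs_of_nonneg (by positivity), mul_zero, add_zero]
    · simp [dvdInd, hd]
  refine (norm_sum_le _ _).trans ((Finset.sum_le_sum hterm).trans (le_of_eq ?_))
  rw [← Finset.sum_mul, hone, one_mul]

/-- At most `r + 1` indices wrap around, which is at most `2r` since `r ≥ 1`. -/
lemma sum_wrap_le {T : ℕ} {r : ℤ} (hr : 1 ≤ r) :
    ∑ k ∈ Finset.Icc (1 : ℤ) T, (if (T : ℤ) ≤ k + r then (1 : ℝ) else 0) ≤ 2 * r := by
  rw [← Finset.sum_filter, Finset.sum_const, nsmul_eq_mul, mul_one]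
  have hsub : (Finset.Icc (1 : ℤ) T).filter (fun k => (T : ℤ) ≤ k + r) ⊆
      Finset.Icc (T - r : ℤ) T := by
    intro k hk
    simp only [Finset.mem_filter, Finset.mem_Icc] at hk ⊢
    omega
  have h1 := Finset.card_le_card hsub
  rw [Int.card_Icc] at h1
  have h2 : ((((Finset.Icc (1 : ℤ) T).filter (fun k => (T : ℤ) ≤ k + r)).card : ℤ)) ≤ 2 * r := by
    omega
  exact_mod_cast h2

/-- Three shifts by `2πr/T` have to be undone: in the second factor of `f²`, in an argument of `f₄`,
and in the reflected argument of `φ`. Each is Lipschitz, except that the reflected frequency jumps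
across the end of the period for about `r` of the `T` indices. There a bounded error is accepted,
and averaging over `k` makes it `O(r/T)`. -/
theorem FreqBounds.exists_norm_mainVariance_sub_le (h : FreqBounds P X F C)
    (hφ : LipWeight φ B Λ) : ∃ D : ℝ, 0 ≤ D ∧ ∀ (T : ℕ) (r : ℤ), 1 ≤ r → r < T →
      ‖mainVariance P X φ T r - riemannVariance P X φ T‖ ≤ D * (r / T) := by
  have hpi := Real.pi_pos
  have hB := hφ.bound_nonneg
  have hΛ := hφ.lip_nonneg
  have hF := h.F_nonneg
  -- `D1` collects the Lipschitz errors for every `k`, and `D2` is the crude error for the indices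
  -- that wrap around.
  set D1 : ℝ := 2 * Real.pi * (2 * (B * B * F * F) + B * F * Λ * F + 2 * Real.pi * (B * B * F))
    with hD1
  set D2 : ℝ := B * F * F * (2 * B) with hD2
  have hD1n : 0 ≤ D1 := by positivity
  have hD2n : 0 ≤ D2 := by positivity
  refine ⟨D1 + 2 * D2, by positivity, fun T r hr hrT => ?_⟩
  have hT : 1 ≤ T := by omega
  have hT' : (0 : ℝ) < T := by exact_mod_cast hT
  have hr' : (0 : ℝ) ≤ r := by exact_mod_cast (by omega : 0 ≤ r)
  have hTc : (T : ℂ) ≠ 0 := by exact_mod_cast hT'.ne'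
  rw [mainVariance, riemannVariance, ← mul_sub, ← Finset.sum_sub_distrib, norm_mul, norm_div,
    norm_one, Complex.norm_natCast]
  have hrow : ∀ k ∈ Finset.Icc (1 : ℤ) T,
      ‖∑ l ∈ Finset.Icc (1 : ℤ) T, φ (freq T k) * (starRingEnd ℂ) (φ (freq T l)) *
        mainFour P X T r k l - (limitSingle P X φ (freq T k) + (2 * Real.pi / T : ℂ) *
          ∑ l ∈ Finset.Icc (1 : ℤ) T, limitDouble P X φ (freq T k) (freq T l))‖ ≤
      D1 * (r / T) + D2 * (if (T : ℤ) ≤ k + r then 1 else 0) := by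
    intro k hk
    set f0 := spectralDensity P X (freq T k) with hf0
    set f1 := spectralDensity P X (freq T (k + r)) with hf1
    set φk := φ (freq T k) with hφk
    set R := (starRingEnd ℂ) (φ (2 * Real.pi - freq T k)) with hR
    set S := ∑ l ∈ Finset.Icc (1 : ℤ) T, (dvdInd T (k + r + l) : ℂ) *
      (starRingEnd ℂ) (φ (freq T l)) with hS
    have esum : ∑ l ∈ Finset.Icc (1 : ℤ) T, φk * (starRingEnd ℂ) (φ (freq T l)) *
        mainFour P X T r k l = φk * (starRingEnd ℂ) φk * (f0 * f1) + φk * S * (f0 * f1) +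
        (2 * Real.pi / T : ℂ) * ∑ l ∈ Finset.Icc (1 : ℤ) T, φk * (starRingEnd ℂ) (φ (freq T l)) *
          higherSpectralDensity P X ![freq T k, -freq T (k + r), -freq T l] := by
      have e0 : ∀ l, φk * (starRingEnd ℂ) (φ (freq T l)) * mainFour P X T r k l =
          φk * (f0 * f1) * ((dvdInd T (k - l) : ℂ) * (starRingEnd ℂ) (φ (freq T l))) +
          φk * (f0 * f1) * ((dvdInd T (k + r + l) : ℂ) * (starRingEnd ℂ) (φ (freq T l))) +
          (2 * Real.pi / T : ℂ) * (φk * (starRingEnd ℂ) (φ (freq T l)) *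
          higherSpectralDensity P X ![freq T k, -freq T (k + r), -freq T l]) := by
        intro l; rw [mainFour]; ring
      rw [Finset.sum_congr rfl fun l _ => e0 l, Finset.sum_add_distrib, Finset.sum_add_distrib,
        ← Finset.mul_sum, ← Finset.mul_sum, ← Finset.mul_sum,
        sum_dvdInd_sub_mul hk (fun l => (starRingEnd ℂ) (φ (freq T l)))]
      ring
    have e1 : ∑ l ∈ Finset.Icc (1 : ℤ) T, φk * (starRingEnd ℂ) (φ (freq T l)) *
        mainFour P X T r k l - (limitSingle P X φ (freq T k) + (2 * Real.pi / T : ℂ) *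
          ∑ l ∈ Finset.Icc (1 : ℤ) T, limitDouble P X φ (freq T k) (freq T l)) =
        (φk * (starRingEnd ℂ) φk * f0 + φk * R * f0) * (f1 - f0) + φk * f0 * f1 * (S - R) +
        (2 * Real.pi / T : ℂ) * ∑ l ∈ Finset.Icc (1 : ℤ) T, φk * (starRingEnd ℂ) (φ (freq T l)) *
          (higherSpectralDensity P X ![freq T k, -freq T (k + r), -freq T l] -
            higherSpectralDensity P X ![freq T k, -freq T k, -freq T l]) := by
      rw [esum]
      simp only [mul_sub, Finset.sum_sub_distrib, limitSingle, limitDouble]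
      rw [← Complex.mul_conj']
      ring
    rw [e1]
    have n1 : ‖φk‖ ≤ B := hφ.bound _ (freq_mem hk)
    have n2 : ‖R‖ ≤ B := by rw [hR, RCLike.norm_conj]; exact hφ.bound _ (reflect_mem (freq_mem hk))
    have n3 : ‖f0‖ ≤ F := h.spectral _
    have n4 : ‖f1‖ ≤ F := h.spectral _
    have n5 : ‖f1 - f0‖ ≤ F * (2 * Real.pi * r / T) := by
      have := h.spectral_lip (freq T (k + r)) (freq T k)
      rwa [freq_add_sub, abs_of_nonneg (by positivity)] at this
    have n6 := norm_sum_dvdInd_reflect_le hφ hr hrT hk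
    have n7 : ‖∑ l ∈ Finset.Icc (1 : ℤ) T, φk * (starRingEnd ℂ) (φ (freq T l)) *
          (higherSpectralDensity P X ![freq T k, -freq T (k + r), -freq T l] -
            higherSpectralDensity P X ![freq T k, -freq T k, -freq T l])‖ ≤
        T * (B * B * (F * (2 * Real.pi * r / T))) := by
      have : ∀ l ∈ Finset.Icc (1 : ℤ) T, ‖φk * (starRingEnd ℂ) (φ (freq T l)) *
          (higherSpectralDensity P X ![freq T k, -freq T (k + r), -freq T l] -
            higherSpectralDensity P X ![freq T k, -freq T k, -freq T l])‖ ≤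
          B * B * (F * (2 * Real.pi * r / T)) := by
        intro l hl
        rw [norm_mul, norm_mul, RCLike.norm_conj]
        refine mul_le_mul (mul_le_mul n1 (hφ.bound _ (freq_mem hl)) (norm_nonneg _) hB) ?_
          (norm_nonneg _) (by positivity)
        have := h.fourth_lip ![freq T k, -freq T (k + r), -freq T l]
          ![freq T k, -freq T k, -freq T l]
        simp only [Fin.sum_univ_three, Matrix.cons_val, sub_self, abs_zero, add_zero,
          zero_add] at this
        rwa [neg_sub_neg, abs_sub_comm, freq_add_sub, abs_of_nonneg (by positivity)] at this
      refine (norm_sum_le _ _).trans ((Finset.sum_le_sum this).trans (le_of_eq ?_))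
      rw [Finset.sum_const, Int.card_Icc, nsmul_eq_mul]
      simp only [add_sub_cancel_right, Int.toNat_natCast]
    have hn : ‖(2 * Real.pi / T : ℂ)‖ = 2 * Real.pi / T := by
      rw [norm_div, norm_mul, Complex.norm_natCast, Complex.norm_real, Real.norm_eq_abs,
        abs_of_pos hpi, Complex.norm_ofNat]
    have m1 : ‖(φk * (starRingEnd ℂ) φk * f0 + φk * R * f0) * (f1 - f0)‖ ≤
        (B * B * F + B * B * F) * (F * (2 * Real.pi * r / T)) := by
      rw [norm_mul]
      refine mul_le_mul ((norm_add_le _ _).trans (add_le_add ?_ ?_)) n5 (norm_nonneg _)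
        (by positivity)
      · rw [norm_mul, norm_mul, RCLike.norm_conj]
        exact mul_le_mul (mul_le_mul n1 n1 (norm_nonneg _) hB) n3 (norm_nonneg _) (by positivity)
      · rw [norm_mul, norm_mul]
        exact mul_le_mul (mul_le_mul n1 n2 (norm_nonneg _) hB) n3 (norm_nonneg _) (by positivity)
    have m2 : ‖φk * f0 * f1 * (S - R)‖ ≤ B * F * F * (Λ * (2 * Real.pi * r / T) +
        2 * B * (if (T : ℤ) ≤ k + r then 1 else 0)) := by
      rw [norm_mul, norm_mul, norm_mul]
      exact mul_le_mul (mul_le_mul (mul_le_mul n1 n3 (norm_nonneg _) hB) n4 (norm_nonneg _)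
        (by positivity)) n6 (norm_nonneg _) (by positivity)
    refine norm_add₃_le.trans ?_
    rw [norm_mul (2 * Real.pi / T : ℂ), hn]
    have m3 := mul_le_mul_of_nonneg_left n7 (by positivity : (0 : ℝ) ≤ 2 * Real.pi / T)
    refine (add_le_add (add_le_add m1 m2) m3).trans (le_of_eq ?_)
    rw [hD1, hD2]
    field_simp
    ring
  have hs : ‖∑ k ∈ Finset.Icc (1 : ℤ) T,
      (∑ l ∈ Finset.Icc (1 : ℤ) T, φ (freq T k) * (starRingEnd ℂ) (φ (freq T l)) *
        mainFour P X T r k l - (limitSingle P X φ (freq T k) + (2 * Real.pi / T : ℂ) *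
          ∑ l ∈ Finset.Icc (1 : ℤ) T, limitDouble P X φ (freq T k) (freq T l)))‖ ≤
      D1 * r + D2 * (2 * r) := by
    refine (norm_sum_le _ _).trans ((Finset.sum_le_sum hrow).trans ?_)
    rw [Finset.sum_add_distrib, Finset.sum_const, Int.card_Icc, nsmul_eq_mul, ← Finset.mul_sum]
    simp only [add_sub_cancel_right, Int.toNat_natCast]
    refine add_le_add (le_of_eq (by field_simp)) (mul_le_mul_of_nonneg_left (sum_wrap_le hr) hD2n)
  refine (mul_le_mul_of_nonneg_left hs (by positivity)).trans (le_of_eq ?_)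
  field_simp

/-- The variance of `√T A_T(φ; r)` up to an error of the order `r/T`. -/
theorem exists_norm_integral_orthSample_sq_sub_limit_le [IsProbabilityMeasure P]
    (hX : StationaryCumulantCondition P X 8) (hmean : ∀ t : ℤ, ∫ x, X t x ∂P = 0)
    (hφ : LipWeight φ B Λ) : ∃ D : ℝ, 0 ≤ D ∧ ∀ (T : ℕ) (r : ℤ), 1 ≤ r → r < T →
      ‖T * ∫ x, orthSample X φ T r x * (starRingEnd ℂ) (orthSample X φ T r x) ∂P -
        limitVariance P X φ‖ ≤ D * (r / T) := by
  obtain ⟨F, C, h⟩ := exists_freqBounds hX hmean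
  obtain ⟨D1, hD1, h1⟩ := h.exists_norm_mainVariance_sub_le hφ
  obtain ⟨D2, hD2, h2⟩ := h.exists_norm_riemannVariance_sub_le hφ
  have hB := hφ.bound_nonneg
  have hC := h.C_nonneg
  have hF := h.F_nonneg
  refine ⟨B ^ 2 * (4 * F * C + (3 * C ^ 2 + C)) + D1 + D2, by positivity, fun T r hr hrT => ?_⟩
  have hT : 1 ≤ T := by omega
  have hT' : (0 : ℝ) < T := by exact_mod_cast hT
  have hr' : (1 : ℝ) ≤ r := by exact_mod_cast hr
  have hd : ¬ (T : ℤ) ∣ r := fun hd => absurd (Int.le_of_dvd (by omega) hd) (by omega)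
  have i1 := norm_integral_orthSample_sq_sub_le hX hmean h hφ hT hd
  have i2 := h1 T r hr hrT
  have i3 := h2 T hT
  -- Errors of order `1/T` are absorbed into `r/T` because `r ≥ 1`.
  have hle : ∀ D : ℝ, 0 ≤ D → D / T ≤ D * (r / T) := fun D hD => by
    rw [← mul_div_assoc]
    exact div_le_div_of_nonneg_right (le_mul_of_one_le_right hD hr') hT'.le
  refine (norm_sub_le_norm_sub_add_norm_sub _ (mainVariance P X φ T r) _).trans ?_
  have i4 := norm_sub_le_norm_sub_add_norm_sub (mainVariance P X φ T r)
    (riemannVariance P X φ T) (limitVariance P X φ)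
  have j1 := hle _ (by positivity : 0 ≤ B ^ 2 * (4 * F * C + (3 * C ^ 2 + C)))
  have j3 := hle D2 hD2
  rw [add_mul, add_mul]
  linarith

end Limit

/-! ### Expectations of products of squared norms -/

section SquaredNorms

variable {Ω : Type*} [MeasurableSpace Ω] {P : Measure Ω} {A C : Ω → ℂ}

lemma memLp_norm_sq (hA : MemLp A 4 P) : MemLp (fun x => ‖A x‖ ^ 2) 2 P := by
  refine (memLp_mul_two hA hA).norm.congr_norm
    ((hA.aestronglyMeasurable.norm).pow 2) (Filter.Eventually.of_forall fun x => ?_)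
  simp [sq]

lemma ofReal_integral_norm_sq (A : Ω → ℂ) :
    ((∫ x, ‖A x‖ ^ 2 ∂P : ℝ) : ℂ) = ∫ x, A x * (starRingEnd ℂ) (A x) ∂P := by
  rw [← integral_complex_ofReal]
  refine integral_congr_ae (Filter.Eventually.of_forall fun x => ?_)
  simp only [Complex.mul_conj']
  push_cast
  rfl

/-- The product of two squared norms has the expectation of the Gaussian case, up to terms with
cumulants of the orders three and four and with means. -/
lemma integral_norm_sq_mul_le (A C : Ω → ℂ) (A' C' : Ω → ℂ)
    (hA' : A' = fun x => (starRingEnd ℂ) (A x)) (hC' : C' = fun x => (starRingEnd ℂ) (C x)) :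
    ∫ x, ‖A x‖ ^ 2 * ‖C x‖ ^ 2 ∂P ≤ (∫ x, ‖A x‖ ^ 2 ∂P) * (∫ x, ‖C x‖ ^ 2 ∂P) +
      ‖∫ x, A x * C x ∂P‖ ^ 2 + ‖∫ x, A x * (starRingEnd ℂ) (C x) ∂P‖ ^ 2 +
      ‖cum4 P A A' C C'‖ +
      (‖∫ x, A x ∂P‖ * ‖cum3 P A' C C'‖ + ‖∫ x, A x ∂P‖ * ‖cum3 P A C C'‖ +
        ‖∫ x, C x ∂P‖ * ‖cum3 P A A' C'‖ + ‖∫ x, C x ∂P‖ * ‖cum3 P A A' C‖) +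
      2 * (‖∫ x, A x ∂P‖ * (‖∫ x, A x ∂P‖ * (‖∫ x, C x ∂P‖ * ‖∫ x, C x ∂P‖))) := by
  have h := integral_four_eq P A A' C C'
  have hm : ((∫ x, ‖A x‖ ^ 2 * ‖C x‖ ^ 2 ∂P : ℝ) : ℂ) =
      ∫ x, A x * (A' x * (C x * C' x)) ∂P := by
    rw [← integral_complex_ofReal]
    refine integral_congr_ae (Filter.Eventually.of_forall fun x => ?_)
    simp only [hA', hC', Complex.mul_conj']
    rw [← mul_assoc, Complex.mul_conj']
    push_cast
    rfl
  have hn : ∫ x, ‖A x‖ ^ 2 * ‖C x‖ ^ 2 ∂P = ‖∫ x, A x * (A' x * (C x * C' x)) ∂P‖ := by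
    rw [← hm, Complex.norm_real, Real.norm_eq_abs, abs_of_nonneg]
    exact integral_nonneg fun x => by positivity
  have hc : ∀ D : Ω → ℂ, ‖∫ x, (starRingEnd ℂ) (D x) ∂P‖ = ‖∫ x, D x ∂P‖ := fun D => by
    rw [integral_conj, RCLike.norm_conj]
  have hAA : ∫ x, A x * A' x ∂P = ((∫ x, ‖A x‖ ^ 2 ∂P : ℝ) : ℂ) := by
    rw [ofReal_integral_norm_sq, hA']
  have hCC : ∫ x, C x * C' x ∂P = ((∫ x, ‖C x‖ ^ 2 ∂P : ℝ) : ℂ) := by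
    rw [ofReal_integral_norm_sq, hC']
  have h1 : ‖∫ x, A' x * C' x ∂P‖ = ‖∫ x, A x * C x ∂P‖ := by
    rw [← hc (fun x => A x * C x)]; simp only [hA', hC', map_mul]
  have h2 : ‖∫ x, A' x * C x ∂P‖ = ‖∫ x, A x * C' x ∂P‖ := by
    rw [← hc (fun x => A x * C' x)]; simp only [hA', hC', map_mul, Complex.conj_conj]
  have hA1 : ‖∫ x, A' x ∂P‖ = ‖∫ x, A x ∂P‖ := by rw [hA', hc]
  have hC1 : ‖∫ x, C' x ∂P‖ = ‖∫ x, C x ∂P‖ := by rw [hC', hc]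
  have hAn : 0 ≤ ∫ x, ‖A x‖ ^ 2 ∂P := integral_nonneg fun x => by positivity
  have hCn : 0 ≤ ∫ x, ‖C x‖ ^ 2 ∂P := integral_nonneg fun x => by positivity
  rw [hn, h]
  refine (norm_sub_le _ _).trans (add_le_add ?_ (le_of_eq ?_))
  · refine (norm_add_le _ _).trans (add_le_add ?_ ?_)
    · refine (norm_add_le _ _).trans (add_le_add ?_ le_rfl)
      refine norm_add₃_le.trans (le_of_eq ?_)
      rw [norm_mul, norm_mul, norm_mul, hAA, hCC, h1, h2, Complex.norm_real, Complex.norm_real,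
        Real.norm_of_nonneg hAn, Real.norm_of_nonneg hCn, hC', sq, sq]
    · refine (norm_add_le _ _).trans (add_le_add ?_ (le_of_eq (by rw [norm_mul, hC1])))
      refine norm_add₃_le.trans (le_of_eq ?_)
      rw [norm_mul, norm_mul, norm_mul, hA1]
  · simp only [norm_mul, hA1, hC1, Complex.norm_ofNat]

/-- A crude Cauchy-Schwarz inequality. -/
lemma norm_integral_mul_le (hA : MemLp A 2 P) (hC : MemLp C 2 P) {m : ℝ}
    (h1 : ∫ x, ‖A x‖ ^ 2 ∂P ≤ m) (h2 : ∫ x, ‖C x‖ ^ 2 ∂P ≤ m) :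
    ‖∫ x, A x * C x ∂P‖ ≤ m := by
  have i1 : Integrable (fun x => ‖A x‖ ^ 2) P := hA.integrable_norm_pow (by norm_num)
  have i2 : Integrable (fun x => ‖C x‖ ^ 2) P := hC.integrable_norm_pow (by norm_num)
  calc ‖∫ x, A x * C x ∂P‖ ≤ ∫ x, ‖A x * C x‖ ∂P := norm_integral_le_integral_norm _
    _ ≤ ∫ x, (1 / 2 * ‖A x‖ ^ 2 + 1 / 2 * ‖C x‖ ^ 2) ∂P := by
      refine integral_mono (hA.integrable_mul hC).norm
        ((i1.const_mul _).add (i2.const_mul _)) fun x => ?_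
      simp only [norm_mul]
      nlinarith [sq_nonneg (‖A x‖ - ‖C x‖)]
    _ ≤ m := by
      rw [integral_add (i1.const_mul _) (i2.const_mul _), integral_const_mul, integral_const_mul]
      linarith

end SquaredNorms

/-! ### Absorbing the logarithms -/

section LogBound

/-- From `log u ≤ u - 1` at `u = t^(1/12)`. The exponent is chosen so that the fourth power becomes
`t^(1/3)`. -/
lemma one_add_log_pow_four_le {t : ℝ} (ht : 1 ≤ t) :
    (1 + Real.log t) ^ 4 ≤ 12 ^ 4 * t ^ (1 / 3 : ℝ) := by
  have h0 : 0 < t := by linarith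
  have hl := Real.log_nonneg ht
  have hu : 1 ≤ t ^ (1 / 12 : ℝ) := Real.one_le_rpow ht (by norm_num)
  have h1 : 1 + Real.log t ≤ 12 * t ^ (1 / 12 : ℝ) := by
    have := Real.log_le_sub_one_of_pos (Real.rpow_pos_of_pos h0 (1 / 12))
    rw [Real.log_rpow h0] at this
    linarith
  calc (1 + Real.log t) ^ 4 ≤ (12 * t ^ (1 / 12 : ℝ)) ^ 4 := by gcongr
    _ = 12 ^ 4 * t ^ (1 / 3 : ℝ) := by
      rw [mul_pow, ← Real.rpow_natCast (t ^ (1 / 12 : ℝ)), ← Real.rpow_mul h0.le]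
      norm_num

lemma one_add_log_pow_four_le_self {t : ℝ} (ht : 1 ≤ t) :
    (1 + Real.log t) ^ 4 ≤ 12 ^ 4 * t := by
  refine (one_add_log_pow_four_le ht).trans (mul_le_mul_of_nonneg_left ?_ (by norm_num))
  calc t ^ (1 / 3 : ℝ) ≤ t ^ (1 : ℝ) := Real.rpow_le_rpow_of_exponent_le ht (by norm_num)
    _ = t := Real.rpow_one t

/-- The logarithmic remainder is dominated by the squared bias and the variance. -/
lemma one_add_log_pow_four_div_le {t m : ℝ} (ht : 1 ≤ t) (hm : 1 ≤ m) :
    (1 + Real.log t) ^ 4 / t ≤ 12 ^ 4 * (m ^ 2 / t ^ 2 + 1 / m) := by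
  have h0 : 0 < t := by linarith
  have hm0 : 0 < m := by linarith
  set u := t ^ (1 / 3 : ℝ) with hu
  have hu0 : 0 < u := Real.rpow_pos_of_pos h0 _
  have hut : u ^ 3 = t := by
    rw [hu, ← Real.rpow_natCast, ← Real.rpow_mul h0.le]; norm_num
  have h1 : (1 + Real.log t) ^ 4 / t ≤ 12 ^ 4 * (1 / u ^ 2) := by
    rw [div_le_iff₀ h0]
    refine (one_add_log_pow_four_le ht).trans (le_of_eq ?_)
    rw [← hu, ← hut]
    field_simp
  refine h1.trans (mul_le_mul_of_nonneg_left ?_ (by norm_num))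
  -- The threshold `m = t^(2/3)` balances `m²/t²` against `1/m`; on either side one of them
  -- dominates `t^(-2/3)`.
  rcases le_total m (u ^ 2) with h | h
  · have : 1 / u ^ 2 ≤ 1 / m := one_div_le_one_div_of_le hm0 h
    have : 0 ≤ m ^ 2 / t ^ 2 := by positivity
    linarith
  · have h3 : 1 / u ^ 2 ≤ m ^ 2 / t ^ 2 := by
      rw [← hut, div_le_div_iff₀ (by positivity) (by positivity)]
      calc 1 * (u ^ 3) ^ 2 = (u ^ 2) ^ 2 * u ^ 2 := by ring
        _ ≤ m ^ 2 * u ^ 2 := by gcongr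
    have : 0 ≤ 1 / m := by positivity
    linarith

end LogBound

/-! ### Fourth moments of the orthogonal samples -/

section OrthQuartic

variable {Ω : Type*} [MeasurableSpace Ω] {P : Measure Ω} {X : ℤ → Ω → ℝ} {φ : ℝ → ℂ}
  {B Λ : ℝ}

lemma memLp_orthSample [IsProbabilityMeasure P] (hX : StationaryCumulantCondition P X 8)
    (φ : ℝ → ℂ) (T : ℕ) (r : ℤ) : MemLp (orthSample X φ T r) 4 P := by
  rw [orthSample_eq_quadForm]; exact memLp_quadForm hX T _

/-- The second moment pairings stay explicit, as they carry the resonances. With `L = O((1 + log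
T)/T)` the fourth cumulant is `O(T L⁴)`, a mean times a third cumulant is `O(L³)`, and the product
of four means is `O(T⁻⁴)`; all are bounded by `(1 + log T)⁴ / T³`. -/
theorem exists_integral_orthSample_quartic_le [IsProbabilityMeasure P]
    (hX : StationaryCumulantCondition P X 8) (hmean : ∀ t : ℤ, ∫ x, X t x ∂P = 0)
    (hφ : LipWeight φ B Λ) : ∃ K : ℝ, 0 ≤ K ∧ ∀ (T : ℕ) (r s : ℤ), 1 ≤ T → ¬ (T : ℤ) ∣ r →
      ¬ (T : ℤ) ∣ s → ∫ x, ‖orthSample X φ T r x‖ ^ 2 * ‖orthSample X φ T s x‖ ^ 2 ∂P ≤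
        (∫ x, ‖orthSample X φ T r x‖ ^ 2 ∂P) * (∫ x, ‖orthSample X φ T s x‖ ^ 2 ∂P) +
        ‖∫ x, orthSample X φ T r x * orthSample X φ T s x ∂P‖ ^ 2 +
        ‖∫ x, orthSample X φ T r x * (starRingEnd ℂ) (orthSample X φ T s x) ∂P‖ ^ 2 +
        K * ((1 + Real.log T) ^ 4 / T ^ 3) := by
  obtain ⟨F, C, h⟩ := exists_freqBounds hX hmean
  obtain ⟨c3, hc3, h3⟩ := exists_norm_cum3_le hX hmean
  obtain ⟨c4, hc4, h4⟩ := exists_norm_cum4_le hX hmean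
  have hB := hφ.bound_nonneg
  have hΛ := hφ.lip_nonneg
  have hC := h.C_nonneg
  have hpi := Real.pi_pos
  set l : ℝ := 5 * B + 4 * Real.pi * Λ with hl
  have hl0 : 0 ≤ l := by positivity
  set b : ℝ := B * C with hb
  have hb0 : 0 ≤ b := by positivity
  -- The summands belong to the fourth cumulant, to the four products of a mean and a third
  -- cumulant, and to the product of the means.
  refine ⟨c4 * l ^ 4 + 4 * (b * (c3 * l ^ 3)) + 2 * b ^ 4, by positivity,
    fun T r s hT hr hs => ?_⟩
  have hT' : (1 : ℝ) ≤ T := by exact_mod_cast hT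
  have hT0 : (0 : ℝ) < T := by linarith
  set g : ℝ := 1 + Real.log T with hg
  have hg1 : 1 ≤ g := by linarith [Real.log_nonneg hT']
  have hL : 0 ≤ l * (g / T) := by positivity
  have hk := kernelBound_orthKernel hT hφ
  have n1 : ∀ (q : ℤ) (p : ℤ × ℤ), p ∈ timePairs T →
      ‖orthCoef φ T q p‖ ≤ orthKernel φ T p.1 p.2 := fun q p _ => (norm_orthCoef φ T q p).le
  have n2 : ∀ (q : ℤ) (p : ℤ × ℤ), p ∈ timePairs T →
      ‖(starRingEnd ℂ) (orthCoef φ T q p)‖ ≤ orthKernel φ T p.1 p.2 := fun q p _ => by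
    rw [RCLike.norm_conj]; exact (norm_orthCoef φ T q p).le
  have er : ∀ q : ℤ, quadForm X T (fun p => (starRingEnd ℂ) (orthCoef φ T q p)) =
      fun x => (starRingEnd ℂ) (orthSample X φ T q x) := fun q => by
    ext x; rw [orthSample_eq_quadForm, conj_quadForm]
  have hmain := integral_norm_sq_mul_le (P := P) (orthSample X φ T r) (orthSample X φ T s) _ _
    (er r) (er s)
  have k4 := h4 T _ _ hL hk _ _ _ _ (n1 r) (n2 r) (n1 s) (n2 s)
  have k31 := h3 T _ _ hL hk _ _ _ (n2 r) (n1 s) (n2 s)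
  have k32 := h3 T _ _ hL hk _ _ _ (n1 r) (n1 s) (n2 s)
  have k33 := h3 T _ _ hL hk _ _ _ (n1 r) (n2 r) (n2 s)
  have k34 := h3 T _ _ hL hk _ _ _ (n1 r) (n2 r) (n1 s)
  rw [← orthSample_eq_quadForm, ← orthSample_eq_quadForm] at k4 k34
  rw [← orthSample_eq_quadForm] at k31 k33
  rw [← orthSample_eq_quadForm, ← orthSample_eq_quadForm] at k32
  have mr := norm_integral_orthSample_le hX h hφ hT hr
  have ms := norm_integral_orthSample_le hX h hφ hT hs
  have e4 : c4 * (T * (l * (g / T)) ^ 4) = c4 * l ^ 4 * (g ^ 4 / T ^ 3) := by field_simp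
  have e3 : b / T * (c3 * (T * (l * (g / T)) ^ 3)) ≤ b * (c3 * l ^ 3) * (g ^ 4 / T ^ 3) := by
    have : b / T * (c3 * (T * (l * (g / T)) ^ 3)) = b * (c3 * l ^ 3) * (g ^ 3 / T ^ 3) := by
      field_simp
    rw [this]
    refine mul_le_mul_of_nonneg_left (div_le_div_of_nonneg_right ?_ (by positivity))
      (by positivity)
    exact pow_le_pow_right₀ hg1 (by norm_num)
  have e2 : b / T * (b / T * (b / T * (b / T))) ≤ b ^ 4 * (g ^ 4 / T ^ 3) := by
    have : b / T * (b / T * (b / T * (b / T))) = b ^ 4 * (1 / T ^ 4) := by field_simp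
    rw [this]
    refine mul_le_mul_of_nonneg_left ?_ (by positivity)
    exact div_le_div₀ (by positivity) (one_le_pow₀ hg1) (by positivity)
      (pow_le_pow_right₀ hT' (by norm_num))
  have hbT : 0 ≤ b / T := by positivity
  have j1 := (mul_le_mul mr k31 (norm_nonneg _) hbT).trans e3
  have j2 := (mul_le_mul mr k32 (norm_nonneg _) hbT).trans e3
  have j3 := (mul_le_mul ms k33 (norm_nonneg _) hbT).trans e3
  have j4 := (mul_le_mul ms k34 (norm_nonneg _) hbT).trans e3
  have j5 := (mul_le_mul mr (mul_le_mul mr (mul_le_mul ms ms (norm_nonneg _) hbT) (by positivity)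
    hbT) (by positivity) hbT).trans e2
  rw [e4] at k4
  refine hmain.trans ?_
  linarith

end OrthQuartic

/-! ### Pointwise bounds at multiples of `T` -/

section Pointwise

variable {Ω : Type*} {X : ℤ → Ω → ℝ} {φ : ℝ → ℂ} {B Λ : ℝ}

lemma orthSample_add_of_dvd {T : ℕ} (hT : 1 ≤ T) (φ : ℝ → ℂ) (r : ℤ) {n : ℤ} (hn : (T : ℤ) ∣ n) :
    orthSample X φ T (r + n) = orthSample X φ T r := by
  ext x
  simp only [orthSample, ← add_assoc, dft_freq_add hT _ hn]

/-- Parseval's identity for the discrete Fourier transform. -/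
lemma sum_norm_sq_dft {T : ℕ} (hT : 1 ≤ T) (x : Ω) :
    ∑ k ∈ Finset.Icc (1 : ℤ) T, ‖dft X T (freq T k) x‖ ^ 2 =
      1 / (2 * Real.pi) * ∑ t ∈ Finset.Icc (1 : ℤ) T, X t x ^ 2 := by
  have hTc : (T : ℂ) ≠ 0 := by exact_mod_cast (by omega : T ≠ 0)
  have hpc : (Real.pi : ℂ) ≠ 0 := by exact_mod_cast Real.pi_ne_zero
  have h1 : ∀ k : ℤ, ((‖dft X T (freq T k) x‖ ^ 2 : ℝ) : ℂ) =
      (1 / (2 * Real.pi * T) : ℂ) * ∑ t ∈ Finset.Icc (1 : ℤ) T, ∑ s ∈ Finset.Icc (1 : ℤ) T,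
        ((X t x : ℂ) * X s x) * rootChar T (k * (t - s)) := by
    intro k
    push_cast
    rw [← Complex.mul_conj', conj_dft_freq, dft_freq, dft_freq, mul_mul_mul_comm, sqrt_sq_inv,
      Finset.sum_mul_sum]
    congr 1
    refine Finset.sum_congr rfl fun t _ => Finset.sum_congr rfl fun s _ => ?_
    rw [mul_mul_mul_comm, ← rootChar_add]
    congr 2; ring
  have h2 : ((∑ k ∈ Finset.Icc (1 : ℤ) T, ‖dft X T (freq T k) x‖ ^ 2 : ℝ) : ℂ) =
      ((1 / (2 * Real.pi) * ∑ t ∈ Finset.Icc (1 : ℤ) T, X t x ^ 2 : ℝ) : ℂ) := by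
    rw [Complex.ofReal_sum, Finset.sum_congr rfl fun k _ => h1 k, ← Finset.mul_sum,
      Finset.sum_comm]
    have h3 : ∀ t ∈ Finset.Icc (1 : ℤ) T, ∑ k ∈ Finset.Icc (1 : ℤ) T,
        ∑ s ∈ Finset.Icc (1 : ℤ) T, ((X t x : ℂ) * X s x) * rootChar T (k * (t - s)) =
        T * (X t x : ℂ) ^ 2 := by
      intro t ht
      rw [Finset.sum_comm]
      have h4 : ∀ s ∈ Finset.Icc (1 : ℤ) T, ∑ k ∈ Finset.Icc (1 : ℤ) T,
          ((X t x : ℂ) * X s x) * rootChar T (k * (t - s)) =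
          (dvdInd T (t - s) : ℂ) * (T * ((X t x : ℂ) * X s x)) := by
        intro s _
        rw [← Finset.mul_sum, sum_rootChar hT, dvdInd]
        split_ifs <;> push_cast <;> ring
      rw [Finset.sum_congr rfl h4, sum_dvdInd_sub_mul ht (fun s => T * ((X t x : ℂ) * X s x)), sq]
    rw [Finset.sum_congr rfl h3, ← Finset.mul_sum]
    push_cast
    field_simp
  exact_mod_cast h2

/-- The orthogonal sample at a multiple of `T` is dominated by the sample second moment. -/
lemma norm_orthSample_le_of_dvd (hφ : LipWeight φ B Λ) {T : ℕ} (hT : 1 ≤ T) {r : ℤ}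
    (hr : (T : ℤ) ∣ r) (x : Ω) :
    ‖orthSample X φ T r x‖ ≤ B * ∑ t ∈ Finset.Icc (1 : ℤ) T, 1 / (T : ℝ) * X t x ^ 2 := by
  have hT' : (0 : ℝ) < T := by exact_mod_cast hT
  have hB := hφ.bound_nonneg
  have hpi := Real.pi_gt_three
  have h0 : orthSample X φ T r x = orthSample X φ T 0 x := by
    rw [← orthSample_add_of_dvd hT φ 0 hr, zero_add]
  have hsum : ‖∑ k ∈ Finset.Icc (1 : ℤ) T, φ (freq T k) * dft X T (freq T k) x *
      (starRingEnd ℂ) (dft X T (freq T (k + 0)) x)‖ ≤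
      ∑ k ∈ Finset.Icc (1 : ℤ) T, B * ‖dft X T (freq T k) x‖ ^ 2 := by
    refine (norm_sum_le _ _).trans (Finset.sum_le_sum fun k hk => ?_)
    rw [add_zero, norm_mul, norm_mul, RCLike.norm_conj, mul_assoc, sq]
    exact mul_le_mul_of_nonneg_right (hφ.bound _ (freq_mem hk)) (by positivity)
  rw [← Finset.mul_sum, sum_norm_sq_dft hT] at hsum
  rw [h0, orthSample, sum_Icc_natCast T (fun k => φ (freq T k) * dft X T (freq T k) x *
      (starRingEnd ℂ) (dft X T (freq T (k + 0)) x)), norm_mul, norm_div, norm_one,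
    Complex.norm_natCast, ← Finset.mul_sum]
  have hS : 0 ≤ ∑ t ∈ Finset.Icc (1 : ℤ) T, X t x ^ 2 := Finset.sum_nonneg fun t _ => sq_nonneg _
  have hle : 1 / (2 * Real.pi) * ∑ t ∈ Finset.Icc (1 : ℤ) T, X t x ^ 2 ≤
      ∑ t ∈ Finset.Icc (1 : ℤ) T, X t x ^ 2 :=
    mul_le_of_le_one_left hS (div_le_one_of_le₀ (by linarith) (by linarith))
  calc 1 / (T : ℝ) * ‖∑ k ∈ Finset.Icc (1 : ℤ) T, φ (freq T k) * dft X T (freq T k) x *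
      (starRingEnd ℂ) (dft X T (freq T (k + 0)) x)‖
      ≤ 1 / (T : ℝ) * (B * ∑ t ∈ Finset.Icc (1 : ℤ) T, X t x ^ 2) :=
        mul_le_mul_of_nonneg_left (hsum.trans (mul_le_mul_of_nonneg_left hle hB)) (by positivity)
    _ = B * (1 / (T : ℝ) * ∑ t ∈ Finset.Icc (1 : ℤ) T, X t x ^ 2) := by ring

lemma norm_orthSample_pow_le_of_dvd (hφ : LipWeight φ B Λ) {T : ℕ} (hT : 1 ≤ T) {r : ℤ}
    (hr : (T : ℤ) ∣ r) (x : Ω) :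
    ‖orthSample X φ T r x‖ ^ 4 ≤
      B ^ 4 * (1 / (T : ℝ) * ∑ t ∈ Finset.Icc (1 : ℤ) T, X t x ^ 8) := by
  have hT' : (0 : ℝ) < T := by exact_mod_cast hT
  have hB := hφ.bound_nonneg
  -- Convexity of the fourth power: the mean of the squares raised to the fourth power is at most
  -- the mean of the eighth powers, whose expectation is finite and independent of `t`.
  have hm := Real.pow_arith_mean_le_arith_mean_pow (Finset.Icc (1 : ℤ) T) (fun _ => 1 / (T : ℝ))
    (fun t => X t x ^ 2) (fun _ _ => by positivity) (by
      rw [Finset.sum_const, Int.card_Icc, nsmul_eq_mul]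
      simp only [add_sub_cancel_right, Int.toNat_natCast]
      field_simp) (fun _ _ => sq_nonneg _) 4
  refine (pow_le_pow_left₀ (norm_nonneg _) (norm_orthSample_le_of_dvd hφ hT hr x) 4).trans ?_
  rw [mul_pow, Finset.mul_sum]
  refine mul_le_mul_of_nonneg_left (hm.trans (le_of_eq ?_)) (by positivity)
  exact Finset.sum_congr rfl fun t _ => by rw [← pow_mul]

end Pointwise

/-! ### Covariances of the squared orthogonal samples -/

section SecondMoments

variable {Ω : Type*} [MeasurableSpace Ω] {P : Measure Ω} {X : ℤ → Ω → ℝ} {φ : ℝ → ℂ}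
  {B Λ : ℝ}

lemma integral_pow_eight [IsProbabilityMeasure P] (hX : StationaryCumulantCondition P X 8)
    (t : ℤ) : ∫ x, X t x ^ 8 ∂P = ∫ x, X 0 x ^ 8 ∂P := by
  have := hX.moment_shift 8 le_rfl (fun _ => 0) t
  simpa using this

lemma integrable_pow_eight (hX : StationaryCumulantCondition P X 8) (t : ℤ) :
    Integrable (fun x => X t x ^ 8) P := by
  have := (hX.memLp t).integrable_norm_pow (by norm_num)
  refine this.congr (Filter.Eventually.of_forall fun x => ?_)
  simp only [Real.norm_eq_abs]
  exact Even.pow_abs (by decide) _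

/-- By periodicity `r` may be replaced by its residue, which lies between `1` and `T - 1`. The error
`D * (r / T)` of the variance expansion is then at most `D`. -/
theorem exists_integral_norm_sq_orthSample_le [IsProbabilityMeasure P]
    (hX : StationaryCumulantCondition P X 8) (hmean : ∀ t : ℤ, ∫ x, X t x ∂P = 0)
    (hφ : LipWeight φ B Λ) : ∃ H : ℝ, 0 ≤ H ∧ ∀ (T : ℕ) (r : ℤ), 1 ≤ T → ¬ (T : ℤ) ∣ r →
      ∫ x, ‖orthSample X φ T r x‖ ^ 2 ∂P ≤ H / T := by
  obtain ⟨D, hD, h⟩ := exists_norm_integral_orthSample_sq_sub_limit_le hX hmean hφ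
  refine ⟨‖limitVariance P X φ‖ + D, by positivity, fun T r hT hr => ?_⟩
  have hT' : (0 : ℝ) < T := by exact_mod_cast hT
  have hTz : (0 : ℤ) < T := by exact_mod_cast hT
  have e : orthSample X φ T r = orthSample X φ T (r % T) := by
    conv_lhs => rw [← Int.emod_add_mul_ediv r T]
    exact orthSample_add_of_dvd hT φ _ (dvd_mul_right _ _)
  have hlt := Int.emod_lt_of_pos r hTz
  have hpos : 1 ≤ r % T := by
    have h0 := Int.emod_nonneg r hTz.ne'
    have h1 : r % T ≠ 0 := fun h0 => hr (Int.dvd_of_emod_eq_zero h0)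
    omega
  have hb := h T (r % T) hpos hlt
  rw [← ofReal_integral_norm_sq, ← e] at hb
  have hle : D * (((r % T : ℤ) : ℝ) / T) ≤ D :=
    mul_le_of_le_one_right hD (div_le_one_of_le₀ (by exact_mod_cast hlt.le) hT'.le)
  have hm : 0 ≤ ∫ x, ‖orthSample X φ T r x‖ ^ 2 ∂P := integral_nonneg fun x => by positivity
  rw [le_div_iff₀ hT', mul_comm]
  have hn : ‖(T : ℂ) * ((∫ x, ‖orthSample X φ T r x‖ ^ 2 ∂P : ℝ) : ℂ)‖ =
      T * ∫ x, ‖orthSample X φ T r x‖ ^ 2 ∂P := by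
    rw [norm_mul, Complex.norm_natCast, Complex.norm_real, Real.norm_of_nonneg hm]
  rw [← hn]
  have := norm_le_norm_add_norm_sub' ((T : ℂ) * ((∫ x, ‖orthSample X φ T r x‖ ^ 2 ∂P : ℝ) : ℂ))
    (limitVariance P X φ)
  linarith

/-- The covariances of the squared orthogonal samples. -/
theorem exists_covariance_norm_sq_orthSample_le [IsProbabilityMeasure P]
    (hX : StationaryCumulantCondition P X 8) (hmean : ∀ t : ℤ, ∫ x, X t x ∂P = 0)
    (hφ : LipWeight φ B Λ) : ∃ K : ℝ, 0 ≤ K ∧ ∀ (T : ℕ) (r s : ℤ), 1 ≤ T → ¬ (T : ℤ) ∣ r →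
      ¬ (T : ℤ) ∣ s → cov[fun x => ‖orthSample X φ T r x‖ ^ 2,
        fun x => ‖orthSample X φ T s x‖ ^ 2; P] ≤
        K * ((if (T : ℤ) ∣ s - r then 1 / (T : ℝ) ^ 2 else 0) +
          (if (T : ℤ) ∣ r + s then 1 / (T : ℝ) ^ 2 else 0) +
          (1 / (T : ℝ) ^ 4 + (1 + Real.log T) ^ 4 / T ^ 3)) := by
  obtain ⟨F, C, h⟩ := exists_freqBounds hX hmean
  obtain ⟨H, hH, hH'⟩ := exists_integral_norm_sq_orthSample_le hX hmean hφ
  obtain ⟨K, hK, hK'⟩ := exists_integral_orthSample_quartic_le hX hmean hφ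
  have hB := hφ.bound_nonneg
  have hC := h.C_nonneg
  have hF := h.F_nonneg
  set c : ℝ := B ^ 2 * (4 * F * C + (3 * C ^ 2 + C)) with hc
  have hc0 : 0 ≤ c := by positivity
  refine ⟨H ^ 2 + 2 * c ^ 2 + K, by positivity, fun T r s hT hr hs => ?_⟩
  have hT' : (0 : ℝ) < T := by exact_mod_cast hT
  have hT1 : (1 : ℝ) ≤ T := by exact_mod_cast hT
  have hlog := Real.log_nonneg hT1
  have hA := fun q => memLp_orthSample hX φ T q
  have hA2 := fun q => (hA q).mono_exponent (by norm_num : (2 : ℝ≥0∞) ≤ 4)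
  have hAc : MemLp (fun x => (starRingEnd ℂ) (orthSample X φ T s x)) 2 P := (hA2 s).star
  rw [covariance_eq_sub (memLp_norm_sq (hA r)) (memLp_norm_sq (hA s))]
  simp only [Pi.mul_apply]
  have i0 := hK' T r s hT hr hs
  -- At resonance only the Cauchy-Schwarz bound `H / T` is available, and off resonance the sharper
  -- `c / T ^ 2`. The sum of the two squared bounds covers both cases.
  have key : ∀ (Z : ℂ) (p : Prop) [Decidable p], ‖Z‖ ≤ H / T → (¬ p → ‖Z‖ ≤ c / T ^ 2) →
      ‖Z‖ ^ 2 ≤ H ^ 2 * (if p then 1 / (T : ℝ) ^ 2 else 0) + c ^ 2 * (1 / (T : ℝ) ^ 4) := by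
    intro Z p _ h1 h2
    split_ifs with hp
    · have := pow_le_pow_left₀ (norm_nonneg _) h1 2
      rw [div_pow, div_eq_mul_one_div] at this
      have : 0 ≤ c ^ 2 * (1 / (T : ℝ) ^ 4) := by positivity
      linarith
    · have := pow_le_pow_left₀ (norm_nonneg _) (h2 hp) 2
      rw [div_pow, ← pow_mul, div_eq_mul_one_div] at this
      linarith
  have i1 := key (∫ x, orthSample X φ T r x * orthSample X φ T s x ∂P) ((T : ℤ) ∣ r + s)
    (norm_integral_mul_le (hA2 r) (hA2 s) (hH' T r hT hr) (hH' T s hT hs))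
    (fun hp => norm_integral_orthSample_mul_le hX hmean h hφ hT hr hs hp)
  have i2 := key (∫ x, orthSample X φ T r x * (starRingEnd ℂ) (orthSample X φ T s x) ∂P)
    ((T : ℤ) ∣ s - r)
    (norm_integral_mul_le (hA2 r) hAc (hH' T r hT hr) (by
      simp only [RCLike.norm_conj]; exact hH' T s hT hs))
    (fun hp => norm_integral_orthSample_mul_conj_le hX hmean h hφ hT hr hs hp)
  set u : ℝ := if (T : ℤ) ∣ s - r then 1 / (T : ℝ) ^ 2 else 0 with hu
  set v : ℝ := if (T : ℤ) ∣ r + s then 1 / (T : ℝ) ^ 2 else 0 with hv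
  have hu0 : 0 ≤ u := by rw [hu]; positivity
  have hv0 : 0 ≤ v := by rw [hv]; positivity
  set w : ℝ := 1 / (T : ℝ) ^ 4 with hw
  set z : ℝ := (1 + Real.log T) ^ 4 / T ^ 3 with hz
  have hw0 : 0 ≤ w := by positivity
  have hz0 : 0 ≤ z := by positivity
  have p1 : 0 ≤ H ^ 2 * (w + z) := by positivity
  have p2 : 0 ≤ 2 * c ^ 2 * (u + v + z) := by positivity
  have p3 : 0 ≤ K * (u + v + w) := by positivity
  linarith

/-- The fourth moments of the orthogonal samples. -/
theorem exists_integral_norm_pow_four_orthSample_le [IsProbabilityMeasure P]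
    (hX : StationaryCumulantCondition P X 8) (hmean : ∀ t : ℤ, ∫ x, X t x ∂P = 0)
    (hφ : LipWeight φ B Λ) : ∃ K : ℝ, 0 ≤ K ∧ ∀ (T : ℕ) (r : ℤ), 1 ≤ T → ¬ (T : ℤ) ∣ r →
      ∫ x, (‖orthSample X φ T r x‖ ^ 2) ^ 2 ∂P ≤ K / T ^ 2 := by
  obtain ⟨H, hH, hH'⟩ := exists_integral_norm_sq_orthSample_le hX hmean hφ
  obtain ⟨K, hK, hK'⟩ := exists_covariance_norm_sq_orthSample_le hX hmean hφ
  refine ⟨H ^ 2 + K * (3 + 12 ^ 4), by positivity, fun T r hT hr => ?_⟩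
  have hT' : (0 : ℝ) < T := by exact_mod_cast hT
  have hT1 : (1 : ℝ) ≤ T := by exact_mod_cast hT
  have i0 := hK' T r r hT hr hr
  rw [covariance_eq_sub (memLp_norm_sq (memLp_orthSample hX φ T r))
    (memLp_norm_sq (memLp_orthSample hX φ T r))] at i0
  simp only [Pi.mul_apply, ← sq (‖orthSample X φ T r _‖ ^ 2)] at i0
  have hm : 0 ≤ ∫ x, ‖orthSample X φ T r x‖ ^ 2 ∂P := integral_nonneg fun x => by positivity
  have i1 := mul_le_mul (hH' T r hT hr) (hH' T r hT hr) hm (by positivity)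
  have hle : ∀ (p : Prop) [Decidable p], (if p then 1 / (T : ℝ) ^ 2 else 0) ≤ 1 / (T : ℝ) ^ 2 := by
    intro p _
    split_ifs
    · exact le_rfl
    · positivity
  have i2 := hle ((T : ℤ) ∣ r - r)
  have i3 := hle ((T : ℤ) ∣ r + r)
  have i4 : 1 / (T : ℝ) ^ 4 ≤ 1 / (T : ℝ) ^ 2 :=
    one_div_le_one_div_of_le (by positivity) (pow_le_pow_right₀ hT1 (by norm_num))
  have i5 : (1 + Real.log T) ^ 4 / (T : ℝ) ^ 3 ≤ 12 ^ 4 * (1 / (T : ℝ) ^ 2) := by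
    rw [div_le_iff₀ (by positivity)]
    refine (one_add_log_pow_four_le_self hT1).trans (le_of_eq (by field_simp))
  have i6 := mul_le_mul_of_nonneg_left (add_le_add (add_le_add i2 i3) (add_le_add i4 i5)) hK
  have e : (H ^ 2 + K * (3 + 12 ^ 4)) / (T : ℝ) ^ 2 = H / T * (H / T) + K *
      (1 / (T : ℝ) ^ 2 + 1 / (T : ℝ) ^ 2 + (1 / (T : ℝ) ^ 2 + 12 ^ 4 * (1 / (T : ℝ) ^ 2))) := by
    field_simp; ring
  rw [e]
  linarith

end SecondMoments

/-! ### Bias, variance and second moment of the estimator -/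

section Estimator

variable {Ω : Type*} [MeasurableSpace Ω] {P : Measure Ω} {X : ℤ → Ω → ℝ} {φ : ℝ → ℂ}
  {B Λ : ℝ}

lemma memLp_varEstimator [IsProbabilityMeasure P] (hX : StationaryCumulantCondition P X 8)
    (φ : ℝ → ℂ) (T M : ℕ) : MemLp (varEstimator X φ T M) 2 P :=
  (memLp_finsetSum (Finset.Icc 1 M)
    fun r _ => memLp_norm_sq (memLp_orthSample hX φ T (r : ℤ))).const_mul _

lemma integral_varEstimator [IsProbabilityMeasure P] (hX : StationaryCumulantCondition P X 8)
    (φ : ℝ → ℂ) (T M : ℕ) : ∫ x, varEstimator X φ T M x ∂P =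
      (T : ℝ) / M * ∑ r ∈ Finset.Icc 1 M, ∫ x, ‖orthSample X φ T (r : ℤ) x‖ ^ 2 ∂P := by
  simp only [varEstimator]
  rw [integral_const_mul, integral_finsetSum _ fun (r : ℕ) _ =>
    (memLp_norm_sq (memLp_orthSample hX φ T (r : ℤ))).integrable (by norm_num)]

lemma variance_varEstimator [IsProbabilityMeasure P] (hX : StationaryCumulantCondition P X 8)
    (φ : ℝ → ℂ) (T M : ℕ) : Var[varEstimator X φ T M; P] =
      ((T : ℝ) / M) ^ 2 * ∑ r ∈ Finset.Icc 1 M, ∑ s ∈ Finset.Icc 1 M,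
        cov[fun x => ‖orthSample X φ T (r : ℤ) x‖ ^ 2,
          fun x => ‖orthSample X φ T (s : ℤ) x‖ ^ 2; P] := by
  have e : varEstimator X φ T M = fun x => ((T : ℝ) / M) *
      ∑ r ∈ Finset.Icc 1 M, ‖orthSample X φ T (r : ℤ) x‖ ^ 2 := rfl
  rw [e, variance_const_mul, variance_fun_sum' fun (r : ℕ) _ =>
    memLp_norm_sq (memLp_orthSample hX φ T (r : ℤ))]

/-- The bias of the estimator for `M < T`. -/
theorem exists_norm_bias_le [IsProbabilityMeasure P]
    (hX : StationaryCumulantCondition P X 8) (hmean : ∀ t : ℤ, ∫ x, X t x ∂P = 0)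
    (hφ : LipWeight φ B Λ) : ∃ D : ℝ, 0 ≤ D ∧ ∀ T M : ℕ, 1 ≤ M → M < T →
      ‖((∫ x, varEstimator X φ T M x ∂P : ℝ) : ℂ) - limitVariance P X φ‖ ≤ D * (M / T) := by
  obtain ⟨D, hD, h⟩ := exists_norm_integral_orthSample_sq_sub_limit_le hX hmean hφ
  refine ⟨D, hD, fun T M hM hMT => ?_⟩
  have hM0 : (0 : ℝ) < M := by exact_mod_cast hM
  have hT0 : (0 : ℝ) < T := by exact_mod_cast (by omega : 0 < T)
  have hMc : (M : ℂ) ≠ 0 := by exact_mod_cast hM0.ne'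
  have e : ((∫ x, varEstimator X φ T M x ∂P : ℝ) : ℂ) - limitVariance P X φ =
      (1 / (M : ℂ)) * ∑ r ∈ Finset.Icc 1 M, (T * ∫ x, orthSample X φ T (r : ℤ) x *
        (starRingEnd ℂ) (orthSample X φ T (r : ℤ) x) ∂P - limitVariance P X φ) := by
    rw [integral_varEstimator hX]
    push_cast
    simp only [ofReal_integral_norm_sq, Finset.sum_sub_distrib, ← Finset.mul_sum,
      Finset.sum_const, Nat.card_Icc, nsmul_eq_mul, Nat.add_sub_cancel]
    field_simp
  have hterm : ∀ r ∈ Finset.Icc 1 M, ‖T * ∫ x, orthSample X φ T (r : ℤ) x *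
      (starRingEnd ℂ) (orthSample X φ T (r : ℤ) x) ∂P - limitVariance P X φ‖ ≤ D * (M / T) := by
    intro r hr
    rw [Finset.mem_Icc] at hr
    refine (h T r (by exact_mod_cast hr.1) (by exact_mod_cast lt_of_le_of_lt hr.2 hMT)).trans ?_
    have : ((r : ℤ) : ℝ) ≤ M := by exact_mod_cast hr.2
    gcongr
  rw [e, norm_mul, norm_div, norm_one, Complex.norm_natCast]
  calc 1 / (M : ℝ) * ‖∑ r ∈ Finset.Icc 1 M, (T * ∫ x, orthSample X φ T (r : ℤ) x *
        (starRingEnd ℂ) (orthSample X φ T (r : ℤ) x) ∂P - limitVariance P X φ)‖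
      ≤ 1 / (M : ℝ) * ∑ r ∈ Finset.Icc 1 M, D * (M / T : ℝ) :=
        mul_le_mul_of_nonneg_left ((norm_sum_le _ _).trans (Finset.sum_le_sum hterm))
          (by positivity)
    _ = D * (M / T) := by
      rw [Finset.sum_const, Nat.card_Icc, nsmul_eq_mul, Nat.add_sub_cancel]
      field_simp

/-- The variance of the estimator for `M < T`. -/
theorem exists_variance_varEstimator_le [IsProbabilityMeasure P]
    (hX : StationaryCumulantCondition P X 8) (hmean : ∀ t : ℤ, ∫ x, X t x ∂P = 0)
    (hφ : LipWeight φ B Λ) : ∃ K : ℝ, 0 ≤ K ∧ ∀ T M : ℕ, 1 ≤ M → M < T →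
      Var[varEstimator X φ T M; P] ≤ K * ((M : ℝ) ^ 2 / (T : ℝ) ^ 2 + 1 / (M : ℝ)) := by
  obtain ⟨K, hK, h⟩ := exists_covariance_norm_sq_orthSample_le hX hmean hφ
  refine ⟨K * (3 + 12 ^ 4), by positivity, fun T M hM hMT => ?_⟩
  have hM0 : (0 : ℝ) < M := by exact_mod_cast hM
  have hM1 : (1 : ℝ) ≤ M := by exact_mod_cast hM
  have hT : 1 ≤ T := by omega
  have hT0 : (0 : ℝ) < T := by exact_mod_cast hT
  have hT1 : (1 : ℝ) ≤ T := by exact_mod_cast hT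
  set a : ℝ := 1 / (T : ℝ) ^ 2 with ha
  have ha0 : 0 ≤ a := by positivity
  set w : ℝ := 1 / (T : ℝ) ^ 4 + (1 + Real.log T) ^ 4 / T ^ 3 with hw
  have hnd : ∀ r ∈ Finset.Icc 1 M, ¬ (T : ℤ) ∣ (r : ℤ) := by
    intro r hr hd
    rw [Finset.mem_Icc] at hr
    have := Int.le_of_dvd (by omega) hd
    omega
  have hrow : ∀ r ∈ Finset.Icc 1 M, ∑ s ∈ Finset.Icc 1 M,
      cov[fun x => ‖orthSample X φ T (r : ℤ) x‖ ^ 2,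
        fun x => ‖orthSample X φ T (s : ℤ) x‖ ^ 2; P] ≤ K * (a + a + M * w) := by
    intro r hr
    refine (Finset.sum_le_sum fun (s : ℕ) hs => h T r s hT (hnd r hr) (hnd s hs)).trans ?_
    rw [← Finset.mul_sum, Finset.sum_add_distrib, Finset.sum_add_distrib]
    refine mul_le_mul_of_nonneg_left (add_le_add (add_le_add ?_ ?_) (le_of_eq ?_)) hK
    · have : ∀ s ∈ Finset.Icc 1 M, (if (T : ℤ) ∣ (s : ℤ) - r then a else 0) =
          if r = s then a else 0 := by
        intro s hs
        rw [Finset.mem_Icc] at hs hr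
        have hiff : (T : ℤ) ∣ (s : ℤ) - r ↔ r = s := by
          constructor
          · intro hd
            have := Int.eq_zero_of_abs_lt_dvd hd (by rw [abs_lt]; omega)
            omega
          · rintro rfl; simp
        simp only [hiff]
      rw [Finset.sum_congr rfl this, Finset.sum_ite_eq, if_pos hr]
    -- Since `0 < r + s < 2T`, resonance of the sum means `s = T - r`. This index may exceed `M`, in
    -- which case the term is absent.
    · have : ∀ s ∈ Finset.Icc 1 M, (if (T : ℤ) ∣ (r : ℤ) + s then a else 0) =
          if T - r = s then a else 0 := by
        intro s hs
        rw [Finset.mem_Icc] at hs hr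
        have hiff : (T : ℤ) ∣ (r : ℤ) + s ↔ T - r = s := by
          constructor
          · intro hd
            have := Int.eq_zero_of_abs_lt_dvd (dvd_sub_self_right.2 hd : (T : ℤ) ∣ (r : ℤ) + s - T)
              (by rw [abs_lt]; omega)
            omega
          · intro hd
            have : (r : ℤ) + s = T := by omega
            rw [this]
        simp only [hiff]
      rw [Finset.sum_congr rfl this, Finset.sum_ite_eq]
      split_ifs
      · exact le_rfl
      · exact ha0
    · rw [Finset.sum_const, Nat.card_Icc, nsmul_eq_mul, Nat.add_sub_cancel]
  rw [variance_varEstimator hX]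
  have hsum := Finset.sum_le_sum hrow
  rw [Finset.sum_const, Nat.card_Icc, nsmul_eq_mul, Nat.add_sub_cancel] at hsum
  refine (mul_le_mul_of_nonneg_left hsum (sq_nonneg _)).trans ?_
  -- The two resonant terms per row give `2/M`; the remainder `w` over all `M²` pairs gives `1/T² +
  -- (1 + log T)⁴/T`, uniformly in `M`.
  have e : ((T : ℝ) / M) ^ 2 * (M * (K * (a + a + M * w))) =
      K * (2 * (1 / M) + 1 / (T : ℝ) ^ 2 + (1 + Real.log T) ^ 4 / T) := by
    rw [ha, hw]; field_simp; ring
  rw [e, mul_assoc]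
  refine mul_le_mul_of_nonneg_left ?_ hK
  have i1 := one_add_log_pow_four_div_le hT1 hM1
  have i2 : 1 / (T : ℝ) ^ 2 ≤ (M : ℝ) ^ 2 / (T : ℝ) ^ 2 :=
    div_le_div_of_nonneg_right (one_le_pow₀ hM1) (by positivity)
  have i3 : 0 ≤ 1 / (M : ℝ) := by positivity
  have i4 : 0 ≤ (M : ℝ) ^ 2 / (T : ℝ) ^ 2 := by positivity
  linarith

/-- The second moment of the estimator is bounded for `T ≤ M`. -/
theorem exists_integral_varEstimator_sq_le [IsProbabilityMeasure P]
    (hX : StationaryCumulantCondition P X 8) (hmean : ∀ t : ℤ, ∫ x, X t x ∂P = 0)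
    (hφ : LipWeight φ B Λ) : ∃ K : ℝ, 0 ≤ K ∧ ∀ T M : ℕ, 1 ≤ T → T ≤ M →
      ∫ x, varEstimator X φ T M x ^ 2 ∂P ≤ K := by
  obtain ⟨K, hK, h⟩ := exists_integral_norm_pow_four_orthSample_le hX hmean hφ
  have hB := hφ.bound_nonneg
  have hμ : 0 ≤ ∫ x, X 0 x ^ 8 ∂P := integral_nonneg fun x => by positivity
  refine ⟨2 * K + 2 * (B ^ 4 * ∫ x, X 0 x ^ 8 ∂P), by positivity, fun T M hT hTM => ?_⟩
  have hT0 : (0 : ℝ) < T := by exact_mod_cast hT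
  have hM0 : (0 : ℝ) < M := by exact_mod_cast (by omega : 0 < M)
  -- For `r` not divisible by `T` the fourth moment of `A_r` is `O(1/T²)`, which offsets the factor
  -- `T²`. For multiples of `T` it is only bounded, but there are at most `M / T` of them. Both
  -- parts are squared by Cauchy-Schwarz.
  set I₁ := (Finset.Icc 1 M).filter (fun r => ¬ T ∣ r) with hI₁
  set I₂ := (Finset.Icc 1 M).filter (fun r => T ∣ r) with hI₂
  set Q : ℕ → Ω → ℝ := fun r x => ‖orthSample X φ T (r : ℤ) x‖ ^ 2 with hQ
  set Z : Ω → ℝ := fun x => B ^ 4 * (1 / (T : ℝ) * ∑ t ∈ Finset.Icc (1 : ℤ) T, X t x ^ 8) with hZ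
  have hQm : ∀ r, MemLp (Q r) 2 P := fun r => memLp_norm_sq (memLp_orthSample hX φ T (r : ℤ))
  have hc1 : (I₁.card : ℝ) ≤ M := by
    have := Finset.card_filter_le (Finset.Icc 1 M) (fun r => ¬ T ∣ r)
    rw [Nat.card_Icc, Nat.add_sub_cancel] at this
    exact_mod_cast this
  have hc2 : (I₂.card : ℝ) ≤ M / T := by
    have e : I₂ = (Finset.Ioc 0 M).filter (fun r => T ∣ r) := rfl
    rw [e, Nat.Ioc_filter_dvd_card_eq_div]
    exact Nat.cast_div_le
  have hZ0 : ∀ x, 0 ≤ Z x := fun x => by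
    have : 0 ≤ ∑ t ∈ Finset.Icc (1 : ℤ) T, X t x ^ 8 :=
      Finset.sum_nonneg fun t _ => by positivity
    simp only [hZ]; positivity
  have hpt : ∀ x, varEstimator X φ T M x ^ 2 ≤
      2 * ((T : ℝ) ^ 2 / M) * ∑ r ∈ I₁, Q r x ^ 2 + 2 * Z x := by
    intro x
    have e : varEstimator X φ T M x = (T : ℝ) / M * (∑ r ∈ I₂, Q r x + ∑ r ∈ I₁, Q r x) := by
      rw [hI₁, hI₂, Finset.sum_filter_add_sum_filter_not]; rfl
    have s1 : (∑ r ∈ I₁, Q r x) ^ 2 ≤ M * ∑ r ∈ I₁, Q r x ^ 2 :=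
      sq_sum_le_card_mul_sum_sq.trans (mul_le_mul_of_nonneg_right hc1
        (Finset.sum_nonneg fun r _ => sq_nonneg _))
    have s2 : (∑ r ∈ I₂, Q r x) ^ 2 ≤ (M / T : ℝ) ^ 2 * Z x := by
      have hq : ∀ r ∈ I₂, Q r x ^ 2 ≤ Z x := by
        intro r hr
        have hd : (T : ℤ) ∣ (r : ℤ) := by exact_mod_cast (Finset.mem_filter.1 hr).2
        have := norm_orthSample_pow_le_of_dvd (X := X) hφ hT hd x
        simpa only [hQ, hZ, ← pow_mul] using this
      have := (Finset.sum_le_sum hq)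
      rw [Finset.sum_const, nsmul_eq_mul] at this
      refine sq_sum_le_card_mul_sum_sq.trans ((mul_le_mul_of_nonneg_left this
        (Nat.cast_nonneg _)).trans ?_)
      rw [← mul_assoc, ← sq]
      exact mul_le_mul_of_nonneg_right (pow_le_pow_left₀ (Nat.cast_nonneg _) hc2 2) (hZ0 x)
    have e1 : 2 * ((T : ℝ) ^ 2 / M) * ∑ r ∈ I₁, Q r x ^ 2 + 2 * Z x =
        ((T : ℝ) / M) ^ 2 * (2 * (M * ∑ r ∈ I₁, Q r x ^ 2) + 2 * ((M / T : ℝ) ^ 2 * Z x)) := by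
      field_simp
    rw [e, e1, mul_pow]
    refine mul_le_mul_of_nonneg_left ?_ (sq_nonneg _)
    linarith [add_sq_le (a := ∑ r ∈ I₂, Q r x) (b := ∑ r ∈ I₁, Q r x)]
  have hi1 : Integrable (fun x => ∑ r ∈ I₁, Q r x ^ 2) P :=
    integrable_finsetSum _ fun r _ => (hQm r).integrable_sq
  have hi2 : Integrable Z P :=
    ((integrable_finsetSum _ fun t _ => integrable_pow_eight hX t).const_mul _).const_mul _
  have hE1 : ∫ x, ∑ r ∈ I₁, Q r x ^ 2 ∂P ≤ M * (K / T ^ 2) := by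
    rw [integral_finsetSum _ fun r _ => (hQm r).integrable_sq]
    refine (Finset.sum_le_sum fun (r : ℕ) hr => h T (r : ℤ) hT (by
      exact_mod_cast (Finset.mem_filter.1 hr).2)).trans ?_
    rw [Finset.sum_const, nsmul_eq_mul]
    exact mul_le_mul_of_nonneg_right hc1 (by positivity)
  have hE2 : ∫ x, Z x ∂P = B ^ 4 * ∫ x, X 0 x ^ 8 ∂P := by
    simp only [hZ]
    rw [integral_const_mul, integral_const_mul,
      integral_finsetSum _ fun t _ => integrable_pow_eight hX t,
      Finset.sum_congr rfl fun t _ => integral_pow_eight hX t, Finset.sum_const, Int.card_Icc,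
      nsmul_eq_mul]
    simp only [add_sub_cancel_right, Int.toNat_natCast]
    field_simp
  calc ∫ x, varEstimator X φ T M x ^ 2 ∂P
      ≤ ∫ x, (2 * ((T : ℝ) ^ 2 / M) * ∑ r ∈ I₁, Q r x ^ 2 + 2 * Z x) ∂P :=
        integral_mono (memLp_varEstimator hX φ T M).integrable_sq
          ((hi1.const_mul _).add (hi2.const_mul _)) hpt
    _ = 2 * ((T : ℝ) ^ 2 / M) * ∫ x, ∑ r ∈ I₁, Q r x ^ 2 ∂P + 2 * ∫ x, Z x ∂P := by
      rw [integral_add (hi1.const_mul _) (hi2.const_mul _), integral_const_mul, integral_const_mul]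
    _ ≤ 2 * ((T : ℝ) ^ 2 / M) * (M * (K / T ^ 2)) + 2 * ∫ x, Z x ∂P := by gcongr
    _ = 2 * K + 2 * (B ^ 4 * ∫ x, X 0 x ^ 8 ∂P) := by rw [hE2]; field_simp

lemma lipWeight_of_lipschitzOnWith {L : ℝ≥0}
    (h : LipschitzOnWith L φ (Set.Icc 0 (2 * Real.pi))) :
    LipWeight φ (‖φ 0‖ + L * (2 * Real.pi)) L := by
  have hpi := Real.pi_pos
  have hl : ∀ ω ∈ Set.Icc 0 (2 * Real.pi), ∀ ω' ∈ Set.Icc 0 (2 * Real.pi),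
      ‖φ ω - φ ω'‖ ≤ L * |ω - ω'| := fun ω hω ω' hω' => by
    have := h.dist_le_mul ω hω ω' hω'
    rwa [dist_eq_norm, Real.dist_eq] at this
  refine ⟨fun ω hω => ?_, hl, by positivity, L.coe_nonneg⟩
  have i1 := hl ω hω 0 ⟨le_rfl, by positivity⟩
  have i2 : (L : ℝ) * |ω - 0| ≤ L * (2 * Real.pi) := by
    refine mul_le_mul_of_nonneg_left ?_ L.coe_nonneg
    rw [sub_zero, abs_of_nonneg hω.1]; exact hω.2
  have i3 := norm_le_norm_add_norm_sub' (φ ω) (φ 0)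
  linarith

/-- The bias-variance decomposition up to a factor two; the crude form suffices and treats a complex
centre `c` directly, as `limitVariance` is complex valued. -/
lemma integral_norm_sub_sq_le [IsProbabilityMeasure P] {V : Ω → ℝ} (hV : MemLp V 2 P) (c : ℂ) :
    ∫ x, ‖(V x : ℂ) - c‖ ^ 2 ∂P ≤
      2 * Var[V; P] + 2 * ‖((∫ x, V x ∂P : ℝ) : ℂ) - c‖ ^ 2 := by
  set m := ∫ x, V x ∂P with hm
  have hpt : ∀ x, ‖(V x : ℂ) - c‖ ^ 2 ≤ 2 * (V x - m) ^ 2 + 2 * ‖(m : ℂ) - c‖ ^ 2 := by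
    intro x
    have h1 := norm_sub_le_norm_sub_add_norm_sub (V x : ℂ) (m : ℂ) c
    rw [← Complex.ofReal_sub, Complex.norm_real, Real.norm_eq_abs] at h1
    refine (pow_le_pow_left₀ (norm_nonneg _) h1 2).trans ?_
    have h2 := add_sq_le (a := |V x - m|) (b := ‖(m : ℂ) - c‖)
    rw [sq_abs] at h2
    linarith
  have i1 : Integrable (fun x => (V x - m) ^ 2) P := (hV.sub (memLp_const m)).integrable_sq
  have i2 : Integrable (fun x => ‖(V x : ℂ) - c‖ ^ 2) P :=
    (hV.ofReal.sub (memLp_const c)).integrable_norm_pow (by norm_num)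
  refine (integral_mono i2 ((i1.const_mul 2).add (integrable_const _)) hpt).trans (le_of_eq ?_)
  simp only [Pi.add_apply]
  rw [integral_add (i1.const_mul 2) (integrable_const _), integral_const_mul,
    variance_eq_integral hV.aemeasurable]
  simp [hm]

end Estimator

end OrthogonalSample

/-! ### The mean square error bound -/

theorem mainTheorem4 {Ω : Type*} [MeasurableSpace Ω] (P : Measure Ω) [IsProbabilityMeasure P]
    (X : ℤ → Ω → ℝ) (hmean : ∀ t : ℤ, ∫ x, X t x ∂P = 0)
    (hX : OrthogonalSample.StationaryCumulantCondition P X 8)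
    (φ : ℝ → ℂ) (hφ : ∃ L : ℝ≥0, LipschitzOnWith L φ (Set.Icc 0 (2 * Real.pi))) :
    ∃ K : ℝ, ∀ T M : ℕ, 1 ≤ T → 1 ≤ M →
      MemLp (OrthogonalSample.varEstimator X φ T M) 2 P ∧
      ‖((∫ x, OrthogonalSample.varEstimator X φ T M x ∂P : ℝ) : ℂ)
          - OrthogonalSample.limitVariance P X φ‖ ≤ K * ((M : ℝ) / (T : ℝ)) ∧
      ∫ x, ‖(OrthogonalSample.varEstimator X φ T M x : ℂ)
          - OrthogonalSample.limitVariance P X φ‖ ^ 2 ∂P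
        ≤ K * ((M : ℝ) ^ 2 / (T : ℝ) ^ 2 + 1 / (M : ℝ)) := by
  obtain ⟨L, hL⟩ := hφ
  have hw := OrthogonalSample.lipWeight_of_lipschitzOnWith hL
  obtain ⟨D, hD, hbias⟩ := OrthogonalSample.exists_norm_bias_le hX hmean hw
  obtain ⟨K, hK, hvar⟩ := OrthogonalSample.exists_variance_varEstimator_le hX hmean hw
  obtain ⟨S, hS, hsq⟩ := OrthogonalSample.exists_integral_varEstimator_sq_le hX hmean hw
  set c := OrthogonalSample.limitVariance P X φ with hc
  have hc0 := norm_nonneg c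
  set E : ℝ := 1 + S + ‖c‖ with hE
  have hE0 : 0 ≤ E := by positivity
  -- `D`, `2K` and `2D²` serve the regime `M < T`, while `E` and `2S + 2E²` serve `T ≤ M`, where `E`
  -- bounds the bias and `S` the second moment.
  refine ⟨D + 2 * K + 2 * D ^ 2 + E + (2 * S + 2 * E ^ 2), fun T M hT hM => ?_⟩
  have hT0 : (0 : ℝ) < T := by exact_mod_cast hT
  have hM0 : (0 : ℝ) < M := by exact_mod_cast hM
  have hmem := OrthogonalSample.memLp_varEstimator hX φ T M
  have hint := OrthogonalSample.integral_norm_sub_sq_le hmem c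
  have q0 : 0 ≤ (M : ℝ) / T := by positivity
  have q1 : 0 ≤ (M : ℝ) ^ 2 / (T : ℝ) ^ 2 := by positivity
  have q2 : 0 ≤ 1 / (M : ℝ) := by positivity
  refine ⟨hmem, ?_⟩
  rcases lt_or_ge M T with h | h
  · have i1 := hbias T M hM h
    have i2 := hvar T M hM h
    have i3 := pow_le_pow_left₀ (norm_nonneg _) i1 2
    rw [mul_pow, div_pow] at i3
    constructor
    · refine i1.trans (mul_le_mul_of_nonneg_right ?_ q0)
      have : 0 ≤ 2 * K + 2 * D ^ 2 + E + (2 * S + 2 * E ^ 2) := by positivity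
      linarith
    · have p1 : 0 ≤ (D + E + (2 * S + 2 * E ^ 2)) * ((M : ℝ) ^ 2 / (T : ℝ) ^ 2 + 1 / (M : ℝ)) := by
        positivity
      have p2 : 0 ≤ 2 * D ^ 2 * (1 / (M : ℝ)) := by positivity
      linarith
  · have hTM : (T : ℝ) ≤ M := by exact_mod_cast h
    -- In this regime the bounds claimed are at least the constant itself, so it is enough that bias
    -- and mean square error are bounded.
    have j1 : 1 ≤ (M : ℝ) / T := (one_le_div hT0).2 hTM
    have j2 : 1 ≤ (M : ℝ) ^ 2 / (T : ℝ) ^ 2 := by rw [← div_pow]; exact one_le_pow₀ j1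
    have i1 := hsq T M hT h
    have hv0 := variance_nonneg (OrthogonalSample.varEstimator X φ T M) P
    have hv : Var[OrthogonalSample.varEstimator X φ T M; P] =
        ∫ x, OrthogonalSample.varEstimator X φ T M x ^ 2 ∂P -
          (∫ x, OrthogonalSample.varEstimator X φ T M x ∂P) ^ 2 := by
      rw [variance_eq_sub hmem]; rfl
    set m := ∫ x, OrthogonalSample.varEstimator X φ T M x ∂P with hm
    -- Nonnegativity of the variance gives `m² ≤ S`, and `|m| ≤ 1 + m²`.
    have i2 : |m| ≤ 1 + S := by
      have : m ^ 2 ≤ S := by linarith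
      rw [← sq_abs] at this
      nlinarith [sq_nonneg (|m| - 1), sq_nonneg |m|]
    have i3 : ‖(m : ℂ) - c‖ ≤ E := by
      refine (norm_sub_le _ _).trans ?_
      rw [Complex.norm_real, Real.norm_eq_abs]
      linarith
    have i4 := pow_le_pow_left₀ (norm_nonneg _) i3 2
    have p0 : 0 ≤ D + 2 * K + 2 * D ^ 2 + E + (2 * S + 2 * E ^ 2) := by positivity
    constructor
    · have := le_mul_of_one_le_right p0 j1
      have : 0 ≤ D + 2 * K + 2 * D ^ 2 + (2 * S + 2 * E ^ 2) := by positivity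
      linarith
    · have := le_mul_of_one_le_right p0 (by linarith :
        1 ≤ (M : ℝ) ^ 2 / (T : ℝ) ^ 2 + 1 / (M : ℝ))
      have : 0 ≤ D + 2 * K + 2 * D ^ 2 + E := by positivity
      have : 0 ≤ m ^ 2 := sq_nonneg m
      linarith
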